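/- Let $p\ge 3$, $\lambda=2\cos(\pi/p)$, $S=\begin{pmatrix}1&\lambda\\0&1\end{pmatrix}$, $T=\begin{pmatrix}0&-1\\1&0\end{pmatrix}$, $U=ST$, and let $G_p\subseteq \mathrm{PSL}(2,\mathbb R)$ be the Hecke group generated by $S$ and $T$. An element of $G_p$ is hyperbolic if $|\mathrm{tr}|>2$, and primitive if it is not of the form $h^n$ with $h\in G_p$, $n\ge 2$; a conjugacy class of $G_p$ is primitive hyperbolic if it contains an element that is both. *Irreducible systems of poles.* For an integer $k\ge 1$ put $(q\mid M)(z)=(cz+d)^{-2k}q\left(\frac{az+b}{cz+d}\right)$. A rational period function (RPF) of weight $2k$ on $G_p$ is a rational function $q$ over $\mathbb C$ with $q+q\mid T=0$ and $q+q\mid U+\dots+q\mid U^{p-1}=0$. An irreducible system of poles (ISP) for $G_p$ is a set of the form $$\{y\in\mathbb C\setminus\{0\}: \text{every RPF on } G_p \text{ (of any weight } 2k,\ k\geq 1) \text{ with a pole at } z \text{ has a pole at } y\},$$ where $z\ne0$ is a pole of at least one RPF on $G_p$ of some weight $2k$, $k\ge1$. *Simple numbers.* To $M=\begin{pmatrix}a&b\\c&d\end{pmatrix}$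 with positive trace attach the form $Q_M=[A,B,C]=[c,\,d-a,\,-b]$, that is, $Ax^2+Bxy+Cy^2$. Two forms are $G_p$-equivalent if one is carried to the other by the substitution $(x,y)\mapsto(ax+by,cx+dy)$ for some element of $G_p$. To a primitive hyperbolic conjugacy class attach the $G_p$-equivalence class $\mathcal A$ of the forms $Q_M$, where $M$ runs over the matrices of positive trace representing its elements. Let $$Z_{\mathcal A}=\left\{\frac{-B+\sqrt{B^2-4AC}}{2A}: [A,B,C]\in\mathcal A,\ A>0>C\right\}$$ be its set of simple numbers, and put $P_{\mathcal A}=Z_{\mathcal A}\cup TZ_{\mathcal A}$, where $Tx=-1/x$. *Continued fractions.* The $\lambda$-continued fraction of a real number $\alpha$ has the entries $r_j=\lfloor\alpha_j/\lambda\rfloor+1$, where $\alpha_0=\alpha$ and $\alpha_{j+1}=1/(r_j\lambda-\alpha_j)$ for $j\ge 0$. The number $\alpha$ is reduced if the sequence of its entries is purely periodic, with a period that is not a cyclic permutation of $2,1,\dots,1$ ($p-3$ ones). **Theorem.** The map sending a primitive hyperbolic conjugacy class with associated class of forms $\mathcal A$ to $P_{\mathcal A}$ is a bijection from the set of primitive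 hyperbolic conjugacy classes of $G_p$ onto the set of ISPs of RPFs on $G_p$. Explicitly, let $V_j=U^{j-1}S$ for $1\le j\le p-1$. Every primitive hyperbolic conjugacy class of $G_p$ contains a product $$W=V_1^{m_1}V_{j_1}V_1^{m_2}V_{j_2}\cdots V_1^{m_\ell}V_{j_\ell},\qquad \ell\ge1,\ m_t\ge0,\ 2\le j_t\le p-1 .$$ Moreover, for every such product $W$ that is primitive and hyperbolic and every $1\le t\le \ell$ there is exactly one real number $\beta_t$ whose $\lambda$-continued fraction is purely periodic with the (repeated) period $$m_t+2,\underbrace{1,\dots,1}_{j_t-2},\,m_{t+1}+2,\underbrace{1,\dots,1}_{j_{t+1}-2},\,\dots,\,m_{t-1}+2,\underbrace{1,\dots,1}_{j_{t-1}-2}$$ (indices modulo $\ell$); this $\beta_t$ is reduced, and the class $\mathcal A$ associated with the conjugacy class of $W$ has $$Z_{\mathcal A}=\{S^{-i}\beta_t: 1\le t\le \ell,\ 1\le i\le m_t+1\},\qquad S^{-i}\beta_t=\beta_t-i\lambda .$$ -/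

import Mathlib

open scoped MatrixGroups

namespace HeckeRPF

noncomputable section

/-! ### The Hecke groups -/

/-- `λ_p = 2 cos(π / p)`. -/
def lam (p : ℕ) : ℝ := 2 * Real.cos (Real.pi / p)

/-- `S = (1 λ; 0 1)`. -/
def matS (p : ℕ) : SL(2, ℝ) := ⟨!![1, lam p; 0, 1], by simp [Matrix.det_fin_two]⟩

/-- `T = (0 -1; 1 0)`. -/
def matT : SL(2, ℝ) := ⟨!![0, -1; 1, 0], by simp [Matrix.det_fin_two]⟩

/-- `U = S T`. -/
def matU (p : ℕ) : SL(2, ℝ) := matS p * matT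

/-- The image in `PSL(2, ℝ)` of a matrix in `SL(2, ℝ)`. -/
def toPSL (M : SL(2, ℝ)) : PSL(2, ℝ) := QuotientGroup.mk M

/-- The Hecke group `G_p`, the subgroup of `PSL(2, ℝ)` generated by `S` and `T`. -/
def heckeGroup (p : ℕ) : Subgroup PSL(2, ℝ) :=
  Subgroup.closure {toPSL (matS p), toPSL matT}

/-- `S` as an element of `G_p`. -/
def genS (p : ℕ) : heckeGroup p :=
  ⟨toPSL (matS p), Subgroup.subset_closure (Set.mem_insert _ _)⟩

/-- `T` as an element of `G_p`. -/
def genT (p : ℕ) : heckeGroup p :=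
  ⟨toPSL matT, Subgroup.subset_closure (Set.mem_insert_of_mem _ rfl)⟩

/-- `U = S T` as an element of `G_p`. -/
def genU (p : ℕ) : heckeGroup p := genS p * genT p

/-- The Möbius action of a matrix on a (finite) real number. -/
def moebius (M : SL(2, ℝ)) (x : ℝ) : ℝ := (M 0 0 * x + M 0 1) / (M 1 0 * x + M 1 1)

/-- The matrix `M` represents the element `g` of `G_p`. -/
def Represents {p : ℕ} (M : SL(2, ℝ)) (g : heckeGroup p) : Prop :=
  toPSL M = (g : PSL(2, ℝ))

/-- `g` is hyperbolic: `|a + d| > 2` (this does not depend on the sign of the matrix). -/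
def IsHyperbolic {p : ℕ} (g : heckeGroup p) : Prop :=
  ∃ M : SL(2, ℝ), Represents M g ∧ 2 < |M 0 0 + M 1 1|

/-- `g` is primitive: it is not a power `h ^ n`, `n ≥ 2`, of an element of `G_p`. -/
def IsPrimitive {p : ℕ} (g : heckeGroup p) : Prop :=
  ∀ (h : heckeGroup p) (n : ℕ), 2 ≤ n → h ^ n ≠ g

/-- A primitive hyperbolic conjugacy class of `G_p`. -/
def IsPrimitiveHyperbolicClass {p : ℕ} (c : ConjClasses (heckeGroup p)) : Prop :=
  ∃ g : heckeGroup p, ConjClasses.mk g = c ∧ IsPrimitive g ∧ IsHyperbolic g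

/-! ### Conjugacy class generators -/

/-- The conjugacy class generator `V_j = U ^ (j - 1) S`, for `1 ≤ j ≤ p - 1`. -/
def genV (p j : ℕ) : heckeGroup p := genU p ^ (j - 1) * genS p

/-- For `w = [(m₁, j₁), …, (m_ℓ, j_ℓ)]` the product
`W = V_1 ^ m₁ * V_{j₁} * ⋯ * V_1 ^ m_ℓ * V_{j_ℓ}`. -/
def genProduct (p : ℕ) (w : List (ℕ × ℕ)) : heckeGroup p :=
  (w.map fun b => genV p 1 ^ b.1 * genV p b.2).prod

/-- The exponent data of a generator product: `ℓ ≥ 1`, `m_t ≥ 0`, `2 ≤ j_t ≤ p - 1`. -/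
def IsProductData (p : ℕ) (w : List (ℕ × ℕ)) : Prop :=
  w ≠ [] ∧ ∀ b ∈ w, 2 ≤ b.2 ∧ b.2 ≤ p - 1

/-! ### Continued fractions -/

/-- The complete quotients `α_j` of the `λ`-continued fraction of `α`:
`α_0 = α` and `α_{j+1} = 1 / (r_j λ - α_j)`, where `r_j = ⌊α_j / λ⌋ + 1`. -/
def cfQuotient (p : ℕ) (x : ℝ) : ℕ → ℝ
  | 0 => x
  | n + 1 => 1 / (((⌊cfQuotient p x n / lam p⌋ + 1 : ℤ) : ℝ) * lam p - cfQuotient p x n)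

/-- The entries `r_j = ⌊α_j / λ⌋ + 1` of the `λ`-continued fraction of `α`. -/
def cfEntry (p : ℕ) (x : ℝ) (n : ℕ) : ℤ := ⌊cfQuotient p x n / lam p⌋ + 1

/-- The `λ`-continued fraction of `x` is purely periodic with (not necessarily minimal)
period `L`. -/
def HasCFPeriod (p : ℕ) (x : ℝ) (L : List ℤ) : Prop :=
  L ≠ [] ∧ ∀ n : ℕ, cfEntry p x n = L.getD (n % L.length) 0

/-- `β` is `G_p`-reduced: its `λ`-continued fraction is purely periodic, and the period is not
a cyclic permutation of `2, 1, …, 1` (with `p - 3` ones). -/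
def IsReduced (p : ℕ) (b : ℝ) : Prop :=
  (∃ L : List ℤ, HasCFPeriod p b L) ∧
    ∀ s : ℕ, ¬ HasCFPeriod p b ((2 :: List.replicate (p - 3) 1).rotate s)

/-- The period `m₁ + 2, 1, …, 1, m₂ + 2, 1, …, 1, …, m_ℓ + 2, 1, …, 1`, where the `t`-th run of
ones has length `j_t - 2`. -/
def periodOf (w : List (ℕ × ℕ)) : List ℤ :=
  w.flatMap fun b => ((b.1 : ℤ) + 2) :: List.replicate (b.2 - 2) 1

/-! ### Binary quadratic forms and simple numbers -/

/-- The binary quadratic form `[A, B, C] = A x² + B x y + C y²`. -/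
@[ext] structure BQF where
  A : ℝ
  B : ℝ
  C : ℝ

/-- `(Q ∘ M)(x, y) = Q (a x + b y, c x + d y)`. -/
def BQF.comp (Q : BQF) (M : SL(2, ℝ)) : BQF where
  A := Q.A * M 0 0 ^ 2 + Q.B * M 0 0 * M 1 0 + Q.C * M 1 0 ^ 2
  B := 2 * Q.A * M 0 0 * M 0 1 + Q.B * (M 0 0 * M 1 1 + M 0 1 * M 1 0)
    + 2 * Q.C * M 1 0 * M 1 1
  C := Q.A * M 0 1 ^ 2 + Q.B * M 0 1 * M 1 1 + Q.C * M 1 1 ^ 2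

/-- `G_p`-equivalence of forms. -/
def BQF.Equivalent (p : ℕ) (Q R : BQF) : Prop :=
  ∃ M : SL(2, ℝ), toPSL M ∈ heckeGroup p ∧ R = Q.comp M

/-- The form `Q_M = [c, d - a, -b]`. -/
def formOf (M : SL(2, ℝ)) : BQF := ⟨M 1 0, M 1 1 - M 0 0, - M 0 1⟩

/-- The number `α_Q = (-B + √D) / (2A)`, `D = B² - 4AC`. -/
def BQF.root (Q : BQF) : ℝ := (-Q.B + √(Q.B ^ 2 - 4 * Q.A * Q.C)) / (2 * Q.A)

/-- A form is simple if `A > 0 > C`. -/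
def BQF.IsSimple (Q : BQF) : Prop := 0 < Q.A ∧ Q.C < 0

/-- The `G_p`-equivalence class of forms that corresponds to a (primitive hyperbolic) conjugacy
class `c`: the forms equivalent to `Q_M`, where `M` is a matrix of positive trace that represents
an element of `c`. -/
def formClass {p : ℕ} (c : ConjClasses (heckeGroup p)) : Set BQF :=
  {Q | ∃ (g : heckeGroup p) (M : SL(2, ℝ)), ConjClasses.mk g = c ∧ Represents M g ∧
    0 < M 0 0 + M 1 1 ∧ BQF.Equivalent p (formOf M) Q}

/-- `Z_𝒜`, the set of simple numbers of a class `𝒜` of (hyperbolic) forms. -/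
def simpleNumbers (𝒜 : Set BQF) : Set ℝ := {x | ∃ Q ∈ 𝒜, Q.IsSimple ∧ x = Q.root}

/-- `P_𝒜 = Z_𝒜 ∪ T Z_𝒜`, as a set of complex numbers. -/
def poleSet (𝒜 : Set BQF) : Set ℂ :=
  (fun x : ℝ => (x : ℂ)) '' (simpleNumbers 𝒜 ∪ moebius matT '' simpleNumbers 𝒜)

/-! ### Rational period functions and irreducible systems of poles -/

/-- The slash operator `(q | M)(z) = (c z + d)^(-2k) q((a z + b) / (c z + d))` of weight `2k`
on rational functions. -/
def slash (k : ℕ) (q : RatFunc ℂ) (M : SL(2, ℝ)) : RatFunc ℂ :=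
  let e : ℝ → RatFunc ℂ := fun r => RatFunc.C (r : ℂ)
  (e (M 1 0) * RatFunc.X + e (M 1 1)) ^ (-(2 * (k : ℤ))) *
    RatFunc.eval RatFunc.C
      ((e (M 0 0) * RatFunc.X + e (M 0 1)) / (e (M 1 0) * RatFunc.X + e (M 1 1))) q

/-- `q` is a rational period function of weight `2k` for `G_p`: `q + q | T = 0` and
`q + q | U + ⋯ + q | U ^ (p - 1) = 0`. -/
def IsRPF (p k : ℕ) (q : RatFunc ℂ) : Prop :=
  q + slash k q matT = 0 ∧ ∑ j ∈ Finset.range p, slash k q (matU p ^ j) = 0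

/-- `z ∈ ℂ` is a pole of the rational function `q`. -/
def IsPole (q : RatFunc ℂ) (z : ℂ) : Prop := q.denom.IsRoot z

/-- Whenever `z` is a pole of a rational period function for `G_p`, of any positive weight `2k`,
so is `y`. -/
def Forces (p : ℕ) (z y : ℂ) : Prop :=
  ∀ (k : ℕ) (q : RatFunc ℂ), 0 < k → IsRPF p k q → IsPole q z → IsPole q y

/-- `P` is an irreducible system of poles for `G_p`: the set of all nonzero numbers that are forced
to occur as poles together with some number `z ≠ 0` that does occur as a pole of a rational period
function. -/
def IsISP (p : ℕ) (P : Set ℂ) : Prop :=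
  ∃ z : ℂ, z ≠ 0 ∧ (∃ (k : ℕ) (q : RatFunc ℂ), 0 < k ∧ IsRPF p k q ∧ IsPole q z) ∧
    P = {y | y ≠ 0 ∧ Forces p z y}

end

end HeckeRPF

/-!
Let `V_j = U ^ (j - 1) S` for `1 ≤ j ≤ p - 1`. These matrices have nonnegative entries, and they map
the positive half line into pairwise disjoint intervals `I_j`. So the map `shift`, which sends
`V_j y` to `y`, is well defined on the union of the `I_j`, and a point has at most one itinerary of
given length (`wordMat_moebius_injective`). Everything in the theorem is a statement about the
periodic orbits of `shift`.

*Simple numbers.* A form `Q_M` is simple exactly if all entries of `M` are positive, and then its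
root is the positive fixed point of `M`. The normal form `± A N B`, with `A, B ∈ {1, T}` and a
product `N` of matrices `V_j`, shows by comparison of signs that a matrix of the Hecke group with
positive entries is a product of matrices `V_j` (`PosEntries.exists_word`). Hence the simple numbers
of a class are the positive fixed points of the words in it, they form exactly one orbit of the
shift (`mem_simpleNumbers_iff_exists_iterate`), and the primitive class is recovered from the word
that describes one period of this orbit (`eq_of_mem_simpleNumbers`,
`exists_class_of_mem_periodicPts`). Cyclic reduction shows that every hyperbolic element is
conjugate to a word (`exists_word_of_hyperbolic`).

*Continued fractions.* On `x + λ` the complete quotients of the `λ`-continued fraction pass through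
`U⁻¹, U⁻², …`, so that one block `V_1 ^ m V_j` of an itinerary corresponds to the entries
`m + 2, 1, …, 1` (`cf_moebius_expand`). Conversely a number with the given period has an infinite
backward orbit under a hyperbolic word, which contracts to its attracting fixed point
(`PosEntries.eq_of_backward_orbit`).

*Poles.* If `q` is a rational period function with a pole at `z ≠ 0`, then `q | T = -q` gives a
pole at `T z`, and the relation for the powers of `U` gives a further pole `U ^ j (T z) = V_j z`
whenever `z` lies in the closed right half plane (`IsRPF.exists_isPole_matV`). Since there are only
finitely many poles, the poles in the closed right half plane other than `0` are positive real
numbers and they are permuted by the shift (`IsRPF.im_eq_zero`, `IsRPF.shift_isPole`). So a system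
of poles contains the whole orbit and its image under `T`. In weight two there is nothing else: a
rational function `q` with `q dz` having residue `1` at the points of an orbit and `-1` at their
images under `T` satisfies both relations, because each holds for the divisor of residues
(`exists_isRPF`).
-/

namespace HeckeRPF

noncomputable section

/-! ### Two by two matrices of determinant one -/

lemma mul_apply_00 (M N : SL(2, ℝ)) : (M * N) 0 0 = M 0 0 * N 0 0 + M 0 1 * N 1 0 := by
  simp [Matrix.mul_apply, Fin.sum_univ_two]

lemma mul_apply_01 (M N : SL(2, ℝ)) : (M * N) 0 1 = M 0 0 * N 0 1 + M 0 1 * N 1 1 := by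
  simp [Matrix.mul_apply, Fin.sum_univ_two]

lemma mul_apply_10 (M N : SL(2, ℝ)) : (M * N) 1 0 = M 1 0 * N 0 0 + M 1 1 * N 1 0 := by
  simp [Matrix.mul_apply, Fin.sum_univ_two]

lemma mul_apply_11 (M N : SL(2, ℝ)) : (M * N) 1 1 = M 1 0 * N 0 1 + M 1 1 * N 1 1 := by
  simp [Matrix.mul_apply, Fin.sum_univ_two]

lemma inv_apply_00 (M : SL(2, ℝ)) : M⁻¹ 0 0 = M 1 1 := by
  simp [Matrix.SpecialLinearGroup.SL2_inv_expl M]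

lemma inv_apply_01 (M : SL(2, ℝ)) : M⁻¹ 0 1 = -M 0 1 := by
  simp [Matrix.SpecialLinearGroup.SL2_inv_expl M]

lemma inv_apply_10 (M : SL(2, ℝ)) : M⁻¹ 1 0 = -M 1 0 := by
  simp [Matrix.SpecialLinearGroup.SL2_inv_expl M]

lemma inv_apply_11 (M : SL(2, ℝ)) : M⁻¹ 1 1 = M 0 0 := by
  simp [Matrix.SpecialLinearGroup.SL2_inv_expl M]

lemma neg_apply (M : SL(2, ℝ)) (i j : Fin 2) : (-M) i j = -M i j := by
  simp [Matrix.SpecialLinearGroup.coe_neg]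

lemma det_eq_one (M : SL(2, ℝ)) : M 0 0 * M 1 1 - M 0 1 * M 1 0 = 1 := by
  rw [← Matrix.det_fin_two]; exact M.2

lemma ext_entries {M N : SL(2, ℝ)} (h00 : M 0 0 = N 0 0) (h01 : M 0 1 = N 0 1)
    (h10 : M 1 0 = N 1 0) (h11 : M 1 1 = N 1 1) : M = N := by
  ext i j; fin_cases i <;> fin_cases j <;> assumption

@[simp] lemma matT_00 : matT 0 0 = 0 := by simp [matT]
@[simp] lemma matT_01 : matT 0 1 = -1 := by simp [matT]
@[simp] lemma matT_10 : matT 1 0 = 1 := by simp [matT]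
@[simp] lemma matT_11 : matT 1 1 = 0 := by simp [matT]
@[simp] lemma matS_00 (p : ℕ) : matS p 0 0 = 1 := by simp [matS]
@[simp] lemma matS_01 (p : ℕ) : matS p 0 1 = lam p := by simp [matS]
@[simp] lemma matS_10 (p : ℕ) : matS p 1 0 = 0 := by simp [matS]
@[simp] lemma matS_11 (p : ℕ) : matS p 1 1 = 1 := by simp [matS]
@[simp] lemma matU_00 (p : ℕ) : matU p 0 0 = lam p := by simp [matU, mul_apply_00]
@[simp] lemma matU_01 (p : ℕ) : matU p 0 1 = -1 := by simp [matU, mul_apply_01]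
@[simp] lemma matU_10 (p : ℕ) : matU p 1 0 = 1 := by simp [matU, mul_apply_10]
@[simp] lemma matU_11 (p : ℕ) : matU p 1 1 = 0 := by simp [matU, mul_apply_11]

lemma matT_mul_matT : matT * matT = -1 := by
  apply ext_entries
  · simp [mul_apply_00]
  · simp [mul_apply_01]
  · simp [mul_apply_10]
  · simp [mul_apply_11]

lemma matT_inv : matT⁻¹ = -matT := by
  rw [inv_eq_iff_mul_eq_one]; simp [matT_mul_matT]

lemma matT_mul_matT_mul (M : SL(2, ℝ)) : matT * (matT * M) = -M := by
  rw [← mul_assoc, matT_mul_matT]; simp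

lemma matU_mul_matT (p : ℕ) : matU p * matT = -matS p := by
  rw [matU, mul_assoc, matT_mul_matT]; simp

/-! ### Powers of `U` and the matrices `V_j` -/

/-- The ratio `sin (n π / p) / sin (π / p)`, which gives the entries of the powers of `U`. -/
def sinRatio (p n : ℕ) : ℝ := Real.sin (n * (Real.pi / p)) / Real.sin (Real.pi / p)

lemma sin_pi_div_pos {p : ℕ} (hp : 3 ≤ p) : 0 < Real.sin (Real.pi / p) := by
  have h3 : (3 : ℝ) ≤ p := by exact_mod_cast hp
  apply Real.sin_pos_of_pos_of_lt_pi
  · have := Real.pi_pos; positivity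
  · exact div_lt_self Real.pi_pos (by linarith)

@[simp] lemma sinRatio_zero (p : ℕ) : sinRatio p 0 = 0 := by simp [sinRatio]

lemma sinRatio_one {p : ℕ} (hp : 3 ≤ p) : sinRatio p 1 = 1 := by
  simp [sinRatio, (sin_pi_div_pos hp).ne']

lemma sinRatio_add_two (p n : ℕ) :
    sinRatio p (n + 2) = lam p * sinRatio p (n + 1) - sinRatio p n := by
  simp only [sinRatio, lam]
  rw [← mul_div_assoc (2 * Real.cos _), ← sub_div]
  congr 1
  push_cast
  have h1 := Real.sin_add ((n + 1) * (Real.pi / p)) (Real.pi / p)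
  have h2 := Real.sin_sub ((n + 1) * (Real.pi / p)) (Real.pi / p)
  rw [show ((n : ℝ) + 2) * (Real.pi / p) = (n + 1) * (Real.pi / p) + Real.pi / p by ring,
    show (n : ℝ) * (Real.pi / p) = (n + 1) * (Real.pi / p) - Real.pi / p by ring, h1, h2]
  ring

lemma sinRatio_two {p : ℕ} (hp : 3 ≤ p) : sinRatio p 2 = lam p := by
  rw [sinRatio_add_two, sinRatio_one hp]; simp

lemma sinRatio_self {p : ℕ} (hp : 3 ≤ p) : sinRatio p p = 0 := by
  have : (p : ℝ) ≠ 0 := by positivity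
  simp [sinRatio, mul_div_cancel₀ _ this]

lemma sinRatio_reflect {p n : ℕ} (hp : 3 ≤ p) (h : n ≤ p) : sinRatio p (p - n) = sinRatio p n := by
  have : (p : ℝ) ≠ 0 := by positivity
  simp only [sinRatio]
  rw [Nat.cast_sub h, sub_mul, mul_div_cancel₀ _ this, Real.sin_pi_sub]

lemma sinRatio_nonneg {p n : ℕ} (hp : 3 ≤ p) (h : n ≤ p) : 0 ≤ sinRatio p n := by
  have hpos : (0 : ℝ) < p := by positivity
  have := Real.pi_pos
  refine div_nonneg (Real.sin_nonneg_of_nonneg_of_le_pi (by positivity) ?_) (sin_pi_div_pos hp).le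
  rw [mul_div_assoc', div_le_iff₀ hpos, mul_comm]
  have : (n : ℝ) ≤ p := by exact_mod_cast h
  gcongr

lemma one_le_sinRatio {p n : ℕ} (hp : 3 ≤ p) (h1 : 1 ≤ n) (h2 : n < p) : 1 ≤ sinRatio p n := by
  have hpos : (0 : ℝ) < p := by positivity
  have hpi := Real.pi_pos
  -- by the symmetry `n ↦ p - n` the angle may be taken in the range where the sine increases
  have key : ∀ m : ℕ, 1 ≤ m → 2 * m ≤ p → 1 ≤ sinRatio p m := by
    intro m hm hmp
    rw [sinRatio, one_le_div (sin_pi_div_pos hp)]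
    have hm' : (1 : ℝ) ≤ m := by exact_mod_cast hm
    have hmp' : 2 * (m : ℝ) ≤ p := by exact_mod_cast hmp
    apply Real.sin_le_sin_of_le_of_le_pi_div_two
    · have : 0 < Real.pi / p := by positivity
      linarith
    · rw [mul_div_assoc', div_le_iff₀ hpos]
      nlinarith
    · have : 0 ≤ Real.pi / p := by positivity
      nlinarith
  rcases le_total (2 * n) p with h | h
  · exact key n h1 h
  · rw [← sinRatio_reflect hp h2.le]
    exact key _ (by omega) (by omega)

lemma one_le_lam {p : ℕ} (hp : 3 ≤ p) : 1 ≤ lam p := by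
  rw [← sinRatio_two hp]; exact one_le_sinRatio hp (by omega) (by omega)

lemma lam_pos {p : ℕ} (hp : 3 ≤ p) : 0 < lam p := by linarith [one_le_lam hp]

/-- The matrix `V_j = U ^ (j - 1) S`, which is meaningful for `j ≥ 1`. -/
def matV (p j : ℕ) : SL(2, ℝ) := matU p ^ (j - 1) * matS p

lemma matV_one (p : ℕ) : matV p 1 = matS p := by simp [matV]

lemma matU_mul_matV {p j : ℕ} (hj : 1 ≤ j) : matU p * matV p j = matV p (j + 1) := by
  obtain ⟨i, rfl⟩ := Nat.exists_eq_add_of_le' hj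
  simp [matV, pow_succ', mul_assoc]

lemma matV_succ_entries {p : ℕ} (hp : 3 ≤ p) (i : ℕ) :
    matV p (i + 1) 0 0 = sinRatio p (i + 1) ∧ matV p (i + 1) 0 1 = sinRatio p (i + 2) ∧
      matV p (i + 1) 1 0 = sinRatio p i ∧ matV p (i + 1) 1 1 = sinRatio p (i + 1) := by
  induction i with
  | zero => simp [matV_one, sinRatio_one hp, sinRatio_two hp]
  | succ i ih =>
    obtain ⟨h1, h2, h3, h4⟩ := ih
    rw [← matU_mul_matV (by omega)]
    simp only [mul_apply_00, mul_apply_01, mul_apply_10, mul_apply_11, h1, h2, h3, h4]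
    refine ⟨?_, ?_, ?_, ?_⟩
    · rw [sinRatio_add_two p i]; simp [sub_eq_add_neg]
    · rw [sinRatio_add_two p (i + 1)]; simp [sub_eq_add_neg]
    · simp
    · simp

/-- The next matrix in the sequence `V_1, …, V_{p-1}` is `T`. -/
lemma matV_self {p : ℕ} (hp : 3 ≤ p) : matV p p = matT := by
  obtain ⟨i, rfl⟩ := Nat.exists_eq_add_of_le' (show 1 ≤ p by omega)
  obtain ⟨h1, h2, h3, h4⟩ := matV_succ_entries hp i
  have h0 := sinRatio_self hp
  have hi : sinRatio (i + 1) i = 1 := by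
    have := sinRatio_reflect hp (n := 1) (by omega)
    rwa [sinRatio_one hp, Nat.add_sub_cancel] at this
  apply ext_entries
  · simp [h1, h0]
  · rw [h2, sinRatio_add_two, h0, hi]; simp
  · simp [h3, hi]
  · simp [h4, h0]

lemma matU_pow_self {p : ℕ} (hp : 3 ≤ p) : matU p ^ p = -1 := by
  have h := matV_self hp
  have hU : matS p = -(matU p * matT) := by rw [matU_mul_matT]; simp
  have : matU p ^ p * matT = -matT := by
    rw [matV, hU, mul_neg, ← mul_assoc, ← pow_succ, Nat.sub_add_cancel (by omega)] at h
    exact neg_eq_iff_eq_neg.mp h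
  calc matU p ^ p = matU p ^ p * matT * matT⁻¹ := by simp
    _ = -1 := by rw [this]; simp

lemma matV_mul_matT {p j : ℕ} (hj : 1 ≤ j) : matV p j * matT = matU p ^ j := by
  rw [matV, mul_assoc, ← matU, ← pow_succ, Nat.sub_add_cancel hj]

lemma matV_eq_neg {p j : ℕ} (hj : 1 ≤ j) : matV p j = -(matU p ^ j * matT) := by
  rw [← matV_mul_matT hj, mul_assoc, matT_mul_matT]; simp

lemma matV_add_self {p j : ℕ} (hp : 3 ≤ p) (hj : 1 ≤ j) : matV p (p + j) = -matV p j := by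
  rw [matV_eq_neg hj, matV_eq_neg (by omega), pow_add, matU_pow_self hp]; simp

/-- Nonnegative matrices with diagonal entries at least one. They form a monoid. -/
structure NonnegEntries (M : SL(2, ℝ)) : Prop where
  one_le_00 : 1 ≤ M 0 0
  nonneg_01 : 0 ≤ M 0 1
  nonneg_10 : 0 ≤ M 1 0
  one_le_11 : 1 ≤ M 1 1

lemma NonnegEntries.one : NonnegEntries 1 := by
  constructor <;> simp

lemma NonnegEntries.mul {M N : SL(2, ℝ)} (hM : NonnegEntries M) (hN : NonnegEntries N) :
    NonnegEntries (M * N) := by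
  obtain ⟨a1, a2, a3, a4⟩ := hM
  obtain ⟨b1, b2, b3, b4⟩ := hN
  constructor
  · rw [mul_apply_00]; nlinarith [mul_nonneg a2 b3]
  · rw [mul_apply_01]; nlinarith [mul_nonneg a2 (by linarith : (0 : ℝ) ≤ N 1 1)]
  · rw [mul_apply_10]; nlinarith [mul_nonneg a3 (by linarith : (0 : ℝ) ≤ N 0 0)]
  · rw [mul_apply_11]; nlinarith [mul_nonneg a3 b2]

lemma nonnegEntries_matV {p j : ℕ} (hp : 3 ≤ p) (h1 : 1 ≤ j) (h2 : j ≤ p - 1) :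
    NonnegEntries (matV p j) := by
  obtain ⟨i, rfl⟩ := Nat.exists_eq_add_of_le' h1
  obtain ⟨e1, e2, e3, e4⟩ := matV_succ_entries hp i
  have h := one_le_sinRatio hp h1 (by omega)
  exact ⟨e1 ▸ h, e2 ▸ sinRatio_nonneg hp (by omega), e3 ▸ sinRatio_nonneg hp (by omega), e4 ▸ h⟩

lemma matV_10_pos {p j : ℕ} (hp : 3 ≤ p) (h1 : 2 ≤ j) (h2 : j ≤ p - 1) : 0 < matV p j 1 0 := by
  obtain ⟨i, rfl⟩ := Nat.exists_eq_add_of_le' (show 1 ≤ j by omega)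
  obtain ⟨e1, e2, e3, e4⟩ := matV_succ_entries hp i
  linarith [one_le_sinRatio hp (show 1 ≤ i by omega) (by omega)]

lemma matV_01_pos {p j : ℕ} (hp : 3 ≤ p) (h1 : 1 ≤ j) (h2 : j < p - 1) : 0 < matV p j 0 1 := by
  obtain ⟨i, rfl⟩ := Nat.exists_eq_add_of_le' (show 1 ≤ j by omega)
  obtain ⟨e1, e2, e3, e4⟩ := matV_succ_entries hp i
  linarith [one_le_sinRatio hp (show 1 ≤ i + 2 by omega) (by omega)]

/-! ### The Möbius action on positive numbers -/

lemma NonnegEntries.den_pos {M : SL(2, ℝ)} (hM : NonnegEntries M) {x : ℝ} (hx : 0 ≤ x) :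
    0 < M 1 0 * x + M 1 1 := by
  have := mul_nonneg hM.nonneg_10 hx
  linarith [hM.one_le_11]

lemma NonnegEntries.num_pos {M : SL(2, ℝ)} (hM : NonnegEntries M) {x : ℝ} (hx : 0 < x) :
    0 < M 0 0 * x + M 0 1 := by
  have := hM.nonneg_01
  nlinarith [hM.one_le_00]

lemma NonnegEntries.moebius_pos {M : SL(2, ℝ)} (hM : NonnegEntries M) {x : ℝ} (hx : 0 < x) :
    0 < moebius M x := div_pos (hM.num_pos hx) (hM.den_pos hx.le)

lemma moebius_one (x : ℝ) : moebius 1 x = x := by simp [moebius]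

lemma moebius_mul (M N : SL(2, ℝ)) {x : ℝ} (hx : N 1 0 * x + N 1 1 ≠ 0) :
    moebius (M * N) x = moebius M (moebius N x) := by
  simp only [moebius, mul_apply_00, mul_apply_01, mul_apply_10, mul_apply_11]
  rw [← mul_div_mul_right _ (M 1 0 * _ + M 1 1) hx]
  congr 1 <;> field_simp <;> ring

lemma moebius_eq_iff {M : SL(2, ℝ)} {x y : ℝ} (hx : M 1 0 * x + M 1 1 ≠ 0) :
    moebius M x = y ↔ M 0 0 * x + M 0 1 = y * (M 1 0 * x + M 1 1) := by
  rw [moebius, div_eq_iff hx]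

lemma moebius_matS (p : ℕ) (x : ℝ) : moebius (matS p) x = x + lam p := by simp [moebius]

lemma moebius_matT (x : ℝ) : moebius matT x = -1 / x := by simp [moebius]

lemma NonnegEntries.moebius_injective {M : SL(2, ℝ)} (hM : NonnegEntries M) {x y : ℝ}
    (hx : 0 < x) (hy : 0 < y) (h : moebius M x = moebius M y) : x = y := by
  rw [moebius, moebius, div_eq_div_iff (hM.den_pos hx.le).ne' (hM.den_pos hy.le).ne'] at h
  have := det_eq_one M
  linear_combination h + (y - x) * this

/-- The images of the positive half line under the different `V_j` are disjoint. -/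
lemma matV_moebius_injective {p i j : ℕ} (hp : 3 ≤ p) (hi : 1 ≤ i) (hi' : i ≤ p - 1)
    (hj : 1 ≤ j) (hj' : j ≤ p - 1) {x y : ℝ} (hx : 0 < x) (hy : 0 < y)
    (h : moebius (matV p i) x = moebius (matV p j) y) : i = j ∧ x = y := by
  -- `V_i x = V_j y` with `i < j` would say that `V_{j-i} y = T x` is negative
  have key : ∀ {i j : ℕ} {x y : ℝ}, 1 ≤ i → i < j → j ≤ p - 1 → 0 < x → 0 < y →
      moebius (matV p i) x ≠ moebius (matV p j) y := by
    intro i j x y hi hij hj hx hy h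
    have e : matV p j = matV p i * (matT * matV p (j - i)) := by
      rw [← mul_assoc, matV_mul_matT hi, matV, matV, ← mul_assoc, ← pow_add]
      congr 3; omega
    have hV := nonnegEntries_matV hp (show 1 ≤ j - i by omega) (by omega)
    have hn := hV.num_pos hy
    have hd := hV.den_pos hy.le
    have hdi := (nonnegEntries_matV hp hi (by omega)).den_pos hx.le
    have hdj := (nonnegEntries_matV hp (show 1 ≤ j by omega) hj).den_pos hy.le
    rw [moebius, moebius, div_eq_div_iff hdi.ne' hdj.ne', e] at h
    simp only [mul_apply_00, mul_apply_01, mul_apply_10, mul_apply_11, matT_00, matT_01, matT_10,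
      matT_11] at h
    have hdet := det_eq_one (matV p i)
    have : x * (matV p (j - i) 0 0 * y + matV p (j - i) 0 1) +
        (matV p (j - i) 1 0 * y + matV p (j - i) 1 1) = 0 := by
      linear_combination h - (x * (matV p (j - i) 0 0 * y + matV p (j - i) 0 1) +
        (matV p (j - i) 1 0 * y + matV p (j - i) 1 1)) * hdet
    have := mul_pos hx hn
    linarith
  rcases lt_trichotomy i j with hij | rfl | hij
  · exact absurd h (key hi hij hj' hx hy)
  · exact ⟨rfl, (nonnegEntries_matV hp hi hi').moebius_injective hx hy h⟩
  · exact absurd h.symm (key hj hij hi' hy hx)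

/-! ### Words in the `V_j` -/

/-- A list of indices of the generators `V_1, …, V_{p-1}`. -/
def IsWord (p : ℕ) (l : List ℕ) : Prop := ∀ j ∈ l, 1 ≤ j ∧ j ≤ p - 1

lemma isWord_nil (p : ℕ) : IsWord p [] := by simp [IsWord]

lemma isWord_cons {p j : ℕ} {l : List ℕ} :
    IsWord p (j :: l) ↔ (1 ≤ j ∧ j ≤ p - 1) ∧ IsWord p l := by simp [IsWord]

lemma isWord_append {p : ℕ} {l l' : List ℕ} :
    IsWord p (l ++ l') ↔ IsWord p l ∧ IsWord p l' := by
  simp only [IsWord, List.mem_append]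
  exact ⟨fun h => ⟨fun j hj => h j (.inl hj), fun j hj => h j (.inr hj)⟩,
    fun h j hj => hj.elim (h.1 j) (h.2 j)⟩

/-- The product of the matrices `V_j` along a word. -/
def wordMat (p : ℕ) (l : List ℕ) : SL(2, ℝ) := (l.map (matV p)).prod

@[simp] lemma wordMat_nil (p : ℕ) : wordMat p [] = 1 := by simp [wordMat]

lemma wordMat_cons (p j : ℕ) (l : List ℕ) : wordMat p (j :: l) = matV p j * wordMat p l := by
  simp [wordMat]

lemma wordMat_append (p : ℕ) (l l' : List ℕ) :
    wordMat p (l ++ l') = wordMat p l * wordMat p l' := by simp [wordMat]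

lemma nonnegEntries_wordMat {p : ℕ} (hp : 3 ≤ p) {l : List ℕ} (hl : IsWord p l) :
    NonnegEntries (wordMat p l) := by
  induction l with
  | nil => simpa using NonnegEntries.one
  | cons j l ih =>
    rw [isWord_cons] at hl
    rw [wordMat_cons]
    exact (nonnegEntries_matV hp hl.1.1 hl.1.2).mul (ih hl.2)

lemma moebius_wordMat_pos {p : ℕ} (hp : 3 ≤ p) {l : List ℕ} (hl : IsWord p l) {x : ℝ}
    (hx : 0 < x) : 0 < moebius (wordMat p l) x := (nonnegEntries_wordMat hp hl).moebius_pos hx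

lemma moebius_wordMat_cons {p : ℕ} (hp : 3 ≤ p) {j : ℕ} {l : List ℕ} (hl : IsWord p l) {x : ℝ}
    (hx : 0 < x) :
    moebius (wordMat p (j :: l)) x = moebius (matV p j) (moebius (wordMat p l) x) := by
  rw [wordMat_cons, moebius_mul _ _ ((nonnegEntries_wordMat hp hl).den_pos hx.le).ne']

lemma moebius_wordMat_append {p : ℕ} (hp : 3 ≤ p) {l l' : List ℕ} (hl : IsWord p l') {x : ℝ}
    (hx : 0 < x) :
    moebius (wordMat p (l ++ l')) x = moebius (wordMat p l) (moebius (wordMat p l') x) := by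
  rw [wordMat_append, moebius_mul _ _ ((nonnegEntries_wordMat hp hl).den_pos hx.le).ne']

/-- A point of the positive half line has at most one itinerary of given length. -/
lemma wordMat_moebius_injective {p : ℕ} (hp : 3 ≤ p) {l l' : List ℕ} (hl : IsWord p l)
    (hl' : IsWord p l') (hlen : l.length = l'.length) {x y : ℝ} (hx : 0 < x) (hy : 0 < y)
    (h : moebius (wordMat p l) x = moebius (wordMat p l') y) : l = l' ∧ x = y := by
  induction l generalizing l' with
  | nil =>
    obtain rfl : l' = [] := List.length_eq_zero_iff.mp hlen.symm
    simpa [moebius_one] using h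
  | cons j l ih =>
    obtain _ | ⟨j', l'⟩ := l'
    · simp at hlen
    rw [isWord_cons] at hl hl'
    rw [moebius_wordMat_cons hp hl.2 hx, moebius_wordMat_cons hp hl'.2 hy] at h
    obtain ⟨rfl, hh⟩ := matV_moebius_injective hp hl.1.1 hl.1.2 hl'.1.1 hl'.1.2
      (moebius_wordMat_pos hp hl.2 hx) (moebius_wordMat_pos hp hl'.2 hy) h
    obtain ⟨rfl, rfl⟩ := ih hl.2 hl'.2 (by simpa using hlen) hh
    exact ⟨rfl, rfl⟩

lemma wordMat_10_pos {p : ℕ} (hp : 3 ≤ p) {l : List ℕ} (hl : IsWord p l) {j : ℕ} (hj : j ∈ l)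
    (h2 : 2 ≤ j) : 0 < wordMat p l 1 0 := by
  induction l with
  | nil => simp at hj
  | cons i l ih =>
    rw [isWord_cons] at hl
    have hV := nonnegEntries_matV hp hl.1.1 hl.1.2
    have hN := nonnegEntries_wordMat hp hl.2
    rw [wordMat_cons, mul_apply_10]
    rcases List.mem_cons.mp hj with rfl | hj
    · have := matV_10_pos hp h2 hl.1.2
      have h1 := mul_pos this (lt_of_lt_of_le one_pos hN.one_le_00)
      have h2 := mul_nonneg (zero_le_one.trans hV.one_le_11) hN.nonneg_10
      linarith
    · have := ih hl.2 hj
      have h1 := mul_nonneg hV.nonneg_10 (zero_le_one.trans hN.one_le_00)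
      have h2 := mul_pos (lt_of_lt_of_le one_pos hV.one_le_11) this
      linarith

lemma wordMat_01_pos {p : ℕ} (hp : 3 ≤ p) {l : List ℕ} (hl : IsWord p l) {j : ℕ} (hj : j ∈ l)
    (h2 : j < p - 1) : 0 < wordMat p l 0 1 := by
  induction l with
  | nil => simp at hj
  | cons i l ih =>
    rw [isWord_cons] at hl
    have hV := nonnegEntries_matV hp hl.1.1 hl.1.2
    have hN := nonnegEntries_wordMat hp hl.2
    rw [wordMat_cons, mul_apply_01]
    rcases List.mem_cons.mp hj with rfl | hj
    · have := matV_01_pos hp hl.1.1 h2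
      have h1 := mul_pos this (lt_of_lt_of_le one_pos hN.one_le_11)
      have h2 := mul_nonneg (zero_le_one.trans hV.one_le_00) hN.nonneg_01
      linarith
    · have := ih hl.2 hj
      have h1 := mul_nonneg hV.nonneg_01 (zero_le_one.trans hN.one_le_11)
      have h2 := mul_pos (lt_of_lt_of_le one_pos hV.one_le_00) this
      linarith

/-- All entries of the matrix are positive. -/
structure PosEntries (M : SL(2, ℝ)) : Prop where
  pos_00 : 0 < M 0 0
  pos_01 : 0 < M 0 1
  pos_10 : 0 < M 1 0
  pos_11 : 0 < M 1 1

/-- A word that is neither a power of `V_1` nor a power of `V_{p-1}`. -/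
def IsMixed (p : ℕ) (l : List ℕ) : Prop := (∃ j ∈ l, 2 ≤ j) ∧ ∃ j ∈ l, j < p - 1

lemma IsMixed.posEntries {p : ℕ} (hp : 3 ≤ p) {l : List ℕ} (hl : IsWord p l) (h : IsMixed p l) :
    PosEntries (wordMat p l) := by
  obtain ⟨⟨i, hi, hi'⟩, ⟨j, hj, hj'⟩⟩ := h
  have hN := nonnegEntries_wordMat hp hl
  exact ⟨by linarith [hN.one_le_00], wordMat_01_pos hp hl hj hj', wordMat_10_pos hp hl hi hi',
    by linarith [hN.one_le_11]⟩

lemma matV_pred_entries {p : ℕ} (hp : 3 ≤ p) : matV p (p - 1) 0 0 = 1 ∧ matV p (p - 1) 0 1 = 0 ∧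
    matV p (p - 1) 1 0 = lam p ∧ matV p (p - 1) 1 1 = 1 := by
  obtain ⟨i, rfl⟩ := Nat.exists_eq_add_of_le' (show 2 ≤ p by omega)
  obtain ⟨e1, e2, e3, e4⟩ := matV_succ_entries hp i
  have h1 := sinRatio_reflect hp (n := 1) (by omega)
  have h2 := sinRatio_reflect hp (n := 2) (by omega)
  rw [sinRatio_one hp] at h1
  rw [sinRatio_two hp] at h2
  have := sinRatio_self hp
  simp only [Nat.add_sub_cancel, show i + 2 - 1 = i + 1 by omega] at *
  exact ⟨e1.trans h1, e2.trans this, e3.trans h2, e4.trans h1⟩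

lemma wordMat_replicate_one {p : ℕ} (n : ℕ) :
    wordMat p (List.replicate n 1) 0 0 = 1 ∧ wordMat p (List.replicate n 1) 0 1 = n * lam p ∧
      wordMat p (List.replicate n 1) 1 0 = 0 ∧ wordMat p (List.replicate n 1) 1 1 = 1 := by
  induction n with
  | zero => simp
  | succ n ih =>
    obtain ⟨h1, h2, h3, h4⟩ := ih
    simp only [List.replicate_succ, wordMat_cons, matV_one, mul_apply_00, mul_apply_01,
      mul_apply_10, mul_apply_11, h1, h2, h3, h4]
    simp
    ring

lemma wordMat_replicate_pred {p : ℕ} (hp : 3 ≤ p) (n : ℕ) :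
    wordMat p (List.replicate n (p - 1)) 0 0 = 1 ∧ wordMat p (List.replicate n (p - 1)) 0 1 = 0 ∧
      wordMat p (List.replicate n (p - 1)) 1 0 = n * lam p ∧
      wordMat p (List.replicate n (p - 1)) 1 1 = 1 := by
  induction n with
  | zero => simp
  | succ n ih =>
    obtain ⟨h1, h2, h3, h4⟩ := ih
    obtain ⟨e1, e2, e3, e4⟩ := matV_pred_entries hp
    simp only [List.replicate_succ, wordMat_cons, mul_apply_00, mul_apply_01,
      mul_apply_10, mul_apply_11, h1, h2, h3, h4, e1, e2, e3, e4]
    simp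
    ring

/-- A word is mixed unless it is a power of `V_1` or of `V_{p-1}`. -/
lemma isMixed_or {p : ℕ} {l : List ℕ} (hl : IsWord p l) :
    IsMixed p l ∨ l = List.replicate l.length 1 ∨ l = List.replicate l.length (p - 1) := by
  by_contra! h
  obtain ⟨h1, h2, h3⟩ := h
  apply h1
  constructor
  · by_contra! h
    exact h2 (List.eq_replicate_iff.mpr ⟨rfl, fun j hj => by
      have := hl j hj; have := h j hj; omega⟩)
  · by_contra! h
    exact h3 (List.eq_replicate_iff.mpr ⟨rfl, fun j hj => by
      have := hl j hj; have := h j hj; omega⟩)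

lemma isMixed_of_two_lt_trace {p : ℕ} (hp : 3 ≤ p) {l : List ℕ} (hl : IsWord p l)
    (h : 2 < |wordMat p l 0 0 + wordMat p l 1 1|) : IsMixed p l := by
  rcases isMixed_or hl with h' | h' | h'
  · exact h'
  · rw [h'] at h
    obtain ⟨e1, e2, e3, e4⟩ := wordMat_replicate_one (p := p) l.length
    rw [e1, e4] at h; norm_num at h
  · rw [h'] at h
    obtain ⟨e1, e2, e3, e4⟩ := wordMat_replicate_pred hp l.length
    rw [e1, e4] at h; norm_num at h

lemma isMixed_of_moebius_eq {p : ℕ} (hp : 3 ≤ p) {l : List ℕ} (hl : IsWord p l) (hne : l ≠ [])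
    {x : ℝ} (hx : 0 < x) (h : moebius (wordMat p l) x = x) : IsMixed p l := by
  have hlen : (0 : ℝ) < l.length := by exact_mod_cast List.length_pos_iff.mpr hne
  have hlam := lam_pos hp
  rw [moebius_eq_iff ((nonnegEntries_wordMat hp hl).den_pos hx.le).ne'] at h
  have := mul_pos hlen hlam
  rcases isMixed_or hl with h' | h' | h'
  · exact h'
  · rw [h'] at h
    obtain ⟨e1, e2, e3, e4⟩ := wordMat_replicate_one (p := p) l.length
    rw [e1, e2, e3, e4] at h
    linarith
  · rw [h'] at h
    obtain ⟨e1, e2, e3, e4⟩ := wordMat_replicate_pred hp l.length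
    rw [e1, e2, e3, e4] at h
    have : x * (l.length * lam p * x) = 0 := by linarith
    have : 0 < x * (l.length * lam p * x) := by positivity
    linarith

lemma PosEntries.two_lt_trace {M : SL(2, ℝ)} (hM : PosEntries M) : 2 < M 0 0 + M 1 1 := by
  have := det_eq_one M
  have := mul_pos hM.pos_01 hM.pos_10
  have := hM.pos_00
  have := hM.pos_11
  nlinarith [sq_nonneg (M 0 0 - M 1 1)]

/-! ### The shift on positive numbers -/

/-- The expanding map on positive numbers with inverse branches `V_1, …, V_{p-1}`: it sends
`V_j y`, `y > 0`, to `y`. At the remaining points it takes the value `0`. -/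
def shift (p : ℕ) (x : ℝ) : ℝ :=
  open Classical in
  if h : ∃ y : ℝ, 0 < y ∧ ∃ j : ℕ, 1 ≤ j ∧ j ≤ p - 1 ∧ x = moebius (matV p j) y then h.choose else 0

lemma shift_moebius_matV {p : ℕ} (hp : 3 ≤ p) {j : ℕ} (h1 : 1 ≤ j) (h2 : j ≤ p - 1) {y : ℝ}
    (hy : 0 < y) : shift p (moebius (matV p j) y) = y := by
  have h : ∃ z : ℝ, 0 < z ∧ ∃ i : ℕ, 1 ≤ i ∧ i ≤ p - 1 ∧
      moebius (matV p j) y = moebius (matV p i) z := ⟨y, hy, j, h1, h2, rfl⟩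
  rw [shift, dif_pos h]
  obtain ⟨hz, i, h1', h2', e⟩ := h.choose_spec
  exact (matV_moebius_injective hp h1 h2 h1' h2' hy hz e).2.symm

lemma exists_of_shift_pos {p : ℕ} {x : ℝ} (h : 0 < shift p x) :
    ∃ j, 1 ≤ j ∧ j ≤ p - 1 ∧ x = moebius (matV p j) (shift p x) := by
  rw [shift] at h ⊢
  split_ifs at h ⊢ with h'
  · exact h'.choose_spec.2
  · exact absurd h (lt_irrefl 0)

lemma shift_nonneg (p : ℕ) (x : ℝ) : 0 ≤ shift p x := by
  rw [shift]
  split_ifs with h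
  · exact h.choose_spec.1.le
  · exact le_rfl

lemma shift_zero {p : ℕ} (hp : 3 ≤ p) : shift p 0 = 0 := by
  by_contra h
  obtain ⟨j, h1, h2, e⟩ := exists_of_shift_pos (lt_of_le_of_ne (shift_nonneg p 0) (Ne.symm h))
  have := (nonnegEntries_matV hp h1 h2).moebius_pos
    (lt_of_le_of_ne (shift_nonneg p 0) (Ne.symm h))
  linarith

lemma shift_pos_of_iterate_pos {p : ℕ} (hp : 3 ≤ p) {x : ℝ} {n : ℕ}
    (h : 0 < (shift p)^[n] (shift p x)) : 0 < shift p x := by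
  rcases (shift_nonneg p x).lt_or_eq with h' | h'
  · exact h'
  · rw [← h', Function.iterate_fixed (shift_zero hp)] at h
    exact absurd h (lt_irrefl 0)

lemma shift_iterate_wordMat {p : ℕ} (hp : 3 ≤ p) {l : List ℕ} (hl : IsWord p l) {y : ℝ}
    (hy : 0 < y) : (shift p)^[l.length] (moebius (wordMat p l) y) = y := by
  induction l with
  | nil => simp [moebius_one]
  | cons j l ih =>
    rw [isWord_cons] at hl
    rw [moebius_wordMat_cons hp hl.2 hy, List.length_cons, Function.iterate_succ_apply,
      shift_moebius_matV hp hl.1.1 hl.1.2 (moebius_wordMat_pos hp hl.2 hy), ih hl.2]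

lemma exists_wordMat_of_iterate_pos {p : ℕ} (hp : 3 ≤ p) {n : ℕ} {x : ℝ} (hx : 0 < x)
    (h : 0 < (shift p)^[n] x) :
    ∃ l, IsWord p l ∧ l.length = n ∧ x = moebius (wordMat p l) ((shift p)^[n] x) := by
  induction n generalizing x with
  | zero => exact ⟨[], isWord_nil p, rfl, by simp [moebius_one]⟩
  | succ n ih =>
    rw [Function.iterate_succ_apply] at h ⊢
    have hpos := shift_pos_of_iterate_pos hp h
    obtain ⟨l, hl, hlen, e⟩ := ih hpos h
    obtain ⟨j, h1, h2, e'⟩ := exists_of_shift_pos hpos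
    refine ⟨j :: l, isWord_cons.mpr ⟨⟨h1, h2⟩, hl⟩, by simp [hlen], ?_⟩
    rw [moebius_wordMat_cons hp hl h, ← e, ← e']

lemma iterate_shift_pos {p : ℕ} (hp : 3 ≤ p) {x : ℝ} (hx : 0 < x)
    (hper : x ∈ Function.periodicPts (shift p)) (i : ℕ) : 0 < (shift p)^[i] x := by
  obtain ⟨n, hn, h⟩ := hper
  have hi : i ≤ i * n := Nat.le_mul_of_pos_right i hn
  have h' : (shift p)^[i * n - i] ((shift p)^[i] x) = x := by
    rw [← Function.iterate_add_apply, Nat.sub_add_cancel hi]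
    exact (h.const_mul i)
  by_contra h0
  have h0' : (shift p)^[i] x = 0 := by
    rcases i with _ | i
    · exact absurd hx h0
    · rw [Function.iterate_succ_apply'] at h0 ⊢
      exact le_antisymm (not_lt.mp h0) (shift_nonneg _ _)
  rw [h0', Function.iterate_fixed (shift_zero hp)] at h'
  exact hx.ne h'

/-! ### The Hecke group as a group of matrices -/

/-- The preimage of the Hecke group `G_p` in `SL(2, ℝ)`. -/
def heckeMat (p : ℕ) : Subgroup SL(2, ℝ) := Subgroup.closure {matS p, matT}

lemma matS_mem (p : ℕ) : matS p ∈ heckeMat p := Subgroup.subset_closure (by simp)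

lemma matT_mem (p : ℕ) : matT ∈ heckeMat p := Subgroup.subset_closure (by simp)

lemma matU_mem (p : ℕ) : matU p ∈ heckeMat p := mul_mem (matS_mem p) (matT_mem p)

lemma neg_mem_heckeMat {p : ℕ} {M : SL(2, ℝ)} (h : M ∈ heckeMat p) : -M ∈ heckeMat p := by
  rw [← matT_mul_matT_mul]
  exact mul_mem (matT_mem p) (mul_mem (matT_mem p) h)

lemma matV_mem (p j : ℕ) : matV p j ∈ heckeMat p :=
  mul_mem (pow_mem (matU_mem p) _) (matS_mem p)

lemma wordMat_mem (p : ℕ) (l : List ℕ) : wordMat p l ∈ heckeMat p := by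
  induction l with
  | nil => simp
  | cons j l ih => rw [wordMat_cons]; exact mul_mem (matV_mem p j) ih

lemma toPSL_eq_iff {M N : SL(2, ℝ)} : toPSL M = toPSL N ↔ M = N ∨ M = -N := by
  rw [toPSL, toPSL, QuotientGroup.eq, Matrix.SpecialLinearGroup.mem_center_iff]
  constructor
  · rintro ⟨r, hr, h⟩
    have hN : N = M * (M⁻¹ * N) := by simp
    have hr' : r = 1 ∨ r = -1 := by simpa using hr
    rcases hr' with rfl | rfl
    · left
      have : M⁻¹ * N = 1 := by ext i j; rw [← h]; simp
      rw [hN, this, mul_one]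
    · right
      have : M⁻¹ * N = -1 := by
        apply ext_entries <;> simp [← h, neg_apply]
      rw [hN, this]; simp
  · rintro (rfl | rfl)
    · exact ⟨1, by simp, by simp⟩
    · refine ⟨-1, by simp, ?_⟩
      have : (-N)⁻¹ * N = -1 := by rw [inv_mul_eq_iff_eq_mul]; simp
      rw [this]; ext i j; fin_cases i <;> fin_cases j <;> simp [neg_apply]

lemma toPSL_mem_iff {p : ℕ} {M : SL(2, ℝ)} : toPSL M ∈ heckeGroup p ↔ M ∈ heckeMat p := by
  have key : heckeGroup p = (heckeMat p).map (QuotientGroup.mk' _) := by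
    rw [heckeMat, MonoidHom.map_closure, Set.image_pair]; rfl
  rw [key, Subgroup.mem_map]
  constructor
  · rintro ⟨N, hN, h⟩
    rcases toPSL_eq_iff.mp (show toPSL N = toPSL M from h) with rfl | rfl
    · exact hN
    · simpa using neg_mem_heckeMat hN
  · exact fun h => ⟨M, h, rfl⟩

/-- The projection from the matrix group onto `G_p`. -/
def toHecke (p : ℕ) : heckeMat p →* heckeGroup p where
  toFun M := ⟨toPSL M, toPSL_mem_iff.mpr M.2⟩
  map_one' := rfl
  map_mul' _ _ := rfl

lemma represents_iff {p : ℕ} {M : SL(2, ℝ)} {g : heckeGroup p} :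
    Represents M g ↔ ∃ hM : M ∈ heckeMat p, toHecke p ⟨M, hM⟩ = g := by
  constructor
  · intro h
    exact ⟨toPSL_mem_iff.mp (by rw [Represents] at h; rw [h]; exact g.2), Subtype.ext h⟩
  · rintro ⟨hM, rfl⟩; rfl

lemma toHecke_surjective (p : ℕ) : Function.Surjective (toHecke p) := by
  intro g
  obtain ⟨M, hM⟩ := QuotientGroup.mk_surjective (g : PSL(2, ℝ))
  obtain ⟨h, e⟩ := represents_iff.mp (show Represents M g from hM)
  exact ⟨_, e⟩

lemma toHecke_eq_iff {p : ℕ} {M N : heckeMat p} :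
    toHecke p M = toHecke p N ↔ (M : SL(2, ℝ)) = N ∨ (M : SL(2, ℝ)) = -N := by
  rw [← toPSL_eq_iff, Subtype.ext_iff]; rfl

/-- The conjugacy class in `G_p` of the image of a matrix. -/
def classOf {p : ℕ} (M : SL(2, ℝ)) (hM : M ∈ heckeMat p) : ConjClasses (heckeGroup p) :=
  ConjClasses.mk (toHecke p ⟨M, hM⟩)

lemma classOf_eq_iff {p : ℕ} {M N : SL(2, ℝ)} (hM : M ∈ heckeMat p) (hN : N ∈ heckeMat p) :
    classOf M hM = classOf N hN ↔
      ∃ h ∈ heckeMat p, h * M * h⁻¹ = N ∨ h * M * h⁻¹ = -N := by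
  rw [classOf, classOf, ConjClasses.mk_eq_mk_iff_isConj, isConj_iff]
  constructor
  · rintro ⟨g, hg⟩
    obtain ⟨h, rfl⟩ := toHecke_surjective p g
    rw [← map_mul, ← map_inv, ← map_mul, toHecke_eq_iff] at hg
    exact ⟨h, h.2, hg⟩
  · rintro ⟨h, hh, e⟩
    refine ⟨toHecke p ⟨h, hh⟩, ?_⟩
    rw [← map_mul, ← map_inv, ← map_mul, toHecke_eq_iff]
    exact e

/-! ### Normal forms -/

/-- A property that is stable under left multiplication by `T` and `U` is stable under left
multiplication by the whole group. -/
lemma heckeMat_mul_induction {p : ℕ} (hp : 3 ≤ p) {P : SL(2, ℝ) → Prop}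
    (hT : ∀ B, P B → P (matT * B)) (hU : ∀ B, P B → P (matU p * B)) {M : SL(2, ℝ)}
    (hM : M ∈ heckeMat p) {B : SL(2, ℝ)} (hB : P B) : P (M * B) := by
  have hneg : ∀ B, P B → P (-B) := fun B hB => by
    rw [← matT_mul_matT_mul]; exact hT _ (hT _ hB)
  have hTi : ∀ B, P B → P (matT⁻¹ * B) := fun B hB => by
    rw [matT_inv, neg_mul]; exact hneg _ (hT _ hB)
  have hUn : ∀ n : ℕ, ∀ B, P B → P (matU p ^ n * B) := by
    intro n
    induction n with
    | zero => intro B hB; simpa using hB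
    | succ n ih => intro B hB; rw [pow_succ', mul_assoc]; exact hU _ (ih _ hB)
  have hUi : ∀ B, P B → P ((matU p)⁻¹ * B) := fun B hB => by
    have : (matU p)⁻¹ = -(matU p ^ (p - 1)) := by
      rw [inv_eq_iff_mul_eq_one, mul_neg, ← pow_succ', Nat.sub_add_cancel (by omega),
        matU_pow_self hp, neg_neg]
    rw [this, neg_mul]; exact hneg _ (hUn _ _ hB)
  have hS : matS p = matU p * matT⁻¹ := by rw [matU]; simp
  refine (Subgroup.closure_induction (p := fun M _ => (∀ B, P B → P (M * B)) ∧
    (∀ B, P B → P (M⁻¹ * B))) ?_ ?_ ?_ ?_ hM).1 B hB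
  · rintro M (rfl | rfl)
    · constructor
      · intro B hB; rw [hS, mul_assoc]; exact hU _ (hTi _ hB)
      · intro B hB; rw [hS, mul_inv_rev, inv_inv, mul_assoc]; exact hT _ (hUi _ hB)
    · exact ⟨hT, hTi⟩
  · simp
  · rintro M N - - ⟨h1, h2⟩ ⟨h3, h4⟩
    refine ⟨fun B hB => ?_, fun B hB => ?_⟩
    · rw [mul_assoc]; exact h1 _ (h3 _ hB)
    · rw [mul_inv_rev, mul_assoc]; exact h4 _ (h2 _ hB)
  · rintro M - ⟨h1, h2⟩
    exact ⟨h2, by simpa using h1⟩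

/-- Up to sign, `M` is of the form `A N R`, with `A ∈ {1, T}`, a product `N` of matrices `V_j`, and
`R` in the given set. -/
def HasNormalForm (p : ℕ) (ℛ : Set SL(2, ℝ)) (M : SL(2, ℝ)) : Prop :=
  ∃ u, IsWord p u ∧ ∃ R ∈ ℛ, (M = wordMat p u * R ∨ M = -(wordMat p u * R)) ∨
    (M = matT * (wordMat p u * R) ∨ M = -(matT * (wordMat p u * R)))

lemma HasNormalForm.neg {p : ℕ} {ℛ : Set SL(2, ℝ)} {M : SL(2, ℝ)} (h : HasNormalForm p ℛ M) :
    HasNormalForm p ℛ (-M) := by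
  obtain ⟨u, hu, R, hR, (rfl | rfl) | (rfl | rfl)⟩ := h
  · exact ⟨u, hu, R, hR, .inl (.inr rfl)⟩
  · exact ⟨u, hu, R, hR, .inl (.inl (neg_neg _))⟩
  · exact ⟨u, hu, R, hR, .inr (.inr rfl)⟩
  · exact ⟨u, hu, R, hR, .inr (.inl (neg_neg _))⟩

lemma HasNormalForm.matT_mul {p : ℕ} {ℛ : Set SL(2, ℝ)} {M : SL(2, ℝ)}
    (h : HasNormalForm p ℛ M) : HasNormalForm p ℛ (matT * M) := by
  obtain ⟨u, hu, R, hR, (rfl | rfl) | (rfl | rfl)⟩ := h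
  · exact ⟨u, hu, R, hR, .inr (.inl rfl)⟩
  · exact ⟨u, hu, R, hR, .inr (.inr (mul_neg _ _))⟩
  · exact ⟨u, hu, R, hR, .inl (.inr (matT_mul_matT_mul _))⟩
  · exact ⟨u, hu, R, hR, .inl (.inl (by rw [mul_neg, matT_mul_matT_mul, neg_neg]))⟩

lemma hasNormalForm_matU_mul_wordMat {p : ℕ} (hp : 3 ≤ p) {ℛ : Set SL(2, ℝ)} {u : List ℕ}
    (hu : IsWord p u) (hne : u ≠ []) {R : SL(2, ℝ)} (hR : R ∈ ℛ) :
    HasNormalForm p ℛ (matU p * (wordMat p u * R)) := by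
  obtain _ | ⟨j, u⟩ := u
  · exact absurd rfl hne
  rw [isWord_cons] at hu
  rw [wordMat_cons, mul_assoc, ← mul_assoc (matU p), matU_mul_matV hu.1.1]
  rcases hu.1.2.lt_or_eq with h | h
  · exact ⟨(j + 1) :: u, isWord_cons.mpr ⟨⟨by omega, by omega⟩, hu.2⟩, R, hR,
      .inl (.inl (by rw [wordMat_cons, mul_assoc]))⟩
  · rw [h, Nat.sub_add_cancel (by omega), matV_self hp]
    exact ⟨u, hu.2, R, hR, .inr (.inl rfl)⟩

lemma HasNormalForm.matU_mul {p : ℕ} (hp : 3 ≤ p) {ℛ : Set SL(2, ℝ)}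
    (hℛ : ∀ R ∈ ℛ, HasNormalForm p ℛ (matU p * R)) {M : SL(2, ℝ)}
    (h : HasNormalForm p ℛ M) : HasNormalForm p ℛ (matU p * M) := by
  have h1 : ∀ u, IsWord p u → ∀ R ∈ ℛ, HasNormalForm p ℛ (matU p * (wordMat p u * R)) := by
    intro u hu R hR
    by_cases hne : u = []
    · subst hne; simpa using hℛ R hR
    · exact hasNormalForm_matU_mul_wordMat hp hu hne hR
  have h2 : ∀ u, IsWord p u → ∀ R ∈ ℛ,
      HasNormalForm p ℛ (matU p * (matT * (wordMat p u * R))) := by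
    intro u hu R hR
    rw [← mul_assoc (matU p), matU_mul_matT, ← matV_one]
    exact ⟨1 :: u, isWord_cons.mpr ⟨⟨le_rfl, by omega⟩, hu⟩, R, hR,
      .inl (.inr (by rw [wordMat_cons, neg_mul, mul_assoc]))⟩
  obtain ⟨u, hu, R, hR, (rfl | rfl) | (rfl | rfl)⟩ := h
  · exact h1 u hu R hR
  · rw [mul_neg]; exact (h1 u hu R hR).neg
  · exact h2 u hu R hR
  · rw [mul_neg]; exact (h2 u hu R hR).neg

lemma hasNormalForm_mul {p : ℕ} (hp : 3 ≤ p) {ℛ : Set SL(2, ℝ)}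
    (hℛ : ∀ R ∈ ℛ, HasNormalForm p ℛ (matU p * R)) {M R : SL(2, ℝ)} (hM : M ∈ heckeMat p)
    (hR : R ∈ ℛ) : HasNormalForm p ℛ (M * R) :=
  heckeMat_mul_induction hp (fun _ h => h.matT_mul) (fun _ h => h.matU_mul hp hℛ) hM
    ⟨[], isWord_nil p, R, hR, .inl (.inl (by simp))⟩

/-- The normal form of the elements of `G_p` in the free product of `⟨T⟩` and `⟨U⟩`. -/
lemma exists_normalForm {p : ℕ} (hp : 3 ≤ p) {M : SL(2, ℝ)} (hM : M ∈ heckeMat p) :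
    HasNormalForm p {1, matT} M := by
  rw [← mul_one M]
  refine hasNormalForm_mul hp ?_ hM (by simp)
  rintro R (rfl | rfl)
  · exact ⟨[1], isWord_cons.mpr ⟨⟨le_rfl, by omega⟩, isWord_nil p⟩, matT, by simp,
      .inl (.inl (by rw [wordMat_cons, matV_one, matU]; simp))⟩
  · exact ⟨[1], isWord_cons.mpr ⟨⟨le_rfl, by omega⟩, isWord_nil p⟩, 1, by simp,
      .inl (.inr (by rw [wordMat_cons, matV_one, matU_mul_matT]; simp))⟩

/-- If `M` is a nonempty word then every element of the group is, up to sign, of the form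
`A N M⁻ⁿ` with `A ∈ {1, T}` and a word `N`. -/
lemma exists_normalForm_mul_inv_pow {p : ℕ} (hp : 3 ≤ p) {h : SL(2, ℝ)} (hh : h ∈ heckeMat p)
    {w : List ℕ} (hw : IsWord p w) (hne : w ≠ []) :
    HasNormalForm p {R | ∃ n : ℕ, R = (wordMat p w)⁻¹ ^ n} h := by
  rw [← mul_one h]
  refine hasNormalForm_mul hp ?_ hh ⟨0, by simp⟩
  rintro R ⟨n, rfl⟩
  have : (wordMat p w)⁻¹ ^ n = wordMat p w * (wordMat p w)⁻¹ ^ (n + 1) := by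
    rw [pow_succ', mul_inv_cancel_left]
  rw [this]
  exact hasNormalForm_matU_mul_wordMat hp hw hne ⟨n + 1, rfl⟩

/-- A matrix of the Hecke group with positive entries is a product of matrices `V_j`. -/
lemma PosEntries.exists_word {p : ℕ} (hp : 3 ≤ p) {M : SL(2, ℝ)} (hM : M ∈ heckeMat p)
    (hpos : PosEntries M) : ∃ l, IsWord p l ∧ l ≠ [] ∧ M = wordMat p l := by
  obtain ⟨p0, p1, p2, p3⟩ := hpos
  obtain ⟨u, hu, R, hR, h⟩ := exists_normalForm hp hM
  obtain ⟨a, b, c, d⟩ := nonnegEntries_wordMat hp hu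
  -- the sign patterns rule out every normal form except the words themselves
  obtain rfl | rfl := hR
  · rw [mul_one] at h
    obtain (rfl | rfl) | (rfl | rfl) := h
    · refine ⟨u, hu, ?_, rfl⟩
      rintro rfl
      simp at p1
    all_goals
      simp only [neg_apply, mul_apply_00, mul_apply_01, mul_apply_10, mul_apply_11, matT_00,
        matT_01, matT_10, matT_11] at p0 p1 p2 p3
      linarith
  · obtain (rfl | rfl) | (rfl | rfl) := h
    all_goals
      simp only [neg_apply, mul_apply_00, mul_apply_01, mul_apply_10, mul_apply_11, matT_00,
        matT_01, matT_10, matT_11] at p0 p1 p2 p3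
      linarith

/-! ### Hyperbolic elements are conjugate to words -/

/-- Conjugacy up to sign in the matrix group. -/
def ConjUpToSign (p : ℕ) (M N : SL(2, ℝ)) : Prop :=
  ∃ h ∈ heckeMat p, h * M * h⁻¹ = N ∨ h * M * h⁻¹ = -N

lemma ConjUpToSign.trans {p : ℕ} {L M N : SL(2, ℝ)} (h₁ : ConjUpToSign p L M)
    (h₂ : ConjUpToSign p M N) : ConjUpToSign p L N := by
  obtain ⟨h, hh, e⟩ := h₁
  obtain ⟨k, hk, f⟩ := h₂
  refine ⟨k * h, mul_mem hk hh, ?_⟩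
  have : k * h * L * (k * h)⁻¹ = k * (h * L * h⁻¹) * k⁻¹ := by group
  rw [this]
  rcases e with e | e <;> rcases f with f | f <;> simp [e, f]

lemma conjUpToSign_mul_comm {p : ℕ} {A : SL(2, ℝ)} (B : SL(2, ℝ)) (hA : A ∈ heckeMat p) :
    ConjUpToSign p (A * B) (B * A) :=
  ⟨A⁻¹, inv_mem hA, .inl (by group)⟩

lemma ConjUpToSign.refl (p : ℕ) (M : SL(2, ℝ)) : ConjUpToSign p M M :=
  ⟨1, one_mem _, .inl (by simp)⟩

lemma ConjUpToSign.neg_left {p : ℕ} {M N : SL(2, ℝ)} (h : ConjUpToSign p M N) :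
    ConjUpToSign p (-M) N := by
  obtain ⟨h, hh, e⟩ := h
  refine ⟨h, hh, ?_⟩
  rcases e with e | e <;> simp [e]

lemma trace_conj (h M : SL(2, ℝ)) :
    (h * M * h⁻¹) 0 0 + (h * M * h⁻¹) 1 1 = M 0 0 + M 1 1 := by
  simp only [mul_apply_00, mul_apply_11, mul_apply_01, mul_apply_10, inv_apply_00, inv_apply_01,
    inv_apply_10, inv_apply_11]
  linear_combination (M 0 0 + M 1 1) * det_eq_one h

lemma ConjUpToSign.abs_trace_eq {p : ℕ} {M N : SL(2, ℝ)} (h : ConjUpToSign p M N) :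
    |M 0 0 + M 1 1| = |N 0 0 + N 1 1| := by
  obtain ⟨h, hh, e | e⟩ := h
  · rw [← trace_conj h M, e]
  · rw [← trace_conj h M, e, neg_apply, neg_apply, ← neg_add, abs_neg]

lemma abs_trace_matU_pow_le {p : ℕ} (hp : 3 ≤ p) {j : ℕ} (h1 : 1 ≤ j) :
    |(matU p ^ j) 0 0 + (matU p ^ j) 1 1| ≤ 2 := by
  obtain ⟨i, rfl⟩ := Nat.exists_eq_add_of_le' h1
  obtain ⟨e1, e2, e3, e4⟩ := matV_succ_entries hp i
  rw [← matV_mul_matT h1, mul_apply_00, mul_apply_11, e1, e2, e3, e4]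
  have hs := sin_pi_div_pos hp
  have : sinRatio p (i + 2) - sinRatio p i = 2 * Real.cos ((i + 1) * (Real.pi / p)) := by
    simp only [sinRatio]
    rw [← sub_div, div_eq_iff hs.ne']
    push_cast
    rw [show ((i : ℝ) + 2) * (Real.pi / p) = (i + 1) * (Real.pi / p) + Real.pi / p by ring,
      show (i : ℝ) * (Real.pi / p) = (i + 1) * (Real.pi / p) - Real.pi / p by ring,
      Real.sin_add, Real.sin_sub]
    ring
  simp only [matT_00, matT_01, matT_10, matT_11, mul_zero, mul_one, zero_add, add_zero, mul_neg]
  rw [← sub_eq_add_neg, this, abs_mul]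
  have := Real.abs_cos_le_one ((i + 1) * (Real.pi / p))
  norm_num
  linarith

/-- A cyclic reduction: `N T` is conjugate to `T`, to a power of `U`, or to a word. -/
lemma conjUpToSign_wordMat_mul_matT {p : ℕ} (hp : 3 ≤ p) (n : ℕ) {u : List ℕ} (hu : IsWord p u)
    (hn : u.length = n) :
    ConjUpToSign p (wordMat p u * matT) matT ∨
      (∃ j, 1 ≤ j ∧ ConjUpToSign p (wordMat p u * matT) (matU p ^ j)) ∨
      ∃ l, IsWord p l ∧ ConjUpToSign p (wordMat p u * matT) (wordMat p l) := by
  induction n using Nat.strong_induction_on generalizing u with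
  | _ n ih =>
  obtain _ | ⟨j, u⟩ := u
  · left; simpa using ConjUpToSign.refl p matT
  rw [isWord_cons] at hu
  rcases List.eq_nil_or_concat u with rfl | ⟨v, i, rfl⟩
  · refine .inr (.inl ⟨j, hu.1.1, ?_⟩)
    rw [wordMat_cons, wordMat_nil, mul_one, matV_mul_matT hu.1.1]
    exact ConjUpToSign.refl _ _
  rw [List.concat_eq_append] at hu hn ⊢
  rw [isWord_append, isWord_cons] at hu
  obtain ⟨hj, hv, hi, -⟩ := hu
  have e : wordMat p (j :: (v ++ [i])) * matT = matV p j * wordMat p v * matU p ^ i := by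
    rw [wordMat_cons, wordMat_append, wordMat_cons, wordMat_nil, mul_one, ← matV_mul_matT hi.1]
    simp only [mul_assoc]
  have e2 : matU p ^ i * (matV p j * wordMat p v) = matV p (i + j) * wordMat p v := by
    rw [← mul_assoc, matV, matV, ← mul_assoc, ← pow_add]
    congr 4; omega
  have hc : ConjUpToSign p (wordMat p (j :: (v ++ [i])) * matT) (matV p (i + j) * wordMat p v) := by
    rw [e, ← e2]
    exact conjUpToSign_mul_comm _ (mul_mem (matV_mem p j) (wordMat_mem p v))
  rcases lt_trichotomy (i + j) p with h | h | h
  · refine .inr (.inr ⟨(i + j) :: v, isWord_cons.mpr ⟨⟨by omega, by omega⟩, hv⟩, ?_⟩)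
    rw [wordMat_cons]; exact hc
  · rw [h, matV_self hp] at hc
    have hc' := hc.trans (conjUpToSign_mul_comm _ (matT_mem p))
    rcases ih v.length (by rw [← hn]; simp) hv rfl with h' | ⟨k, hk, h'⟩ | ⟨l, hl, h'⟩
    · exact .inl (hc'.trans h')
    · exact .inr (.inl ⟨k, hk, hc'.trans h'⟩)
    · exact .inr (.inr ⟨l, hl, hc'.trans h'⟩)
  · obtain ⟨k, hk⟩ := Nat.exists_eq_add_of_lt h
    rw [show i + j = p + (k + 1) by omega, matV_add_self hp (by omega), neg_mul] at hc
    refine .inr (.inr ⟨(k + 1) :: v, isWord_cons.mpr ⟨⟨by omega, by omega⟩, hv⟩, ?_⟩)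
    rw [wordMat_cons]
    exact hc.trans (ConjUpToSign.refl _ _).neg_left

lemma exists_word_of_hyperbolic {p : ℕ} (hp : 3 ≤ p) {M : SL(2, ℝ)} (hM : M ∈ heckeMat p)
    (h : 2 < |M 0 0 + M 1 1|) : ∃ l, IsWord p l ∧ IsMixed p l ∧ ConjUpToSign p M (wordMat p l) := by
  suffices H : ∃ l, IsWord p l ∧ ConjUpToSign p M (wordMat p l) by
    obtain ⟨l, hl, hc⟩ := H
    exact ⟨l, hl, isMixed_of_two_lt_trace hp hl (hc.abs_trace_eq ▸ h), hc⟩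
  have key : ∀ u, IsWord p u → ConjUpToSign p M (wordMat p u * matT) →
      ∃ l, IsWord p l ∧ ConjUpToSign p M (wordMat p l) := by
    intro u hu hc
    rcases conjUpToSign_wordMat_mul_matT hp _ hu rfl with h' | ⟨k, hk, h'⟩ | ⟨l, hl, h'⟩
    · have := (hc.trans h').abs_trace_eq
      simp at this
      rw [this] at h
      norm_num at h
    · have := (hc.trans h').abs_trace_eq
      have := abs_trace_matU_pow_le hp hk
      linarith
    · exact ⟨l, hl, hc.trans h'⟩
  obtain ⟨u, hu, R, hR, e⟩ := exists_normalForm hp hM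
  obtain rfl | rfl := hR
  · rw [mul_one] at e
    obtain (rfl | rfl) | (rfl | rfl) := e
    · exact ⟨u, hu, ConjUpToSign.refl _ _⟩
    · exact ⟨u, hu, (ConjUpToSign.refl _ _).neg_left⟩
    · exact key u hu (conjUpToSign_mul_comm _ (matT_mem p))
    · exact key u hu (conjUpToSign_mul_comm _ (matT_mem p)).neg_left
  · have hc : ConjUpToSign p (matT * (wordMat p u * matT)) (wordMat p u) := by
      refine (conjUpToSign_mul_comm _ (matT_mem p)).trans ?_
      rw [mul_assoc, matT_mul_matT, mul_neg, mul_one]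
      exact (ConjUpToSign.refl _ _).neg_left
    obtain (rfl | rfl) | (rfl | rfl) := e
    · exact key u hu (ConjUpToSign.refl _ _)
    · exact key u hu (ConjUpToSign.refl _ _).neg_left
    · exact ⟨u, hu, hc⟩
    · exact ⟨u, hu, hc.neg_left⟩

/-! ### Simple forms and positive matrices -/

lemma formOf_conj (M N : SL(2, ℝ)) : formOf (N⁻¹ * M * N) = (formOf M).comp N := by
  have := det_eq_one N
  ext
  · simp only [formOf, BQF.comp, mul_apply_00, mul_apply_01, mul_apply_10, mul_apply_11,
      inv_apply_00, inv_apply_01, inv_apply_10, inv_apply_11]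
    ring
  · simp only [formOf, BQF.comp, mul_apply_00, mul_apply_01, mul_apply_10, mul_apply_11,
      inv_apply_00, inv_apply_01, inv_apply_10, inv_apply_11]
    ring
  · simp only [formOf, BQF.comp, mul_apply_00, mul_apply_01, mul_apply_10, mul_apply_11,
      inv_apply_00, inv_apply_01, inv_apply_10, inv_apply_11]
    ring

lemma posEntries_of_isSimple {M : SL(2, ℝ)} (h : (formOf M).IsSimple)
    (htr : 0 < M 0 0 + M 1 1) : PosEntries M := by
  obtain ⟨h1, h2⟩ := h
  simp only [formOf] at h1 h2
  have h3 : 0 < M 0 1 := by linarith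
  have hdet := det_eq_one M
  have := mul_pos h3 h1
  have : 0 < M 0 0 * M 1 1 := by linarith
  rcases mul_pos_iff.mp this with ⟨a, d⟩ | ⟨a, d⟩
  · exact ⟨a, h3, h1, d⟩
  · linarith

/-- The root of the form attached to a positive matrix is its only positive fixed point. -/
lemma PosEntries.moebius_eq_iff_root {M : SL(2, ℝ)} (hM : PosEntries M) {x : ℝ} :
    0 < x ∧ moebius M x = x ↔ x = (formOf M).root := by
  obtain ⟨h1, h2, h3, h4⟩ := hM
  set D := √((M 1 1 - M 0 0) ^ 2 - 4 * M 1 0 * -M 0 1) with hD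
  have hbc := mul_pos h2 h3
  have hD2 : D ^ 2 = (M 1 1 - M 0 0) ^ 2 - 4 * M 1 0 * -M 0 1 :=
    Real.sq_sqrt (by nlinarith [sq_nonneg (M 1 1 - M 0 0)])
  have hD0 : 0 ≤ D := Real.sqrt_nonneg _
  have hr : (formOf M).root = (-(M 1 1 - M 0 0) + D) / (2 * M 1 0) := rfl
  set r := (formOf M).root
  have hrpos : 0 < r := by
    rw [hr]
    apply div_pos _ (by linarith)
    have : |M 1 1 - M 0 0| < D := abs_lt_of_sq_lt_sq (by nlinarith) hD0
    linarith [(abs_lt.mp this).2]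
  have hreq : M 1 0 * r ^ 2 + (M 1 1 - M 0 0) * r - M 0 1 = 0 := by
    have h2r : 2 * M 1 0 * r = -(M 1 1 - M 0 0) + D := by rw [hr]; field_simp
    have : (4 * M 1 0) * (M 1 0 * r ^ 2 + (M 1 1 - M 0 0) * r - M 0 1) = 0 := by
      linear_combination (2 * M 1 0 * r + (M 1 1 - M 0 0) + D) * h2r + hD2
    exact (mul_eq_zero.mp this).resolve_left (by positivity)
  constructor
  · rintro ⟨hx, e⟩
    rw [moebius_eq_iff (by positivity)] at e
    have : (x - r) * (M 1 0 * x * r + M 0 1) = 0 := by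
      linear_combination -r * e - x * hreq
    have hne : M 1 0 * x * r + M 0 1 ≠ 0 := by positivity
    exact sub_eq_zero.mp ((mul_eq_zero.mp this).resolve_right hne)
  · rintro rfl
    refine ⟨hrpos, ?_⟩
    rw [moebius_eq_iff (by positivity)]
    linear_combination -hreq

lemma PosEntries.eq_of_moebius_eq {M : SL(2, ℝ)} (hM : PosEntries M) {x y : ℝ} (hx : 0 < x)
    (hy : 0 < y) (ex : moebius M x = x) (ey : moebius M y = y) : x = y :=
  (hM.moebius_eq_iff_root.mp ⟨hx, ex⟩).trans (hM.moebius_eq_iff_root.mp ⟨hy, ey⟩).symm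

/-- Simple numbers of a class are the positive fixed points of the words in the class. -/
lemma mem_simpleNumbers_iff {p : ℕ} (hp : 3 ≤ p) {c : ConjClasses (heckeGroup p)} {x : ℝ} :
    x ∈ simpleNumbers (formClass c) ↔ ∃ l, IsWord p l ∧ IsMixed p l ∧
      classOf (wordMat p l) (wordMat_mem p l) = c ∧ 0 < x ∧ moebius (wordMat p l) x = x := by
  constructor
  · rintro ⟨Q, ⟨g, M, rfl, hg, htr, N, hN, rfl⟩, hs, rfl⟩
    obtain ⟨hM, rfl⟩ := represents_iff.mp hg
    rw [toPSL_mem_iff] at hN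
    have hM' : N⁻¹ * M * N ∈ heckeMat p := mul_mem (mul_mem (inv_mem hN) hM) hN
    rw [← formOf_conj] at hs ⊢
    have hpos : PosEntries (N⁻¹ * M * N) := by
      refine posEntries_of_isSimple hs ?_
      have := trace_conj N⁻¹ M
      rw [inv_inv] at this
      rwa [this]
    obtain ⟨l, hl, hne, e⟩ := hpos.exists_word hp hM'
    obtain ⟨hx, hfix⟩ := hpos.moebius_eq_iff_root.mpr rfl
    have hfix' := hfix
    rw [e] at hfix'
    have hmix := isMixed_of_moebius_eq hp hl hne (e ▸ hx) hfix'
    refine ⟨l, hl, hmix, ?_, hx, e ▸ hfix⟩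
    change _ = classOf M hM
    rw [classOf_eq_iff]
    exact ⟨N, hN, .inl (by rw [← e]; group)⟩
  · rintro ⟨l, hl, hmix, rfl, hx, e⟩
    have hpos := hmix.posEntries hp hl
    refine ⟨formOf (wordMat p l), ⟨_, wordMat p l, rfl, rfl, ?_, 1, ?_, ?_⟩, ?_, ?_⟩
    · linarith [hpos.two_lt_trace]
    · exact one_mem _
    · rw [← formOf_conj]; simp
    · exact ⟨hpos.pos_10, by simpa [formOf] using hpos.pos_01⟩
    · exact hpos.moebius_eq_iff_root.mp ⟨hx, e⟩

lemma isPeriodicPt_of_moebius_eq {p : ℕ} (hp : 3 ≤ p) {l : List ℕ} (hl : IsWord p l) {x : ℝ}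
    (hx : 0 < x) (e : moebius (wordMat p l) x = x) :
    Function.IsPeriodicPt (shift p) l.length x := by
  have := shift_iterate_wordMat hp hl hx
  rwa [e] at this

lemma IsMixed.ne_nil {p : ℕ} {l : List ℕ} (h : IsMixed p l) : l ≠ [] := by
  rintro rfl
  obtain ⟨⟨j, hj, -⟩, -⟩ := h
  simp at hj

lemma pos_of_mem_simpleNumbers {p : ℕ} (hp : 3 ≤ p) {c : ConjClasses (heckeGroup p)} {x : ℝ}
    (h : x ∈ simpleNumbers (formClass c)) : 0 < x := by
  obtain ⟨l, -, -, -, hx, -⟩ := (mem_simpleNumbers_iff hp).mp h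
  exact hx

lemma mem_periodicPts_of_mem_simpleNumbers {p : ℕ} (hp : 3 ≤ p) {c : ConjClasses (heckeGroup p)}
    {x : ℝ} (h : x ∈ simpleNumbers (formClass c)) : x ∈ Function.periodicPts (shift p) := by
  obtain ⟨l, hl, hm, -, hx, e⟩ := (mem_simpleNumbers_iff hp).mp h
  exact ⟨l.length, List.length_pos_iff.mpr hm.ne_nil, isPeriodicPt_of_moebius_eq hp hl hx e⟩

lemma classOf_eq_of_conjUpToSign {p : ℕ} {M N : SL(2, ℝ)} {hM : M ∈ heckeMat p}
    {hN : N ∈ heckeMat p} (h : ConjUpToSign p M N) : classOf M hM = classOf N hN :=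
  (classOf_eq_iff hM hN).mpr h

/-- The simple numbers of a class are permuted by the shift. -/
lemma shift_mem_simpleNumbers {p : ℕ} (hp : 3 ≤ p) {c : ConjClasses (heckeGroup p)} {x : ℝ}
    (h : x ∈ simpleNumbers (formClass c)) : shift p x ∈ simpleNumbers (formClass c) := by
  obtain ⟨l, hl, hm, rfl, hx, e⟩ := (mem_simpleNumbers_iff hp).mp h
  obtain _ | ⟨j, l⟩ := l
  · exact absurd rfl hm.ne_nil
  have hjl := isWord_cons.mp hl
  have hy := moebius_wordMat_pos hp hjl.2 hx
  have e' := e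
  rw [moebius_wordMat_cons hp hjl.2 hx] at e'
  have hs : shift p x = moebius (wordMat p l) x := by
    conv_lhs => rw [← e']
    exact shift_moebius_matV hp hjl.1.1 hjl.1.2 hy
  have hj1 : IsWord p [j] := isWord_cons.mpr ⟨hjl.1, isWord_nil p⟩
  have hw : IsWord p (l ++ [j]) := isWord_append.mpr ⟨hjl.2, hj1⟩
  have hfix : moebius (wordMat p (l ++ [j])) (shift p x) = shift p x := by
    rw [hs, moebius_wordMat_append hp hj1 hy, wordMat_cons, wordMat_nil, mul_one, e']
  rw [mem_simpleNumbers_iff hp]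
  refine ⟨l ++ [j], hw, isMixed_of_moebius_eq hp hw (by simp) (hs ▸ hy) hfix, ?_, hs ▸ hy, hfix⟩
  apply classOf_eq_of_conjUpToSign
  rw [wordMat_append, wordMat_cons, wordMat_cons, wordMat_nil, mul_one]
  exact conjUpToSign_mul_comm _ (wordMat_mem p l)

/-- If `T N W = N' T N` with words `N, N', W`, then `T N` would carry the attracting fixed point
of `W` to a negative number, although the attracting fixed point of `N'` is positive. -/
lemma not_matT_mul_conj {p : ℕ} (hp : 3 ≤ p) {u w l : List ℕ} (hu : IsWord p u) (hw : IsWord p w)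
    (hl : IsWord p l) (hwm : IsMixed p w) (hlm : IsMixed p l) {x : ℝ} (hx : 0 < x)
    (e : moebius (wordMat p w) x = x)
    (h : matT * wordMat p u * wordMat p w = wordMat p l * (matT * wordMat p u)) : False := by
  have hN := nonnegEntries_wordMat hp hu
  have hW := hwm.posEntries hp hw
  have hL := hlm.posEntries hp hl
  have hP := hN.num_pos hx
  have hQ := hN.den_pos hx.le
  rw [moebius_eq_iff ((nonnegEntries_wordMat hp hw).den_pos hx.le).ne'] at e
  have htr : wordMat p l 0 0 + wordMat p l 1 1 = wordMat p w 0 0 + wordMat p w 1 1 := by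
    rw [← trace_conj (matT * wordMat p u) (wordMat p w), h, mul_inv_cancel_right]
  have e00 := congrArg (fun M : SL(2, ℝ) => M 0 0) h
  have e01 := congrArg (fun M : SL(2, ℝ) => M 0 1) h
  have e10 := congrArg (fun M : SL(2, ℝ) => M 1 0) h
  have e11 := congrArg (fun M : SL(2, ℝ) => M 1 1) h
  simp only [mul_apply_00, mul_apply_01, mul_apply_10, mul_apply_11, matT_00, matT_01, matT_10,
    matT_11] at e00 e01 e10 e11
  set κ := wordMat p w 1 0 * x + wordMat p w 1 1 with hκ
  set P := wordMat p u 0 0 * x + wordMat p u 0 1 with hPdef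
  set Q := wordMat p u 1 0 * x + wordMat p u 1 1 with hQdef
  have f0 : κ * Q = wordMat p l 0 0 * Q - wordMat p l 0 1 * P := by
    rw [hQdef, hPdef]
    linear_combination -x * e00 - e01 - wordMat p u 1 0 * e + wordMat p u 1 1 * hκ
  have f1 : κ * P = wordMat p l 1 1 * P - wordMat p l 1 0 * Q := by
    rw [hQdef, hPdef]
    linear_combination x * e10 + e11 - wordMat p u 0 0 * e + wordMat p u 0 1 * hκ
  have g0 : κ < wordMat p l 0 0 := by
    have := mul_pos hL.pos_01 hP
    exact lt_of_mul_lt_mul_right (by linarith) hQ.le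
  have g1 : κ < wordMat p l 1 1 := by
    have := mul_pos hL.pos_10 hQ
    exact lt_of_mul_lt_mul_right (by linarith) hP.le
  have k0 : wordMat p w 0 0 < κ := by
    have := hW.pos_01
    exact lt_of_mul_lt_mul_right (by linarith) hx.le
  have k1 : wordMat p w 1 1 < κ := by
    have := mul_pos hW.pos_10 hx
    linarith
  linarith

lemma exists_iterate_eq_of_iterate_eq {α : Type*} {f : α → α} {x y : α} {k : ℕ}
    (hy : y ∈ Function.periodicPts f) (h : f^[k] y = x) : ∃ i, f^[i] x = y := by
  obtain ⟨n, hn, hper⟩ := hy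
  refine ⟨k * n - k, ?_⟩
  rw [← h, ← Function.iterate_add_apply, Nat.sub_add_cancel (Nat.le_mul_of_pos_right k hn)]
  exact hper.const_mul k

/-- Any two simple numbers of a class lie on the same orbit of the shift. -/
lemma exists_iterate_eq_of_mem_simpleNumbers {p : ℕ} (hp : 3 ≤ p)
    {c : ConjClasses (heckeGroup p)} {x y : ℝ} (hx : x ∈ simpleNumbers (formClass c))
    (hy : y ∈ simpleNumbers (formClass c)) : ∃ i, (shift p)^[i] x = y := by
  have hyper := mem_periodicPts_of_mem_simpleNumbers hp hy
  obtain ⟨w, hw, hwm, rfl, hx0, ex⟩ := (mem_simpleNumbers_iff hp).mp hx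
  obtain ⟨l, hl, hlm, hc, hy0, ey⟩ := (mem_simpleNumbers_iff hp).mp hy
  obtain ⟨h, hh, e⟩ := (classOf_eq_iff _ _).mp hc.symm
  have hLpos := hlm.posEntries hp hl
  -- the traces are positive, so there is no sign
  have e1 : h * wordMat p w * h⁻¹ = wordMat p l := by
    refine e.resolve_right fun e => ?_
    have := trace_conj h (wordMat p w)
    rw [e, neg_apply, neg_apply] at this
    linarith [(hwm.posEntries hp hw).two_lt_trace, hLpos.two_lt_trace]
  obtain ⟨u, hu, R, ⟨n, rfl⟩, hform⟩ := exists_normalForm_mul_inv_pow hp hh hw hwm.ne_nil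
  -- replacing `h` by `h Wⁿ` gives `A N W = W' A N`
  have hcomm : ∀ A, h = A * (wordMat p w)⁻¹ ^ n ∨ h = -(A * (wordMat p w)⁻¹ ^ n) →
      A * wordMat p w = wordMat p l * A := by
    intro A hA
    have : h * wordMat p w = wordMat p l * h := by rw [← e1]; group
    have h3 : (wordMat p w)⁻¹ ^ n * wordMat p w = wordMat p w * (wordMat p w)⁻¹ ^ n := by group
    have h2 : A * (wordMat p w)⁻¹ ^ n * wordMat p w
        = wordMat p l * (A * (wordMat p w)⁻¹ ^ n) := by
      rcases hA with hA | hA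
      · rwa [← hA]
      · rw [hA, neg_mul, mul_neg, neg_inj] at this
        exact this
    rw [mul_assoc, h3, ← mul_assoc, ← mul_assoc] at h2
    exact mul_right_cancel h2
  rcases hform with hform | hform
  · have h2 := hcomm _ hform
    have hz := moebius_wordMat_pos hp hu hx0
    have : moebius (wordMat p u) x = y := by
      refine hLpos.eq_of_moebius_eq hz hy0 ?_ ey
      rw [← moebius_mul _ _ ((nonnegEntries_wordMat hp hu).den_pos hx0.le).ne', ← h2,
        moebius_mul _ _ ((nonnegEntries_wordMat hp hw).den_pos hx0.le).ne', ex]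
    refine exists_iterate_eq_of_iterate_eq hyper (k := u.length) ?_
    rw [← this]
    exact shift_iterate_wordMat hp hu hx0
  · rw [← mul_assoc] at hform
    exact (not_matT_mul_conj hp hu hw hl hwm hlm hx0 ex (hcomm _ hform)).elim

lemma mem_simpleNumbers_iff_exists_iterate {p : ℕ} (hp : 3 ≤ p) {c : ConjClasses (heckeGroup p)}
    {x : ℝ} (hx : x ∈ simpleNumbers (formClass c)) {y : ℝ} :
    y ∈ simpleNumbers (formClass c) ↔ ∃ i, (shift p)^[i] x = y := by
  refine ⟨exists_iterate_eq_of_mem_simpleNumbers hp hx, ?_⟩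
  rintro ⟨i, rfl⟩
  induction i with
  | zero => exact hx
  | succ i ih => rw [Function.iterate_succ_apply']; exact shift_mem_simpleNumbers hp ih

/-! ### Primitive classes -/

/-- The word of length the minimal period that fixes a periodic point. -/
lemma exists_minimal_word {p : ℕ} (hp : 3 ≤ p) {x : ℝ} (hx : 0 < x)
    (hper : x ∈ Function.periodicPts (shift p)) :
    ∃ v, IsWord p v ∧ v ≠ [] ∧ moebius (wordMat p v) x = x ∧
      ∀ l, IsWord p l → moebius (wordMat p l) x = x → ∃ k, l.length = k * v.length ∧
        wordMat p l = wordMat p v ^ k := by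
  set n := Function.minimalPeriod (shift p) x
  have hn : 0 < n := Function.minimalPeriod_pos_of_mem_periodicPts hper
  have hit : (shift p)^[n] x = x := Function.iterate_minimalPeriod
  obtain ⟨v, hv, hlen, e⟩ :=
    exists_wordMat_of_iterate_pos hp hx (by rwa [hit] : 0 < (shift p)^[n] x)
  rw [hit] at e
  refine ⟨v, hv, by rintro rfl; simp at hlen; omega, e.symm, fun l hl el => ?_⟩
  have hdvd : n ∣ l.length := (isPeriodicPt_of_moebius_eq hp hl hx el).minimalPeriod_dvd
  obtain ⟨k, hk⟩ := hdvd
  have hrep : ∀ k, IsWord p (List.replicate k v).flatten ∧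
      (List.replicate k v).flatten.length = n * k ∧
      wordMat p (List.replicate k v).flatten = wordMat p v ^ k ∧
      moebius (wordMat p (List.replicate k v).flatten) x = x := by
    intro k
    induction k with
    | zero => simp [isWord_nil, moebius_one]
    | succ k ih =>
      obtain ⟨h1, h2, h3, h4⟩ := ih
      rw [List.replicate_succ, List.flatten_cons]
      refine ⟨isWord_append.mpr ⟨hv, h1⟩, ?_, ?_, ?_⟩
      · rw [List.length_append, h2, hlen]; ring
      · rw [wordMat_append, h3, pow_succ']
      · rw [moebius_wordMat_append hp h1 hx, h4, ← e]
  obtain ⟨h1, h2, h3, h4⟩ := hrep k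
  have := (wordMat_moebius_injective hp hl h1 (hk.trans h2.symm) hx hx (el.trans h4.symm)).1
  exact ⟨k, by rw [hk, hlen, mul_comm], by rw [this, h3]⟩

lemma IsPrimitive.of_isConj {p : ℕ} {g h : heckeGroup p} (hg : IsPrimitive g)
    (hc : IsConj g h) : IsPrimitive h := by
  intro k n hn e
  obtain ⟨a, rfl⟩ := isConj_iff.mp hc
  refine hg (a⁻¹ * k * a) n hn ?_
  have := conj_pow (i := n) (a := a⁻¹) (b := k)
  rw [inv_inv] at this
  rw [this, e]
  group

/-- A primitive class is determined by any of its simple numbers. -/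
lemma eq_of_mem_simpleNumbers {p : ℕ} (hp : 3 ≤ p) {c d : ConjClasses (heckeGroup p)}
    (hc : IsPrimitiveHyperbolicClass c) (hd : IsPrimitiveHyperbolicClass d) {x : ℝ}
    (hxc : x ∈ simpleNumbers (formClass c)) (hxd : x ∈ simpleNumbers (formClass d)) : c = d := by
  have hx := pos_of_mem_simpleNumbers hp hxc
  obtain ⟨v, hv, hne, ev, hmin⟩ :=
    exists_minimal_word hp hx (mem_periodicPts_of_mem_simpleNumbers hp hxc)
  have key : ∀ c : ConjClasses (heckeGroup p), IsPrimitiveHyperbolicClass c →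
      x ∈ simpleNumbers (formClass c) → c = classOf (wordMat p v) (wordMat_mem p v) := by
    rintro c ⟨g, hgc, hprim, -⟩ hxc
    obtain ⟨l, hl, hlm, hlc, -, el⟩ := (mem_simpleNumbers_iff hp).mp hxc
    obtain ⟨k, hk, ek⟩ := hmin l hl el
    have hprim' : IsPrimitive (toHecke p ⟨wordMat p l, wordMat_mem p l⟩) := by
      refine hprim.of_isConj ?_
      rw [← ConjClasses.mk_eq_mk_iff_isConj, hgc, ← hlc]; rfl
    have hpow : toHecke p ⟨wordMat p v, wordMat_mem p v⟩ ^ k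
        = toHecke p ⟨wordMat p l, wordMat_mem p l⟩ := by
      rw [← map_pow]
      congr 1
      exact Subtype.ext ek.symm
    have hk2 : ¬ 2 ≤ k := fun h => hprim' _ k h hpow
    have hk0 : k ≠ 0 := by
      rintro rfl
      rw [zero_mul] at hk
      exact hlm.ne_nil (List.length_eq_zero_iff.mp hk)
    obtain rfl : k = 1 := by omega
    rw [pow_one] at ek
    rw [← hlc]
    exact classOf_eq_of_conjUpToSign (ek ▸ ConjUpToSign.refl _ _)
  rw [key c hc hxc, key d hd hxd]

lemma isHyperbolic_toHecke_iff {p : ℕ} {M : SL(2, ℝ)} (hM : M ∈ heckeMat p) :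
    IsHyperbolic (toHecke p ⟨M, hM⟩) ↔ 2 < |M 0 0 + M 1 1| := by
  constructor
  · rintro ⟨N, hN, h⟩
    rcases toPSL_eq_iff.mp (show toPSL N = toPSL M from hN) with rfl | rfl
    · exact h
    · rwa [neg_apply, neg_apply, ← neg_add, abs_neg] at h
  · exact fun h => ⟨M, rfl, h⟩

/-- Every hyperbolic class has a simple number. -/
lemma exists_mem_simpleNumbers {p : ℕ} (hp : 3 ≤ p) {c : ConjClasses (heckeGroup p)}
    (hc : IsPrimitiveHyperbolicClass c) : ∃ x, x ∈ simpleNumbers (formClass c) := by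
  obtain ⟨g, rfl, -, hh⟩ := hc
  obtain ⟨⟨M, hM⟩, rfl⟩ := toHecke_surjective p g
  rw [isHyperbolic_toHecke_iff] at hh
  obtain ⟨l, hl, hm, hconj⟩ := exists_word_of_hyperbolic hp hM hh
  obtain ⟨h1, h2⟩ := (hm.posEntries hp hl).moebius_eq_iff_root.mpr rfl
  exact ⟨_, (mem_simpleNumbers_iff hp).mpr
    ⟨l, hl, hm, (classOf_eq_of_conjUpToSign (hM := hM) hconj).symm, h1, h2⟩⟩

lemma PosEntries.mul {M N : SL(2, ℝ)} (hM : PosEntries M) (hN : PosEntries N) :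
    PosEntries (M * N) := by
  obtain ⟨a1, a2, a3, a4⟩ := hM
  obtain ⟨b1, b2, b3, b4⟩ := hN
  constructor
  · rw [mul_apply_00]; positivity
  · rw [mul_apply_01]; positivity
  · rw [mul_apply_10]; positivity
  · rw [mul_apply_11]; positivity

lemma PosEntries.pow {M : SL(2, ℝ)} (hM : PosEntries M) (n : ℕ) : PosEntries (M ^ (n + 1)) := by
  induction n with
  | zero => simpa using hM
  | succ n ih => rw [pow_succ]; exact ih.mul hM

lemma PosEntries.toHecke_pow_ne_one {p : ℕ} {M : heckeMat p} (hM : PosEntries (M : SL(2, ℝ)))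
    {n : ℕ} (hn : n ≠ 0) : toHecke p M ^ n ≠ 1 := by
  obtain ⟨m, rfl⟩ := Nat.exists_eq_succ_of_ne_zero hn
  intro h
  rw [← map_pow, ← map_one (toHecke p), toHecke_eq_iff] at h
  have := (hM.pow m).pos_01
  rcases h with h | h
  · rw [show (M : SL(2, ℝ)) ^ (m + 1) = 1 from h] at this
    simp at this
  · rw [show (M : SL(2, ℝ)) ^ (m + 1) = -1 from h, neg_apply] at this
    simp at this

/-- A matrix that commutes with a positive matrix is `±1`, or becomes positive after a change of
sign and possibly an inversion; in the second case the fixed points are the same. -/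
lemma PosEntries.of_commute {M h : SL(2, ℝ)} (hM : PosEntries M) (hc : h * M = M * h) {x : ℝ}
    (hx : 0 < x) (e : moebius M x = x) :
    (h = 1 ∨ h = -1) ∨
      ∃ g, (g = h ∨ g = -h ∨ g = h⁻¹ ∨ g = -h⁻¹) ∧ PosEntries g ∧ moebius g x = x := by
  obtain ⟨p0, p1, p2, p3⟩ := hM
  have e00 := congrArg (fun M : SL(2, ℝ) => M 0 0) hc
  have e01 := congrArg (fun M : SL(2, ℝ) => M 0 1) hc
  simp only [mul_apply_00, mul_apply_01] at e00 e01
  obtain ⟨t, ht⟩ : ∃ t, h 0 1 = t * M 0 1 := ⟨h 0 1 / M 0 1, by field_simp⟩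
  have h10 : h 1 0 = t * M 1 0 := by
    apply mul_left_cancel₀ p1.ne'
    linear_combination -e00 + M 1 0 * ht
  have hd : h 0 0 = h 1 1 + t * (M 0 0 - M 1 1) := by
    apply mul_left_cancel₀ p1.ne'
    linear_combination e01 + (M 0 0 - M 1 1) * ht
  have hdet := det_eq_one h
  rw [moebius_eq_iff (by positivity)] at e
  have hfix : h 0 0 * x + h 0 1 = x * (h 1 0 * x + h 1 1) := by
    rw [h10, ht, hd]; linear_combination t * e
  by_cases ht0 : t = 0
  · left
    subst ht0
    have h00 : h 0 0 = h 1 1 := by simpa using hd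
    have h01 : h 0 1 = 0 := by simpa using ht
    have h10 : h 1 0 = 0 := by simpa using h10
    rw [h00, h01, zero_mul, sub_zero, mul_self_eq_one_iff] at hdet
    rcases hdet with h1 | h1
    · left; apply ext_entries <;> simp [h00, h01, h10, h1]
    · right; apply ext_entries <;> simp [h00, h01, h10, h1, neg_apply]
  · right
    have h2 : 0 < h 0 1 * h 1 0 := by
      rw [ht, h10]
      have : 0 < t ^ 2 := by positivity
      nlinarith [mul_pos this (mul_pos p1 p2)]
    have h1 : 0 < h 0 0 * h 1 1 := by linarith
    rcases mul_pos_iff.mp h1 with ⟨a, d⟩ | ⟨a, d⟩ <;> rcases mul_pos_iff.mp h2 with ⟨b, c⟩ | ⟨b, c⟩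
    · refine ⟨h, .inl rfl, ⟨a, b, c, d⟩, ?_⟩
      rw [moebius_eq_iff (by positivity)]; exact hfix
    · have hpos : PosEntries h⁻¹ := by
        constructor
        · rwa [inv_apply_00]
        · rw [inv_apply_01]; linarith
        · rw [inv_apply_10]; linarith
        · rwa [inv_apply_11]
      refine ⟨h⁻¹, .inr (.inr (.inl rfl)), hpos, ?_⟩
      have := hpos.pos_10
      have := hpos.pos_11
      rw [moebius_eq_iff (by positivity), inv_apply_00, inv_apply_01, inv_apply_10, inv_apply_11]
      linear_combination -hfix
    · have hpos : PosEntries (-h⁻¹) := by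
        constructor
        · rw [neg_apply, inv_apply_00]; linarith
        · rw [neg_apply, inv_apply_01]; linarith
        · rw [neg_apply, inv_apply_10]; linarith
        · rw [neg_apply, inv_apply_11]; linarith
      refine ⟨-h⁻¹, .inr (.inr (.inr rfl)), hpos, ?_⟩
      have := hpos.pos_10
      have := hpos.pos_11
      rw [moebius_eq_iff (by positivity)]
      simp only [neg_apply, inv_apply_00, inv_apply_01, inv_apply_10, inv_apply_11]
      linear_combination hfix
    · have hpos : PosEntries (-h) := by
        constructor <;> rw [neg_apply] <;> linarith
      refine ⟨-h, .inr (.inl rfl), hpos, ?_⟩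
      have := hpos.pos_10
      have := hpos.pos_11
      rw [moebius_eq_iff (by positivity)]
      simp only [neg_apply]
      linear_combination -hfix

/-- Every positive periodic point of the shift is a simple number of a primitive class. -/
lemma exists_class_of_mem_periodicPts {p : ℕ} (hp : 3 ≤ p) {x : ℝ} (hx : 0 < x)
    (hper : x ∈ Function.periodicPts (shift p)) :
    ∃ c : ConjClasses (heckeGroup p), IsPrimitiveHyperbolicClass c ∧
      x ∈ simpleNumbers (formClass c) := by
  obtain ⟨v, hv, hne, ev, hmin⟩ := exists_minimal_word hp hx hper
  have hm := isMixed_of_moebius_eq hp hv hne hx ev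
  have hpos := hm.posEntries hp hv
  refine ⟨classOf (wordMat p v) (wordMat_mem p v), ⟨_, rfl, ?_, ?_⟩,
    (mem_simpleNumbers_iff hp).mpr ⟨v, hv, hm, rfl, hx, ev⟩⟩
  · intro η n hn e
    obtain ⟨h, rfl⟩ := toHecke_surjective p η
    set γ := toHecke p ⟨wordMat p v, wordMat_mem p v⟩ with hγ
    have hne1 : ∀ m, m ≠ 0 → γ ^ m ≠ 1 := fun m hm =>
      PosEntries.toHecke_pow_ne_one (M := ⟨wordMat p v, wordMat_mem p v⟩) hpos hm
    have hcomm : (h : SL(2, ℝ)) * wordMat p v = wordMat p v * h := by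
      have h0 : (h : SL(2, ℝ)) ^ n = wordMat p v ∨ (h : SL(2, ℝ)) ^ n = -wordMat p v := by
        rw [hγ, ← map_pow, toHecke_eq_iff] at e
        exact e
      have hs := (Commute.refl (h : SL(2, ℝ))).pow_right n
      rcases h0 with h0 | h0
      · rw [h0] at hs; exact hs
      · rw [h0] at hs
        have := hs.eq
        rwa [mul_neg, neg_mul, neg_inj] at this
    rcases hpos.of_commute hcomm hx ev with h1 | ⟨g, hg, hgpos, hgx⟩
    · have : toHecke p h = 1 := by rw [← map_one (toHecke p), toHecke_eq_iff]; exact h1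
      rw [this, one_pow] at e
      exact hne1 1 one_ne_zero (by rw [pow_one]; exact e.symm)
    · have hgm : g ∈ heckeMat p := by
        rcases hg with rfl | rfl | rfl | rfl
        · exact h.2
        · exact neg_mem_heckeMat h.2
        · exact inv_mem h.2
        · exact neg_mem_heckeMat (inv_mem h.2)
      obtain ⟨l, hl, hlne, rfl⟩ := hgpos.exists_word hp hgm
      obtain ⟨k, hk, ek⟩ := hmin l hl hgx
      have hk0 : 1 ≤ k := by
        rw [Nat.one_le_iff_ne_zero]
        rintro rfl
        rw [zero_mul] at hk
        exact hlne (List.length_eq_zero_iff.mp hk)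
      have hkn : 2 ≤ k * n := by nlinarith
      have hγk : γ ^ k = toHecke p ⟨wordMat p l, wordMat_mem p l⟩ := by
        rw [hγ, ← map_pow]; congr 1; exact Subtype.ext ek.symm
      have hη : toHecke p h = γ ^ k ∨ (toHecke p h)⁻¹ = γ ^ k := by
        rw [hγk, ← map_inv, toHecke_eq_iff, toHecke_eq_iff]
        rcases hg with hg | hg | hg | hg
        · left; left; exact hg.symm
        · left; right; change (h : SL(2, ℝ)) = -wordMat p l; rw [hg, neg_neg]
        · right; left; exact hg.symm
        · right; right; change (h : SL(2, ℝ))⁻¹ = -wordMat p l; rw [hg, neg_neg]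
      rcases hη with hη | hη
      · rw [hη, ← pow_mul] at e
        refine hne1 (k * n - 1) (by omega) ?_
        have : γ ^ (k * n - 1) * γ = γ := by rw [← pow_succ, Nat.sub_add_cancel (by omega), e]
        simpa using this
      · rw [← inv_inv (toHecke p h), hη, inv_pow, ← pow_mul] at e
        refine hne1 (k * n + 1) (by omega) ?_
        calc γ ^ (k * n + 1) = γ ^ (k * n) * (γ ^ (k * n))⁻¹ := by rw [e, pow_succ]
          _ = 1 := mul_inv_cancel _
  · rw [isHyperbolic_toHecke_iff]
    exact lt_of_lt_of_le hpos.two_lt_trace (le_abs_self _)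

/-! ### Generator products -/

/-- The word spelled by the exponent data of a generator product. -/
def expand (w : List (ℕ × ℕ)) : List ℕ := w.flatMap fun b => List.replicate b.1 1 ++ [b.2]

@[simp] lemma expand_nil : expand [] = [] := rfl

lemma expand_cons (b : ℕ × ℕ) (w : List (ℕ × ℕ)) :
    expand (b :: w) = List.replicate b.1 1 ++ b.2 :: expand w := by
  simp [expand]

lemma isWord_expand {p : ℕ} {w : List (ℕ × ℕ)}
    (hw : ∀ b ∈ w, 2 ≤ b.2 ∧ b.2 ≤ p - 1) : IsWord p (expand w) := by
  induction w with
  | nil => exact isWord_nil p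
  | cons b w ih =>
    have hb := hw b (by simp)
    rw [expand_cons, isWord_append, isWord_cons]
    refine ⟨fun j hj => ?_, ⟨by omega, hb.2⟩, ih fun b' hb' => hw b' (by simp [hb'])⟩
    obtain rfl := List.eq_of_mem_replicate hj
    omega

lemma genProduct_eq_toHecke (p : ℕ) (w : List (ℕ × ℕ)) :
    genProduct p w = toHecke p ⟨wordMat p (expand w), wordMat_mem p _⟩ := by
  have hV : ∀ j, genV p j = toHecke p ⟨matV p j, matV_mem p j⟩ := fun j => rfl
  have hrep : ∀ m, genV p 1 ^ m =
      toHecke p ⟨wordMat p (List.replicate m 1), wordMat_mem p _⟩ := by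
    intro m
    rw [hV, ← map_pow]
    congr 1
    apply Subtype.ext
    simp [wordMat]
  induction w with
  | nil => exact (map_one (toHecke p)).symm
  | cons b w ih =>
    have : genProduct p (b :: w) = genV p 1 ^ b.1 * genV p b.2 * genProduct p w := by
      simp [genProduct]
    rw [this, ih, hrep, hV, ← map_mul, ← map_mul]
    congr 1
    apply Subtype.ext
    simp only [expand_cons, wordMat_append, wordMat_cons, mul_assoc]
    rfl

/-- A word whose last letter is not `1` is spelled by exponent data. -/
lemma exists_expand_eq {p : ℕ} {l : List ℕ} (hl : IsWord p l) {i : ℕ} (h2 : 2 ≤ i)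
    (hi : i ≤ p - 1) : ∃ w, IsProductData p w ∧ expand w = l ++ [i] := by
  induction l with
  | nil => exact ⟨[(0, i)], ⟨by simp, by simp [h2, hi]⟩, by simp [expand]⟩
  | cons j l ih =>
    rw [isWord_cons] at hl
    obtain ⟨w, ⟨hne, hw⟩, e⟩ := ih hl.2
    by_cases hj : j = 1
    · subst hj
      obtain _ | ⟨⟨m, k⟩, w⟩ := w
      · exact absurd rfl hne
      refine ⟨(m + 1, k) :: w, ⟨by simp, fun b hb => ?_⟩, ?_⟩
      · rcases List.mem_cons.mp hb with rfl | hb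
        · exact hw (m, k) (by simp)
        · exact hw b (by simp [hb])
      · rw [expand_cons] at e ⊢
        rw [List.cons_append, ← e]
        simp [List.replicate_succ]
    · refine ⟨(0, j) :: w, ⟨by simp, fun b hb => ?_⟩, ?_⟩
      · rcases List.mem_cons.mp hb with rfl | hb
        · exact ⟨by dsimp only; omega, hl.1.2⟩
        · exact hw b hb
      · rw [expand_cons, e]; simp

lemma exists_genProduct {p : ℕ} (hp : 3 ≤ p) {c : ConjClasses (heckeGroup p)}
    (hc : IsPrimitiveHyperbolicClass c) :
    ∃ w : List (ℕ × ℕ), IsProductData p w ∧ ConjClasses.mk (genProduct p w) = c := by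
  obtain ⟨x, hx⟩ := exists_mem_simpleNumbers hp hc
  obtain ⟨l, hl, ⟨⟨i, hi, hi2⟩, -⟩, rfl, -, -⟩ := (mem_simpleNumbers_iff hp).mp hx
  obtain ⟨l₁, l₂, rfl⟩ := List.append_of_mem hi
  obtain ⟨h1, h2⟩ := isWord_append.mp hl
  obtain ⟨h2, h3⟩ := isWord_cons.mp h2
  obtain ⟨w, hw, e⟩ := exists_expand_eq (isWord_append.mpr ⟨h3, h1⟩) hi2 h2.2
  refine ⟨w, hw, ?_⟩
  rw [genProduct_eq_toHecke]
  refine classOf_eq_of_conjUpToSign (hM := wordMat_mem p _) (hN := wordMat_mem p _) ?_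
  have e1 : expand w = l₂ ++ (l₁ ++ [i]) := by rw [e, List.append_assoc]
  have e2 : l₁ ++ i :: l₂ = (l₁ ++ [i]) ++ l₂ := by simp
  rw [e1, e2, wordMat_append, wordMat_append p _ l₂]
  exact conjUpToSign_mul_comm _ (wordMat_mem p _)

/-! ### Continued fractions -/

lemma cfQuotient_add (p : ℕ) (x : ℝ) (m n : ℕ) :
    cfQuotient p x (m + n) = cfQuotient p (cfQuotient p x m) n := by
  induction n with
  | zero => rfl
  | succ n ih => rw [← add_assoc, cfQuotient, cfQuotient, ih]

lemma cfEntry_add (p : ℕ) (x : ℝ) (m n : ℕ) :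
    cfEntry p x (m + n) = cfEntry p (cfQuotient p x m) n := by
  rw [cfEntry, cfEntry, cfQuotient_add]

lemma cfQuotient_one (p : ℕ) (x : ℝ) :
    cfQuotient p x 1 = 1 / ((cfEntry p x 0 : ℝ) * lam p - x) := rfl

lemma cfEntry_zero_mul_sub_pos {p : ℕ} (hp : 3 ≤ p) (x : ℝ) :
    0 < (cfEntry p x 0 : ℝ) * lam p - x := by
  have := Int.lt_floor_add_one (x / lam p)
  rw [div_lt_iff₀ (lam_pos hp)] at this
  simp only [cfEntry, cfQuotient]
  push_cast
  linarith

lemma cfQuotient_one_pos {p : ℕ} (hp : 3 ≤ p) (x : ℝ) : 0 < cfQuotient p x 1 := by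
  rw [cfQuotient_one]
  exact one_div_pos.mpr (cfEntry_zero_mul_sub_pos hp x)

lemma eq_sub_one_div_cfQuotient (p : ℕ) (x : ℝ) :
    x = (cfEntry p x 0 : ℝ) * lam p - 1 / cfQuotient p x 1 := by
  rw [cfQuotient_one, one_div_one_div]; ring

lemma cfEntry_zero_eq {p : ℕ} (hp : 3 ≤ p) {x : ℝ} {r : ℤ} (h1 : ((r : ℝ) - 1) * lam p ≤ x)
    (h2 : x < r * lam p) : cfEntry p x 0 = r := by
  have hl := lam_pos hp
  have : ⌊x / lam p⌋ = r - 1 := by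
    rw [Int.floor_eq_iff, le_div_iff₀ hl, div_lt_iff₀ hl]
    push_cast
    exact ⟨h1, by linarith⟩
  simp only [cfEntry, cfQuotient, this]
  ring

lemma lam_le_of_cfEntry_zero {p : ℕ} (hp : 3 ≤ p) {x : ℝ} (h : 2 ≤ cfEntry p x 0) :
    lam p ≤ x := by
  have hl := lam_pos hp
  have h1 : (1 : ℤ) ≤ ⌊x / lam p⌋ := by simp only [cfEntry, cfQuotient] at h; omega
  rw [Int.le_floor, le_div_iff₀ hl] at h1
  simpa using h1

/-- `V_{j+1} y = U (V_j y)`. -/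
lemma moebius_matV_succ {p j : ℕ} (hp : 3 ≤ p) (h1 : 1 ≤ j) (h2 : j ≤ p - 1) {y : ℝ}
    (hy : 0 ≤ y) (hpos : 0 < moebius (matV p j) y) :
    moebius (matV p (j + 1)) y = lam p - 1 / moebius (matV p j) y := by
  rw [← matU_mul_matV h1, moebius_mul _ _ ((nonnegEntries_matV hp h1 h2).den_pos hy).ne',
    moebius, matU_00, matU_01, matU_10, matU_11]
  field_simp
  ring

lemma moebius_matV_lt_lam {p j : ℕ} (hp : 3 ≤ p) (h1 : 2 ≤ j) (h2 : j ≤ p - 1) {y : ℝ}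
    (hy : 0 < y) : moebius (matV p j) y < lam p := by
  obtain ⟨i, rfl⟩ := Nat.exists_eq_add_of_le' (show 1 ≤ j by omega)
  have := (nonnegEntries_matV hp (show 1 ≤ i by omega) (by omega)).moebius_pos hy
  rw [moebius_matV_succ hp (by omega) (by omega) hy.le this]
  have := one_div_pos.mpr this
  linarith

/-- The number `V_{k+1} y` has `k` entries equal to one, after which the complete quotient is
`y + λ`. -/
lemma cf_moebius_matV {p k : ℕ} (hp : 3 ≤ p) (hk : k + 1 ≤ p - 1) {y : ℝ} (hy : 0 < y) :
    (∀ n < k, cfEntry p (moebius (matV p (k + 1)) y) n = 1) ∧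
      cfQuotient p (moebius (matV p (k + 1)) y) k = y + lam p := by
  induction k with
  | zero => simp [matV_one, moebius_matS, cfQuotient]
  | succ k ih =>
    obtain ⟨ih1, ih2⟩ := ih (by omega)
    have hpos := (nonnegEntries_matV hp (show 1 ≤ k + 1 by omega) (by omega)).moebius_pos hy
    have hpos' := (nonnegEntries_matV hp (show 1 ≤ k + 2 by omega) (by omega)).moebius_pos hy
    have hlt := moebius_matV_lt_lam hp (show 2 ≤ k + 2 by omega) (by omega) hy
    have e0 : cfEntry p (moebius (matV p (k + 2)) y) 0 = 1 :=
      cfEntry_zero_eq hp (by simpa using hpos'.le) (by simpa using hlt)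
    have e1 : cfQuotient p (moebius (matV p (k + 2)) y) 1 = moebius (matV p (k + 1)) y := by
      rw [cfQuotient_one, e0, moebius_matV_succ hp (by omega) (by omega) hy.le hpos]
      simp
    constructor
    · rintro (_ | n) hn
      · exact e0
      · rw [add_comm n 1, cfEntry_add, e1]
        exact ih1 n (by omega)
    · rw [add_comm k 1, cfQuotient_add, add_comm 1 k, e1, ih2]

lemma moebius_wordMat_replicate_one {p : ℕ} (n : ℕ) (x : ℝ) :
    moebius (wordMat p (List.replicate n 1)) x = x + n * lam p := by
  obtain ⟨h1, h2, h3, h4⟩ := wordMat_replicate_one (p := p) n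
  rw [moebius, h1, h2, h3, h4]; simp

lemma moebius_wordMat_expand_cons {p : ℕ} (hp : 3 ≤ p) {b : ℕ × ℕ} {w : List (ℕ × ℕ)}
    (hw : ∀ b' ∈ b :: w, 2 ≤ b'.2 ∧ b'.2 ≤ p - 1) {y : ℝ} (hy : 0 ≤ y) :
    moebius (wordMat p (expand (b :: w))) y =
      moebius (matV p b.2) (moebius (wordMat p (expand w)) y) + b.1 * lam p := by
  have hw' : IsWord p (expand w) :=
    isWord_expand fun b' hb' => hw b' (by simp [hb'])
  have hb : IsWord p (b.2 :: expand w) :=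
    isWord_cons.mpr ⟨⟨by linarith [(hw b (by simp)).1], (hw b (by simp)).2⟩, hw'⟩
  rw [expand_cons, wordMat_append, moebius_mul _ _ ((nonnegEntries_wordMat hp hb).den_pos hy).ne',
    wordMat_cons, moebius_mul _ _ ((nonnegEntries_wordMat hp hw').den_pos hy).ne',
    moebius_wordMat_replicate_one]

lemma periodOf_cons (b : ℕ × ℕ) (w : List (ℕ × ℕ)) :
    periodOf (b :: w) = (((b.1 : ℤ) + 2) :: List.replicate (b.2 - 2) 1) ++ periodOf w := by
  simp [periodOf]

/-- The continued fraction of `N y + λ`, where `N` is a generator product, begins with the entries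
listed by `periodOf`, after which the complete quotient is `y + λ`. -/
lemma cf_moebius_expand {p : ℕ} (hp : 3 ≤ p) {w : List (ℕ × ℕ)}
    (hw : ∀ b ∈ w, 2 ≤ b.2 ∧ b.2 ≤ p - 1) {y : ℝ} (hy : 0 < y) :
    (∀ n < (periodOf w).length,
      cfEntry p (moebius (wordMat p (expand w)) y + lam p) n = (periodOf w).getD n 0) ∧
      cfQuotient p (moebius (wordMat p (expand w)) y + lam p) (periodOf w).length = y + lam p := by
  induction w with
  | nil => simp [periodOf, moebius_one, cfQuotient]
  | cons b w ih =>
    have hw' : ∀ b' ∈ w, 2 ≤ b'.2 ∧ b'.2 ≤ p - 1 := fun b' hb' => hw b' (by simp [hb'])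
    obtain ⟨ih1, ih2⟩ := ih hw'
    obtain ⟨m, j⟩ := b
    obtain ⟨hj1, hj2⟩ : 2 ≤ j ∧ j ≤ p - 1 := hw (m, j) (by simp)
    obtain ⟨k, rfl⟩ := Nat.exists_eq_add_of_le' hj1
    have hz := moebius_wordMat_pos hp (isWord_expand hw') hy
    rw [moebius_wordMat_expand_cons hp hw hy.le, periodOf_cons]
    set z := moebius (wordMat p (expand w)) y
    dsimp only
    rw [show k + 2 - 2 = k by omega]
    have hpos := (nonnegEntries_matV hp (show 1 ≤ k + 2 by omega) hj2).moebius_pos hz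
    have hpos' := (nonnegEntries_matV hp (show 1 ≤ k + 1 by omega) (by omega)).moebius_pos hz
    have hlt := moebius_matV_lt_lam hp hj1 hj2 hz
    obtain ⟨c1, c2⟩ := cf_moebius_matV hp (show k + 1 ≤ p - 1 by omega) hz
    set β := moebius (matV p (k + 2)) z + m * lam p + lam p with hβ
    have e0 : cfEntry p β 0 = (m : ℤ) + 2 :=
      cfEntry_zero_eq hp (by push_cast; linarith) (by push_cast; linarith)
    have e1 : cfQuotient p β 1 = moebius (matV p (k + 1)) z := by
      rw [cfQuotient_one, e0, hβ, moebius_matV_succ hp (by omega) (by omega) hz.le hpos']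
      push_cast
      rw [show ((m : ℝ) + 2) * lam p - (lam p - 1 / moebius (matV p (k + 1)) z + m * lam p + lam p)
        = 1 / moebius (matV p (k + 1)) z by ring, one_div_one_div]
    have e2 : cfQuotient p β (k + 1) = z + lam p := by
      rw [add_comm, cfQuotient_add, e1, c2]
    constructor
    · intro n hn
      rcases lt_or_ge n (k + 1) with h | h
      · rw [List.getD_append _ _ _ _ (by simpa using h)]
        rcases n with _ | n
        · simpa using e0
        · rw [add_comm n 1, cfEntry_add, e1, c1 n (by omega), add_comm 1 n, List.getD_cons_succ,
            List.getD_replicate _ (by omega)]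
      · rw [List.getD_append_right _ _ _ _ (by simpa using h)]
        obtain ⟨i, rfl⟩ := Nat.exists_eq_add_of_le h
        rw [cfEntry_add, e2]
        simp only [List.length_cons, List.length_append, List.length_replicate] at hn ⊢
        rw [Nat.add_sub_cancel_left]
        exact ih1 i (by omega)
    · simp only [List.length_cons, List.length_append, List.length_replicate]
      rw [cfQuotient_add, e2, ih2]

lemma periodOf_ne_nil {w : List (ℕ × ℕ)} (h : w ≠ []) : periodOf w ≠ [] := by
  obtain _ | ⟨b, w⟩ := w
  · exact absurd rfl h
  · simp [periodOf_cons]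

lemma cfQuotient_mul_of_fixed {p : ℕ} {x : ℝ} {L : ℕ} (h : cfQuotient p x L = x) (k : ℕ) :
    cfQuotient p x (L * k) = x := by
  induction k with
  | zero => rfl
  | succ k ih => rw [Nat.mul_succ, cfQuotient_add, ih, h]

lemma hasCFPeriod_of_moebius_eq {p : ℕ} (hp : 3 ≤ p) {w : List (ℕ × ℕ)} (hw : IsProductData p w)
    {x : ℝ} (hx : 0 < x) (e : moebius (wordMat p (expand w)) x = x) :
    HasCFPeriod p (x + lam p) (periodOf w) := by
  obtain ⟨h1, h2⟩ := cf_moebius_expand hp hw.2 hx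
  rw [e] at h1 h2
  refine ⟨periodOf_ne_nil hw.1, fun n => ?_⟩
  have hlen := List.length_pos_iff.mpr (periodOf_ne_nil hw.1)
  conv_lhs => rw [← Nat.div_add_mod n (periodOf w).length]
  rw [cfEntry_add, cfQuotient_mul_of_fixed h2, h1 _ (Nat.mod_lt _ hlen)]

/-- Reading `k` entries equal to one backwards. -/
lemma eq_moebius_matV_of_cfEntry {p k : ℕ} (hp : 3 ≤ p) (hk : k + 1 ≤ p - 1) {x : ℝ}
    (h : ∀ n < k, cfEntry p x n = 1) (hq : lam p ≤ cfQuotient p x k) :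
    x = moebius (matV p (k + 1)) (cfQuotient p x k - lam p) := by
  induction k generalizing x with
  | zero => simp [matV_one, moebius_matS, cfQuotient]
  | succ k ih =>
    have e : cfQuotient p x (k + 1) = cfQuotient p (cfQuotient p x 1) k := by
      rw [add_comm, cfQuotient_add]
    have ih' := ih (x := cfQuotient p x 1) (by omega) (fun n hn => by
      rw [← cfEntry_add, add_comm]; exact h _ (by omega)) (e ▸ hq)
    rw [← e] at ih'
    have hpos := cfQuotient_one_pos hp x
    have hy : 0 ≤ cfQuotient p x (k + 1) - lam p := by linarith
    rw [moebius_matV_succ hp (by omega) (by omega) hy (ih' ▸ hpos), ← ih']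
    have := eq_sub_one_div_cfQuotient p x
    rwa [h 0 (by omega), Int.cast_one, one_mul] at this

/-- Reading the entries listed by `periodOf` backwards. -/
lemma eq_moebius_expand_of_cfEntry {p : ℕ} (hp : 3 ≤ p) {w : List (ℕ × ℕ)}
    (hw : ∀ b ∈ w, 2 ≤ b.2 ∧ b.2 ≤ p - 1) {x : ℝ}
    (h : ∀ n < (periodOf w).length, cfEntry p x n = (periodOf w).getD n 0)
    (hq : lam p ≤ cfQuotient p x (periodOf w).length) :
    lam p ≤ x ∧ x - lam p = moebius (wordMat p (expand w))
      (cfQuotient p x (periodOf w).length - lam p) := by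
  induction w generalizing x with
  | nil => simpa [periodOf, moebius_one, cfQuotient] using hq
  | cons b w ih =>
    have hw' : ∀ b' ∈ w, 2 ≤ b'.2 ∧ b'.2 ≤ p - 1 := fun b' hb' => hw b' (by simp [hb'])
    obtain ⟨m, j⟩ := b
    obtain ⟨hj1, hj2⟩ : 2 ≤ j ∧ j ≤ p - 1 := hw (m, j) (by simp)
    obtain ⟨k, rfl⟩ := Nat.exists_eq_add_of_le' hj1
    rw [moebius_wordMat_expand_cons hp hw (by linarith)]
    rw [periodOf_cons] at h hq ⊢
    dsimp only at h hq ⊢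
    rw [show k + 2 - 2 = k by omega] at h hq ⊢
    simp only [List.length_cons, List.length_append, List.length_replicate] at h hq ⊢
    rw [cfQuotient_add] at hq ⊢
    obtain ⟨i1, i2⟩ := ih hw' (x := cfQuotient p x (k + 1)) (fun n hn => by
      rw [← cfEntry_add, h _ (by omega), List.getD_append_right _ _ _ _ (by simp)]
      simp) hq
    rw [← i2]
    have e : cfQuotient p x (k + 1) = cfQuotient p (cfQuotient p x 1) k := by
      rw [add_comm, cfQuotient_add]
    have h1 : cfQuotient p x 1 = moebius (matV p (k + 1)) (cfQuotient p x (k + 1) - lam p) := by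
      rw [e] at i1 ⊢
      refine eq_moebius_matV_of_cfEntry hp (by omega) (fun n hn => ?_) i1
      rw [← cfEntry_add, h _ (by omega), add_comm 1 n,
        List.getD_append _ _ _ _ (by simp; omega), List.getD_cons_succ,
        List.getD_replicate _ (by omega)]
    have h0 : cfEntry p x 0 = (m : ℤ) + 2 := by rw [h 0 (by omega)]; simp
    refine ⟨lam_le_of_cfEntry_zero hp (by omega), ?_⟩
    have hpos := cfQuotient_one_pos hp x
    have hy : 0 ≤ cfQuotient p x (k + 1) - lam p := by linarith
    rw [moebius_matV_succ hp (by omega) (by omega) hy (h1 ▸ hpos), ← h1]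
    have := eq_sub_one_div_cfQuotient p x
    rw [h0] at this
    push_cast at this
    linarith

/-- A number with period `periodOf w` has, after subtraction of `λ`, an infinite backward orbit of
nonnegative numbers under the generator product. -/
lemma HasCFPeriod.exists_backward_orbit {p : ℕ} (hp : 3 ≤ p) {w : List (ℕ × ℕ)}
    (hw : IsProductData p w) {x : ℝ} (h : HasCFPeriod p x (periodOf w)) :
    ∃ y : ℕ → ℝ, y 0 = x - lam p ∧ (∀ n, 0 ≤ y n) ∧
      ∀ n, y n = moebius (wordMat p (expand w)) (y (n + 1)) := by
  obtain ⟨hne, h⟩ := h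
  set L := (periodOf w).length
  have hlen : 0 < L := List.length_pos_iff.mpr hne
  have hent : ∀ k, ∀ n < L, cfEntry p (cfQuotient p x (L * k)) n = (periodOf w).getD n 0 := by
    intro k n hn
    rw [← cfEntry_add, h, Nat.mul_add_mod, Nat.mod_eq_of_lt hn]
  have hge : ∀ k, lam p ≤ cfQuotient p x (L * k) := by
    intro k
    apply lam_le_of_cfEntry_zero hp
    rw [hent k 0 hlen]
    obtain ⟨hwne, -⟩ := hw
    obtain _ | ⟨b, w⟩ := w
    · exact absurd rfl hwne
    · simp [periodOf_cons]
  refine ⟨fun n => cfQuotient p x (L * n) - lam p, rfl, fun n => by linarith [hge n], fun n => ?_⟩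
  have e : cfQuotient p x (L * (n + 1)) = cfQuotient p (cfQuotient p x (L * n)) L := by
    rw [Nat.mul_succ, cfQuotient_add]
  have := (eq_moebius_expand_of_cfEntry hp hw.2 (hent n) (by rw [← e]; exact hge _)).2
  dsimp only
  rw [e]
  exact this

/-- A positive matrix contracts towards its fixed point, hence the fixed point is the only
nonnegative number with an infinite nonnegative backward orbit. -/
lemma PosEntries.eq_of_backward_orbit {M : SL(2, ℝ)} (hM : PosEntries M) (hN : NonnegEntries M)
    {x : ℝ} (hx : 0 < x) (e : moebius M x = x) {y : ℕ → ℝ} (hy : ∀ n, 0 ≤ y n)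
    (h : ∀ n, y n = moebius M (y (n + 1))) : y 0 = x := by
  have hc := hM.pos_10
  set κ := M 1 0 * x + M 1 1 with hκ
  have hκ1 : 1 < κ := by have := mul_pos hc hx; linarith [hN.one_le_11]
  have hdet := det_eq_one M
  have hstep : ∀ n, κ * |y n - x| ≤ |y (n + 1) - x| := by
    intro n
    have hd := hN.den_pos (hy (n + 1))
    have hd1 : 1 ≤ M 1 0 * y (n + 1) + M 1 1 := by
      have := mul_nonneg hc.le (hy (n + 1)); linarith [hN.one_le_11]
    have e1 := (moebius_eq_iff hd.ne').mp (h n).symm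
    have e2 := (moebius_eq_iff (hN.den_pos hx.le).ne').mp e
    have key : (M 1 0 * y (n + 1) + M 1 1) * (κ * (y n - x)) = y (n + 1) - x := by
      rw [hκ]
      linear_combination (-(M 1 0 * x + M 1 1)) * e1 + (M 1 0 * y (n + 1) + M 1 1) * e2
        + (y (n + 1) - x) * hdet
    rw [← key, abs_mul, abs_mul, abs_of_pos hd, abs_of_pos (by linarith : 0 < κ)]
    exact le_mul_of_one_le_left (by positivity) hd1
  have hpow : ∀ n, κ ^ n * |y 0 - x| ≤ |y n - x| := by
    intro n
    induction n with
    | zero => simp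
    | succ n ih =>
      calc κ ^ (n + 1) * |y 0 - x| = κ * (κ ^ n * |y 0 - x|) := by ring
        _ ≤ κ * |y n - x| := by gcongr
        _ ≤ _ := hstep n
  have hbound : ∀ n, |y n - x| ≤ M 0 0 / M 1 0 + x := by
    intro n
    have h1 : y n ≤ M 0 0 / M 1 0 := by
      rw [h n, moebius, div_le_div_iff₀ (hN.den_pos (hy _)) hc]
      linarith
    rw [abs_le]
    have := hy n
    have : 0 < M 0 0 / M 1 0 := div_pos hM.pos_00 hc
    constructor <;> linarith
  by_contra hne
  have hpos : 0 < |y 0 - x| := abs_pos.mpr (sub_ne_zero.mpr hne)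
  obtain ⟨n, hn⟩ := pow_unbounded_of_one_lt ((M 0 0 / M 1 0 + x) / |y 0 - x|) hκ1
  rw [div_lt_iff₀ hpos] at hn
  linarith [hpow n, hbound n]

/-- The parabolic matrix `V_{p-1}` has no positive number with an infinite nonnegative backward
orbit. -/
lemma eq_zero_of_backward_orbit_matV_pred {p : ℕ} (hp : 3 ≤ p) {y : ℕ → ℝ} (hy : ∀ n, 0 ≤ y n)
    (h : ∀ n, y n = moebius (matV p (p - 1)) (y (n + 1))) : y 0 = 0 := by
  have hl := lam_pos hp
  obtain ⟨e1, e2, e3, e4⟩ := matV_pred_entries hp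
  have hstep : ∀ n, y n * (1 + lam p * y (n + 1)) = y (n + 1) := by
    intro n
    have hd : 0 < lam p * y (n + 1) + 1 := by have := mul_nonneg hl.le (hy (n + 1)); linarith
    have := (moebius_eq_iff (by rw [e3, e4]; exact hd.ne')).mp (h n).symm
    rw [e1, e2, e3, e4] at this
    linarith
  have hsum : ∀ n : ℕ, y 0 * (1 + n * lam p * y n) = y n := by
    intro n
    induction n with
    | zero => simp
    | succ n ih =>
      have hs := hstep n
      have hd : 0 < 1 + lam p * y (n + 1) := by have := mul_nonneg hl.le (hy (n + 1)); linarith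
      apply mul_right_cancel₀ (b := (1 + lam p * y (n + 1))) hd.ne'
      push_cast
      have : y (n + 1) = y n * (1 + lam p * y (n + 1)) := hs.symm
      linear_combination (1 + lam p * y (n + 1)) ^ 2 * ih +
        (1 + lam p * y (n + 1) - y 0 * n * lam p * (1 + lam p * y (n + 1))) * hs
  by_contra hne
  have hpos : 0 < y 0 := lt_of_le_of_ne (hy 0) (Ne.symm hne)
  obtain ⟨n, hn⟩ := exists_nat_gt (1 / (y 0 * lam p))
  rw [div_lt_iff₀ (by positivity)] at hn
  have h1 := hsum n
  have hyn : 0 < y n := by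
    rcases (hy n).lt_or_eq with h | h
    · exact h
    · rw [← h] at h1; simp at h1; exact absurd h1 hne
  nlinarith

lemma HasCFPeriod.eq_of_moebius_eq {p : ℕ} (hp : 3 ≤ p) {w : List (ℕ × ℕ)}
    (hw : IsProductData p w) {x z : ℝ} (hx : 0 < x) (e : moebius (wordMat p (expand w)) x = x)
    (h : HasCFPeriod p z (periodOf w)) : z = x + lam p := by
  have hword := isWord_expand hw.2
  have hne : expand w ≠ [] := by
    obtain ⟨hwne, -⟩ := hw
    obtain _ | ⟨b, w⟩ := w
    · exact absurd rfl hwne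
    · simp [expand_cons]
  obtain ⟨y, hy0, hy, hstep⟩ := h.exists_backward_orbit hp hw
  have := ((isMixed_of_moebius_eq hp hword hne hx e).posEntries hp hword).eq_of_backward_orbit
    (nonnegEntries_wordMat hp hword) hx e hy hstep
  linarith

lemma isReduced_of_moebius_eq {p : ℕ} (hp : 3 ≤ p) {w : List (ℕ × ℕ)} (hw : IsProductData p w)
    {x : ℝ} (hx : 0 < x) (e : moebius (wordMat p (expand w)) x = x) :
    IsReduced p (x + lam p) := by
  have hper := hasCFPeriod_of_moebius_eq hp hw hx e
  refine ⟨⟨_, hper⟩, fun s hs => ?_⟩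
  -- the leading entry is at least two, so the period starts at its only entry that is not one
  have h0 : 2 ≤ cfEntry p (x + lam p) 0 := by
    rw [hper.2 0, Nat.zero_mod]
    obtain ⟨hwne, -⟩ := hw
    obtain _ | ⟨b, w⟩ := w
    · exact absurd rfl hwne
    · simp [periodOf_cons]
  set L : List ℤ := 2 :: List.replicate (p - 3) 1 with hL
  have hlen : 0 < L.length := by simp [hL]
  have hs0 : s % L.length = 0 := by
    by_contra hne
    obtain ⟨k, hk⟩ := Nat.exists_eq_succ_of_ne_zero hne
    have hlt := Nat.mod_lt s hlen
    rw [hs.2 0, Nat.zero_mod, List.getD_eq_getElem _ _ (by rw [List.length_rotate]; exact hlen),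
      List.getElem_rotate] at h0
    simp only [zero_add, hk] at h0
    rw [hk] at hlt
    simp only [hL, Nat.succ_eq_add_one, List.getElem_cons_succ, List.getElem_replicate] at h0
    omega
  rw [← List.rotate_mod, hs0, List.rotate_zero] at hs
  have hdata : IsProductData p [(0, p - 1)] := ⟨by simp, by simp; omega⟩
  have hLp : L = periodOf [(0, p - 1)] := by
    rw [hL, periodOf_cons]
    simp [periodOf, show p - 1 - 2 = p - 3 by omega]
  rw [hLp] at hs
  obtain ⟨y, hy0, hy, hstep⟩ := hs.exists_backward_orbit hp hdata
  have := eq_zero_of_backward_orbit_matV_pred hp hy (by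
    simpa [expand, wordMat] using hstep)
  linarith

/-! ### Simple numbers and continued fractions -/

lemma mem_expand {w : List (ℕ × ℕ)} {i : ℕ} :
    i ∈ expand w ↔ ∃ b ∈ w, i ∈ List.replicate b.1 1 ++ [b.2] := by
  simp only [expand, List.mem_flatMap]

lemma isMixed_expand_rotate {p : ℕ} {w : List (ℕ × ℕ)} (t : ℕ) (h : IsMixed p (expand w)) :
    IsMixed p (expand (w.rotate t)) := by
  obtain ⟨⟨i, hi, hi'⟩, ⟨j, hj, hj'⟩⟩ := h
  rw [mem_expand] at hi hj
  exact ⟨⟨i, mem_expand.mpr (by simpa only [List.mem_rotate] using hi), hi'⟩,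
    ⟨j, mem_expand.mpr (by simpa only [List.mem_rotate] using hj), hj'⟩⟩

lemma IsProductData.rotate {p : ℕ} {w : List (ℕ × ℕ)} (h : IsProductData p w) (t : ℕ) :
    IsProductData p (w.rotate t) := by
  refine ⟨fun h0 => h.1 ?_, fun b hb => h.2 b (List.mem_rotate.mp hb)⟩
  rwa [List.rotate_eq_nil_iff] at h0

/-- The positive fixed point of a generator product. -/
def productRoot (p : ℕ) (w : List (ℕ × ℕ)) : ℝ := (formOf (wordMat p (expand w))).root

lemma productRoot_spec {p : ℕ} (hp : 3 ≤ p) {w : List (ℕ × ℕ)} (hw : IsProductData p w)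
    (hm : IsMixed p (expand w)) :
    0 < productRoot p w ∧ moebius (wordMat p (expand w)) (productRoot p w) = productRoot p w :=
  (hm.posEntries hp (isWord_expand hw.2)).moebius_eq_iff_root.mpr rfl

lemma expand_append (w w' : List (ℕ × ℕ)) : expand (w ++ w') = expand w ++ expand w' := by
  simp [expand]

/-- The first steps of the shift on the root of a generator product strip off the leading letters
`V_1` one at a time. -/
lemma shift_iterate_productRoot {p : ℕ} (hp : 3 ≤ p) {b : ℕ × ℕ} {w : List (ℕ × ℕ)}
    (hw : IsProductData p (b :: w)) (hm : IsMixed p (expand (b :: w))) {i : ℕ} (hi : i ≤ b.1) :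
    (shift p)^[i] (productRoot p (b :: w)) = productRoot p (b :: w) - i * lam p := by
  obtain ⟨hx, e⟩ := productRoot_spec hp hw hm
  set x := productRoot p (b :: w)
  have hword := isWord_expand hw.2
  have hsplit : expand (b :: w) =
      List.replicate i 1 ++ (List.replicate (b.1 - i) 1 ++ b.2 :: expand w) := by
    rw [expand_cons, ← List.append_assoc, List.replicate_append_replicate, Nat.add_sub_cancel' hi]
  rw [hsplit] at e hword
  obtain ⟨h1, h2⟩ := isWord_append.mp hword
  have hz := moebius_wordMat_pos hp h2 hx
  rw [moebius_wordMat_append hp h2 hx] at e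
  have hs := shift_iterate_wordMat hp h1 hz
  rw [e, List.length_replicate] at hs
  rw [hs]
  rw [moebius_wordMat_replicate_one] at e
  linarith

/-- After the first block has been stripped off, the root of the rotated product remains. -/
lemma shift_iterate_productRoot_succ {p : ℕ} (hp : 3 ≤ p) {b : ℕ × ℕ} {w : List (ℕ × ℕ)}
    (hw : IsProductData p (b :: w)) (hm : IsMixed p (expand (b :: w))) :
    (shift p)^[b.1 + 1] (productRoot p (b :: w)) = productRoot p (w ++ [b]) := by
  obtain ⟨hx, e⟩ := productRoot_spec hp hw hm
  have hw' : IsProductData p (w ++ [b]) := by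
    have := hw.rotate 1
    rwa [List.rotate_cons_succ, List.rotate_zero] at this
  have hm' : IsMixed p (expand (w ++ [b])) := by
    have := isMixed_expand_rotate 1 hm
    rwa [List.rotate_cons_succ, List.rotate_zero] at this
  set x := productRoot p (b :: w)
  have hword' := isWord_expand hw'.2
  have hsplit : expand (b :: w) = expand [b] ++ expand w := by rw [← expand_append]; rfl
  rw [expand_append] at hword'
  obtain ⟨h2, h1⟩ := isWord_append.mp hword'
  have hz := moebius_wordMat_pos hp h2 hx
  rw [hsplit, moebius_wordMat_append hp h2 hx] at e
  have hs := shift_iterate_wordMat hp h1 hz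
  have hlen : (expand [b]).length = b.1 + 1 := by simp [expand]
  rw [e, hlen] at hs
  rw [hs]
  refine (hm'.posEntries hp (isWord_expand hw'.2)).moebius_eq_iff_root.mp ⟨hz, ?_⟩
  rw [expand_append, moebius_wordMat_append hp h1 hz, e]

lemma rotate_eq_cons {w : List (ℕ × ℕ)} (t : Fin w.length) :
    ∃ r, w.rotate t = w.get t :: r ∧ w.rotate (t + 1) = r ++ [w.get t] := by
  have hlen : 0 < (w.rotate t).length := by
    rw [List.length_rotate]; exact (Nat.zero_le _).trans_lt t.2
  obtain ⟨b, r, hr⟩ := List.exists_cons_of_length_pos hlen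
  have hb : b = w.get t := by
    have h1 : (w.rotate t)[0] = b := by simp [hr]
    rw [List.getElem_rotate] at h1
    rw [← h1]
    simp [Nat.mod_eq_of_lt t.2]
  refine ⟨r, by rw [hr, hb], ?_⟩
  rw [← List.rotate_rotate, hr, List.rotate_cons_succ, List.rotate_zero, hb]

lemma moebius_matS_inv_pow (p i : ℕ) (x : ℝ) : moebius ((matS p)⁻¹ ^ i) x = x - i * lam p := by
  have h : ((matS p)⁻¹ ^ i) 0 0 = 1 ∧ ((matS p)⁻¹ ^ i) 0 1 = -(i * lam p) ∧
      ((matS p)⁻¹ ^ i) 1 0 = 0 ∧ ((matS p)⁻¹ ^ i) 1 1 = 1 := by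
    induction i with
    | zero => simp
    | succ i ih =>
      obtain ⟨h1, h2, h3, h4⟩ := ih
      rw [pow_succ, mul_apply_00, mul_apply_01, mul_apply_10, mul_apply_11, h1, h2, h3, h4,
        inv_apply_00, inv_apply_01, inv_apply_10, inv_apply_11]
      simp
      ring
  obtain ⟨h1, h2, h3, h4⟩ := h
  rw [moebius, h1, h2, h3, h4]
  ring

lemma isMixed_of_isHyperbolic_genProduct {p : ℕ} (hp : 3 ≤ p) {w : List (ℕ × ℕ)}
    (hw : IsProductData p w) (h : IsHyperbolic (genProduct p w)) : IsMixed p (expand w) := by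
  rw [genProduct_eq_toHecke, isHyperbolic_toHecke_iff] at h
  exact isMixed_of_two_lt_trace hp (isWord_expand hw.2) h

/-- The simple numbers in the class of a generator product are the points on the orbits of the
roots of the rotated products. -/
lemma simpleNumbers_genProduct {p : ℕ} (hp : 3 ≤ p) {w : List (ℕ × ℕ)} (hw : IsProductData p w)
    (hm : IsMixed p (expand w)) :
    simpleNumbers (formClass (ConjClasses.mk (genProduct p w))) =
      {x | ∃ (t : Fin w.length) (i : ℕ), i ≤ (w.get t).1 ∧
        x = productRoot p (w.rotate t) - i * lam p} := by
  obtain ⟨hx0, e0⟩ := productRoot_spec hp hw hm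
  set c := ConjClasses.mk (genProduct p w) with hc
  have hlen : 0 < w.length := List.length_pos_iff.mpr hw.1
  have hit : ∀ (t : Fin w.length) (i : ℕ), i ≤ (w.get t).1 →
      (shift p)^[i] (productRoot p (w.rotate t)) = productRoot p (w.rotate t) - i * lam p := by
    intro t i hi
    obtain ⟨r, hr, -⟩ := rotate_eq_cons t
    have h1 := hw.rotate t
    have h2 := isMixed_expand_rotate t hm
    rw [hr] at h1 h2 ⊢
    exact shift_iterate_productRoot hp h1 h2 hi
  have hnext : ∀ t : Fin w.length, (shift p)^[(w.get t).1 + 1] (productRoot p (w.rotate t)) =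
      productRoot p (w.rotate (t + 1)) := by
    intro t
    obtain ⟨r, hr, hr'⟩ := rotate_eq_cons t
    have h1 := hw.rotate t
    have h2 := isMixed_expand_rotate t hm
    rw [hr']
    rw [hr] at h1 h2 ⊢
    exact shift_iterate_productRoot_succ hp h1 h2
  have hx : productRoot p w ∈ simpleNumbers (formClass c) := by
    rw [mem_simpleNumbers_iff hp]
    refine ⟨expand w, isWord_expand hw.2, hm, ?_, hx0, e0⟩
    rw [hc, genProduct_eq_toHecke]; rfl
  ext y
  rw [mem_simpleNumbers_iff_exists_iterate hp hx]
  constructor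
  · rintro ⟨n, rfl⟩
    induction n with
    | zero => exact ⟨⟨0, hlen⟩, 0, by simp, by simp⟩
    | succ n ih =>
      obtain ⟨t, i, hi, e⟩ := ih
      rw [Function.iterate_succ_apply', e, ← hit t i hi, ← Function.iterate_succ_apply' (shift p)]
      rcases hi.lt_or_eq with h | h
      · exact ⟨t, i + 1, h, hit t (i + 1) h⟩
      · rw [h, hnext]
        refine ⟨⟨(t + 1) % w.length, Nat.mod_lt _ hlen⟩, 0, by simp, ?_⟩
        simp [List.rotate_mod]
  · have hroot : ∀ t : ℕ, t < w.length →
        ∃ n, (shift p)^[n] (productRoot p w) = productRoot p (w.rotate t) := by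
      intro t
      induction t with
      | zero => exact fun _ => ⟨0, by simp⟩
      | succ t ih =>
        intro ht
        obtain ⟨n, hn⟩ := ih (by omega)
        refine ⟨(w.get ⟨t, by omega⟩).1 + 1 + n, ?_⟩
        rw [Function.iterate_add_apply, hn]
        exact hnext ⟨t, by omega⟩
    rintro ⟨t, i, hi, rfl⟩
    obtain ⟨n, hn⟩ := hroot t t.2
    exact ⟨i + n, by rw [Function.iterate_add_apply, hn, hit t i hi]⟩

/-- The continued fraction description of the simple numbers of a class. -/
lemma exists_reduced_numbers {p : ℕ} (hp : 3 ≤ p) {w : List (ℕ × ℕ)} (hw : IsProductData p w)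
    (hh : IsHyperbolic (genProduct p w)) :
    ∃ β : Fin w.length → ℝ,
      (∀ t : Fin w.length, IsReduced p (β t) ∧
        ∀ x : ℝ, HasCFPeriod p x (periodOf (w.rotate t)) ↔ x = β t) ∧
      simpleNumbers (formClass (ConjClasses.mk (genProduct p w))) =
        {x | ∃ (t : Fin w.length) (i : ℕ), 1 ≤ i ∧ i ≤ (w.get t).1 + 1 ∧
          x = moebius ((matS p)⁻¹ ^ i) (β t)} := by
  have hm := isMixed_of_isHyperbolic_genProduct hp hw hh
  refine ⟨fun t => productRoot p (w.rotate t) + lam p, fun t => ?_, ?_⟩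
  · have hw' := hw.rotate t
    obtain ⟨hx, e⟩ := productRoot_spec hp hw' (isMixed_expand_rotate t hm)
    refine ⟨isReduced_of_moebius_eq hp hw' hx e, fun x => ⟨fun h => ?_, ?_⟩⟩
    · exact h.eq_of_moebius_eq hp hw' hx e
    · rintro rfl
      exact hasCFPeriod_of_moebius_eq hp hw' hx e
  · rw [simpleNumbers_genProduct hp hw hm]
    ext x
    constructor
    · rintro ⟨t, i, hi, rfl⟩
      refine ⟨t, i + 1, by omega, by omega, ?_⟩
      rw [moebius_matS_inv_pow]
      push_cast
      ring
    · rintro ⟨t, i, h1, h2, rfl⟩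
      obtain ⟨k, rfl⟩ := Nat.exists_eq_add_of_le' h1
      refine ⟨t, k, by omega, ?_⟩
      rw [moebius_matS_inv_pow]
      push_cast
      ring

/-! ### Values of rational functions -/

/-- The rational function `f` is regular at `z`, with value `v`. -/
def HasValue (f : RatFunc ℂ) (z v : ℂ) : Prop :=
  ∃ n d : Polynomial ℂ, d.eval z ≠ 0 ∧
    f = algebraMap (Polynomial ℂ) (RatFunc ℂ) n / algebraMap (Polynomial ℂ) (RatFunc ℂ) d ∧
    n.eval z = v * d.eval z

lemma algebraMap_ne_zero_of_eval_ne_zero {d : Polynomial ℂ} {z : ℂ} (h : d.eval z ≠ 0) :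
    algebraMap (Polynomial ℂ) (RatFunc ℂ) d ≠ 0 := by
  intro h0
  rw [map_eq_zero_iff _ (RatFunc.algebraMap_injective ℂ)] at h0
  simp [h0] at h

lemma HasValue.const (c z : ℂ) : HasValue (RatFunc.C c) z c :=
  ⟨Polynomial.C c, 1, by simp, by simp, by simp⟩

lemma HasValue.X (z : ℂ) : HasValue RatFunc.X z z :=
  ⟨Polynomial.X, 1, by simp, by simp, by simp⟩

lemma HasValue.add {f g : RatFunc ℂ} {z v w : ℂ} (hf : HasValue f z v) (hg : HasValue g z w) :
    HasValue (f + g) z (v + w) := by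
  obtain ⟨n, d, hd, rfl, e⟩ := hf
  obtain ⟨n', d', hd', rfl, e'⟩ := hg
  refine ⟨n * d' + n' * d, d * d', by simp [hd, hd'], ?_, ?_⟩
  · have h1 := algebraMap_ne_zero_of_eval_ne_zero hd
    have h2 := algebraMap_ne_zero_of_eval_ne_zero hd'
    rw [div_add_div _ _ h1 h2]
    simp only [map_mul, map_add]
    ring
  · simp only [Polynomial.eval_add, Polynomial.eval_mul, e, e']
    ring

lemma HasValue.mul {f g : RatFunc ℂ} {z v w : ℂ} (hf : HasValue f z v) (hg : HasValue g z w) :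
    HasValue (f * g) z (v * w) := by
  obtain ⟨n, d, hd, rfl, e⟩ := hf
  obtain ⟨n', d', hd', rfl, e'⟩ := hg
  refine ⟨n * n', d * d', by simp [hd, hd'], ?_, ?_⟩
  · rw [div_mul_div_comm, map_mul, map_mul]
  · simp only [Polynomial.eval_mul, e, e']
    ring

lemma HasValue.neg {f : RatFunc ℂ} {z v : ℂ} (hf : HasValue f z v) : HasValue (-f) z (-v) := by
  have := (HasValue.const (-1) z).mul hf
  simpa using this

lemma HasValue.inv {f : RatFunc ℂ} {z v : ℂ} (hf : HasValue f z v) (hv : v ≠ 0) :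
    HasValue f⁻¹ z v⁻¹ := by
  obtain ⟨n, d, hd, rfl, e⟩ := hf
  refine ⟨d, n, ?_, inv_div _ _, ?_⟩
  · rw [e]; exact mul_ne_zero hv hd
  · rw [e]; field_simp

lemma HasValue.pow {f : RatFunc ℂ} {z v : ℂ} (hf : HasValue f z v) (n : ℕ) :
    HasValue (f ^ n) z (v ^ n) := by
  induction n with
  | zero => simpa using HasValue.const 1 z
  | succ n ih => rw [pow_succ, pow_succ]; exact ih.mul hf

lemma HasValue.unique {f : RatFunc ℂ} {z v w : ℂ} (hf : HasValue f z v) (hg : HasValue f z w) :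
    v = w := by
  obtain ⟨n, d, hd, rfl, e⟩ := hf
  obtain ⟨n', d', hd', e1, e'⟩ := hg
  rw [div_eq_div_iff (algebraMap_ne_zero_of_eval_ne_zero hd)
    (algebraMap_ne_zero_of_eval_ne_zero hd'), ← map_mul, ← map_mul] at e1
  have := congrArg (Polynomial.eval z) (RatFunc.algebraMap_injective ℂ e1)
  simp only [Polynomial.eval_mul, e, e'] at this
  apply mul_right_cancel₀ (mul_ne_zero hd hd')
  linear_combination this

lemma exists_hasValue_sum {ι : Type*} (s : Finset ι) (f : ι → RatFunc ℂ) (z : ℂ)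
    (h : ∀ i ∈ s, ∃ v, HasValue (f i) z v) : ∃ v, HasValue (∑ i ∈ s, f i) z v := by
  classical
  induction s using Finset.induction_on with
  | empty => exact ⟨0, by simpa using HasValue.const 0 z⟩
  | insert a s ha ih =>
    obtain ⟨v, hv⟩ := h a (by simp)
    obtain ⟨w, hw⟩ := ih fun i hi => h i (by simp [hi])
    exact ⟨v + w, by rw [Finset.sum_insert ha]; exact hv.add hw⟩

lemma not_isPole_iff {f : RatFunc ℂ} {z : ℂ} : ¬ IsPole f z ↔ ∃ v, HasValue f z v := by
  constructor
  · intro h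
    have h : f.denom.eval z ≠ 0 := h
    exact ⟨f.num.eval z / f.denom.eval z, f.num, f.denom, h, (RatFunc.num_div_denom f).symm,
      by field_simp⟩
  · rintro ⟨v, n, d, hd, rfl, -⟩ h
    exact hd (Polynomial.IsRoot.dvd h (RatFunc.denom_div_dvd n d))

lemma HasValue.eval₂ {m : RatFunc ℂ} {z w : ℂ} (hm : HasValue m z w) (P : Polynomial ℂ) :
    HasValue (P.eval₂ RatFunc.C m) z (P.eval w) := by
  induction P using Polynomial.induction_on' with
  | add P Q hP hQ => rw [Polynomial.eval₂_add, Polynomial.eval_add]; exact hP.add hQ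
  | monomial n a =>
    rw [Polynomial.eval₂_monomial, Polynomial.eval_monomial]
    exact (HasValue.const a z).mul (hm.pow n)

/-! ### The slash operator -/

/-- The affine function `r X + s`. -/
def affine (r s : ℝ) : RatFunc ℂ := RatFunc.C (r : ℂ) * RatFunc.X + RatFunc.C (s : ℂ)

lemma affine_hasValue (r s : ℝ) (z : ℂ) : HasValue (affine r s) z (r * z + s) :=
  ((HasValue.const _ z).mul (HasValue.X z)).add (HasValue.const _ z)

lemma affine_ne_zero {r s : ℝ} (h : r ≠ 0 ∨ s ≠ 0) : affine r s ≠ 0 := by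
  intro h0
  have key : ∀ z : ℂ, (r : ℂ) * z + s = 0 := fun z => by
    have h1 := affine_hasValue r s z
    rw [h0] at h1
    exact h1.unique (by simpa using HasValue.const 0 z)
  have hs : (s : ℂ) = 0 := by simpa using key 0
  have hr : (r : ℂ) = 0 := by simpa [hs] using key 1
  rcases h with h | h
  · exact h (by exact_mod_cast hr)
  · exact h (by exact_mod_cast hs)

lemma slash_eq (k : ℕ) (q : RatFunc ℂ) (M : SL(2, ℝ)) :
    slash k q M = affine (M 1 0) (M 1 1) ^ (-(2 * (k : ℤ))) *
      RatFunc.eval RatFunc.C (affine (M 0 0) (M 0 1) / affine (M 1 0) (M 1 1)) q := rfl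

/-- The complex Möbius action. -/
def cmoebius (M : SL(2, ℝ)) (z : ℂ) : ℂ := (M 0 0 * z + M 0 1) / (M 1 0 * z + M 1 1)

/-- The slash operator carries regularity at `M z` to regularity at `z`. -/
lemma not_isPole_slash {k : ℕ} {q : RatFunc ℂ} {M : SL(2, ℝ)} {z : ℂ}
    (hz : (M 1 0 : ℂ) * z + M 1 1 ≠ 0) (h : ¬ IsPole q (cmoebius M z)) :
    ¬ IsPole (slash k q M) z := by
  have h : q.denom.eval (cmoebius M z) ≠ 0 := h
  rw [not_isPole_iff, slash_eq, zpow_neg, RatFunc.eval, div_eq_mul_inv (Polynomial.eval₂ _ _ _)]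
  have hd := affine_hasValue (M 1 0) (M 1 1) z
  have hm := (affine_hasValue (M 0 0) (M 0 1) z).mul (hd.inv hz)
  rw [← div_eq_mul_inv, ← div_eq_mul_inv] at hm
  refine ⟨_, HasValue.mul (HasValue.inv (v := (M 1 0 * z + M 1 1) ^ (2 * k)) ?_ (pow_ne_zero _ hz))
    ((hm.eval₂ q.num).mul ((hm.eval₂ q.denom).inv h))⟩
  have := hd.pow (2 * k)
  rwa [← zpow_natCast, Nat.cast_mul, Nat.cast_ofNat] at this

lemma slash_one (k : ℕ) (q : RatFunc ℂ) : slash k q 1 = q := by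
  have h1 : affine 0 1 = 1 := by simp [affine]
  have h2 : affine 1 0 = RatFunc.X := by simp [affine]
  rw [slash_eq]
  simp only [Matrix.SpecialLinearGroup.coe_one, Matrix.one_apply_eq, ne_eq, zero_ne_one,
    not_false_eq_true, Matrix.one_apply_ne, one_ne_zero, h1, h2, one_zpow, one_mul, div_one]
  have key : ∀ P : Polynomial ℂ, P.eval₂ RatFunc.C RatFunc.X
      = algebraMap (Polynomial ℂ) (RatFunc ℂ) P := fun P => by
    rw [← RatFunc.aeval_X_left_eq_algebraMap]; rfl
  rw [RatFunc.eval, key, key, RatFunc.num_div_denom]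

/-- Substitution of a Möbius transformation in a nonzero polynomial does not give zero. -/
lemma eval₂_moebius_ne_zero (M : SL(2, ℝ)) {P : Polynomial ℂ} (hP : P ≠ 0) :
    P.eval₂ RatFunc.C (affine (M 0 0) (M 0 1) / affine (M 1 0) (M 1 1)) ≠ 0 := by
  set m := affine (M 0 0) (M 0 1) / affine (M 1 0) (M 1 1) with hm
  intro h0
  have hdet := det_eq_one M
  have hne : affine (M 1 0) (M 1 1) ≠ 0 := by
    apply affine_ne_zero
    by_contra! h
    rw [h.1, h.2] at hdet
    simp at hdet
  -- an algebraic element would be constant, and `m` is not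
  have halg : IsAlgebraic ℂ m := ⟨P, hP, h0⟩
  obtain ⟨r, hr⟩ := minpoly.mem_range_of_degree_eq_one ℂ m
    (IsAlgClosed.degree_eq_one_of_irreducible ℂ (minpoly.irreducible halg.isIntegral))
  rw [RatFunc.algebraMap_eq_C, hm, eq_div_iff hne] at hr
  have key : ∀ z : ℂ, r * (M 1 0 * z + M 1 1) = M 0 0 * z + M 0 1 := fun z => by
    have h1 := (HasValue.const r z).mul (affine_hasValue (M 1 0) (M 1 1) z)
    rw [hr] at h1
    exact h1.unique (affine_hasValue _ _ z)
  have e0 := key 0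
  have e1 := key 1
  have hdet' : (M 0 0 : ℂ) * M 1 1 - M 0 1 * M 1 0 = 1 := by exact_mod_cast hdet
  have : (0 : ℂ) = 1 := by
    linear_combination hdet' + (M 1 1 : ℂ) * (e1 - e0) - (M 1 0 : ℂ) * e0
  exact zero_ne_one this

/-- Substitution of an element that is transcendental over `ℂ`, as a ring homomorphism. -/
def evalHom (m : RatFunc ℂ) (hm : ∀ P : Polynomial ℂ, P ≠ 0 → P.eval₂ RatFunc.C m ≠ 0) :
    RatFunc ℂ →+* RatFunc ℂ :=
  RatFunc.liftRingHom (Polynomial.eval₂RingHom RatFunc.C m)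
    (by
      intro P hP
      exact mem_nonZeroDivisors_of_ne_zero (hm P (nonZeroDivisors.ne_zero hP)))

lemma evalHom_apply {m : RatFunc ℂ} (hm : ∀ P : Polynomial ℂ, P ≠ 0 → P.eval₂ RatFunc.C m ≠ 0)
    (q : RatFunc ℂ) : evalHom m hm q = RatFunc.eval RatFunc.C m q :=
  RatFunc.liftRingHom_apply _ _ q

lemma evalHom_C {m : RatFunc ℂ} (hm : ∀ P : Polynomial ℂ, P ≠ 0 → P.eval₂ RatFunc.C m ≠ 0)
    (c : ℂ) : evalHom m hm (RatFunc.C c) = RatFunc.C c := by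
  rw [evalHom_apply, RatFunc.eval_C]

lemma evalHom_X {m : RatFunc ℂ} (hm : ∀ P : Polynomial ℂ, P ≠ 0 → P.eval₂ RatFunc.C m ≠ 0) :
    evalHom m hm RatFunc.X = m := by
  rw [evalHom_apply, RatFunc.eval_X]

/-- Substitution of the Möbius transformation of `M`. -/
def substHom (M : SL(2, ℝ)) : RatFunc ℂ →+* RatFunc ℂ :=
  evalHom (affine (M 0 0) (M 0 1) / affine (M 1 0) (M 1 1)) fun _ => eval₂_moebius_ne_zero M

lemma slash_eq_substHom (k : ℕ) (q : RatFunc ℂ) (M : SL(2, ℝ)) :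
    slash k q M = affine (M 1 0) (M 1 1) ^ (-(2 * (k : ℤ))) * substHom M q := by
  rw [slash_eq]
  exact congrArg _ (evalHom_apply _ q).symm

lemma substHom_C (M : SL(2, ℝ)) (c : ℂ) : substHom M (RatFunc.C c) = RatFunc.C c :=
  evalHom_C _ c

lemma substHom_X (M : SL(2, ℝ)) :
    substHom M RatFunc.X = affine (M 0 0) (M 0 1) / affine (M 1 0) (M 1 1) :=
  evalHom_X _

lemma slash_sub (k : ℕ) (f g : RatFunc ℂ) (M : SL(2, ℝ)) :
    slash k (f - g) M = slash k f M - slash k g M := by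
  simp only [slash_eq_substHom, map_sub, mul_sub]

lemma slash_sum {ι : Type*} (s : Finset ι) (k : ℕ) (f : ι → RatFunc ℂ) (M : SL(2, ℝ)) :
    slash k (∑ i ∈ s, f i) M = ∑ i ∈ s, slash k (f i) M := by
  simp only [slash_eq_substHom, map_sum, Finset.mul_sum]

/-! ### Poles of rational period functions -/

lemma IsRPF.isPole_neg_inv {p k : ℕ} {q : RatFunc ℂ} (hq : IsRPF p k q) {z : ℂ} (hz : z ≠ 0)
    (h : IsPole q z) : IsPole q (-1 / z) := by
  by_contra h'
  have hT : cmoebius matT z = -1 / z := by simp [cmoebius]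
  have hreg : ¬ IsPole (slash k q matT) z :=
    not_isPole_slash (by simpa using hz) (by rwa [hT])
  obtain ⟨v, hv⟩ := not_isPole_iff.mp hreg
  have : q = -slash k q matT := eq_neg_of_add_eq_zero_left hq.1
  have hv' := hv.neg
  rw [← this] at hv'
  exact not_isPole_iff.mpr ⟨_, hv'⟩ h

lemma NonnegEntries.one_le_re_den {M : SL(2, ℝ)} (hM : NonnegEntries M) {z : ℂ} (hz : 0 ≤ z.re) :
    1 ≤ ((M 1 0 : ℂ) * z + M 1 1).re := by
  have := mul_nonneg hM.nonneg_10 hz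
  simp only [Complex.add_re, Complex.mul_re, Complex.ofReal_re, Complex.ofReal_im, zero_mul,
    sub_zero]
  linarith [hM.one_le_11]

lemma NonnegEntries.cden_ne_zero {M : SL(2, ℝ)} (hM : NonnegEntries M) {z : ℂ} (hz : 0 ≤ z.re) :
    (M 1 0 : ℂ) * z + M 1 1 ≠ 0 := by
  intro h
  have := hM.one_le_re_den hz
  rw [h] at this
  norm_num at this

/-- If `T z` is a pole and `z` lies in the closed right half plane then some `V_j z` is a pole:
the second relation for `q` cannot have only one singular term at `T z`. -/
lemma IsRPF.exists_isPole_matV {p k : ℕ} (hp : 3 ≤ p) {q : RatFunc ℂ} (hq : IsRPF p k q) {z : ℂ}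
    (hz : z ≠ 0) (hre : 0 ≤ z.re) (h : IsPole q (-1 / z)) :
    ∃ j, 1 ≤ j ∧ j ≤ p - 1 ∧ IsPole q (cmoebius (matV p j) z) := by
  by_contra! hno
  have hreg : ∀ j ∈ Finset.range (p - 1),
      ∃ v, HasValue (slash k q (matU p ^ (j + 1))) (-1 / z) v := by
    intro j hj
    rw [Finset.mem_range] at hj
    rw [← not_isPole_iff, ← matV_mul_matT (by omega)]
    have hd := (nonnegEntries_matV hp (show 1 ≤ j + 1 by omega) (by omega)).cden_ne_zero hre
    have hden : ((matV p (j + 1) * matT) 1 0 : ℂ) * (-1 / z) + (matV p (j + 1) * matT) 1 1 =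
        -(matV p (j + 1) 1 0 * z + matV p (j + 1) 1 1) / z := by
      simp only [mul_apply_10, mul_apply_11, matT_00, matT_01, matT_10, matT_11]
      push_cast
      field_simp
      ring
    apply not_isPole_slash
    · rw [hden]
      exact div_ne_zero (neg_ne_zero.mpr hd) hz
    · have : cmoebius (matV p (j + 1) * matT) (-1 / z) = cmoebius (matV p (j + 1)) z := by
        rw [cmoebius, cmoebius, hden, div_div_eq_mul_div, div_eq_div_iff (neg_ne_zero.mpr hd) hd]
        simp only [mul_apply_00, mul_apply_01, matT_00, matT_01, matT_10, matT_11]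
        push_cast
        field_simp
        ring
      rw [this]
      exact hno (j + 1) (by omega) (by omega)
  obtain ⟨v, hv⟩ := exists_hasValue_sum _ _ _ hreg
  have hsum := hq.2
  obtain ⟨i, hi⟩ := Nat.exists_eq_add_of_le' (show 1 ≤ p by omega)
  rw [hi, Finset.sum_range_succ', pow_zero, slash_one] at hsum
  rw [hi, Nat.add_sub_cancel] at hv
  have : q = -∑ j ∈ Finset.range i, slash k q (matU (i + 1) ^ (j + 1)) :=
    eq_neg_of_add_eq_zero_right hsum
  have hv' := hv.neg
  rw [← this] at hv'
  exact not_isPole_iff.mpr ⟨_, hv'⟩ h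

lemma NonnegEntries.cmoebius_re_nonneg {M : SL(2, ℝ)} (hM : NonnegEntries M) {z : ℂ}
    (hz : 0 ≤ z.re) : 0 ≤ (cmoebius M z).re := by
  have hN : 0 < Complex.normSq (M 1 0 * z + M 1 1) :=
    Complex.normSq_pos.mpr (hM.cden_ne_zero hz)
  rw [cmoebius, Complex.div_re, ← add_div]
  apply div_nonneg _ hN.le
  simp only [Complex.add_re, Complex.mul_re, Complex.ofReal_re, Complex.ofReal_im, zero_mul,
    sub_zero, Complex.add_im, Complex.mul_im, add_zero]
  obtain ⟨h1, h2, h3, h4⟩ := hM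
  have ha : 0 ≤ M 0 0 := by linarith
  have hd : 0 ≤ M 1 1 := by linarith
  have := sq_nonneg z.im
  have e : (M 0 0 * z.re + M 0 1) * (M 1 0 * z.re + M 1 1) + M 0 0 * z.im * (M 1 0 * z.im) =
      M 0 0 * M 1 0 * (z.re * z.re + z.im ^ 2) + (M 0 0 * M 1 1 + M 0 1 * M 1 0) * z.re
        + M 0 1 * M 1 1 := by ring
  rw [e]
  positivity

lemma NonnegEntries.cmoebius_ne_zero {M : SL(2, ℝ)} (hM : NonnegEntries M) {z : ℂ}
    (hz : 0 ≤ z.re) (hz0 : z ≠ 0) : cmoebius M z ≠ 0 := by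
  rw [cmoebius]
  refine div_ne_zero (fun h => hz0 ?_) (hM.cden_ne_zero hz)
  have hre := congrArg Complex.re h
  have him := congrArg Complex.im h
  simp only [Complex.add_re, Complex.mul_re, Complex.ofReal_re, Complex.ofReal_im, zero_mul,
    sub_zero, Complex.add_im, Complex.mul_im, add_zero, Complex.zero_re, Complex.zero_im] at hre him
  have ha : 0 < M 0 0 := by linarith [hM.one_le_00]
  have := hM.nonneg_01
  apply Complex.ext
  · rw [Complex.zero_re]; nlinarith
  · exact (mul_eq_zero.mp him).resolve_left ha.ne'

lemma cmoebius_mul (M N : SL(2, ℝ)) {z : ℂ} (hz : (N 1 0 : ℂ) * z + N 1 1 ≠ 0) :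
    cmoebius (M * N) z = cmoebius M (cmoebius N z) := by
  simp only [cmoebius, mul_apply_00, mul_apply_01, mul_apply_10, mul_apply_11]
  push_cast
  rw [← mul_div_mul_right _ ((M 1 0 : ℂ) * _ + M 1 1) hz]
  congr 1 <;> field_simp <;> ring

lemma cmoebius_one (z : ℂ) : cmoebius 1 z = z := by simp [cmoebius]

lemma cmoebius_ofReal (M : SL(2, ℝ)) (x : ℝ) : cmoebius M x = (moebius M x : ℝ) := by
  simp [cmoebius, moebius]

lemma NonnegEntries.im_eq_zero {M : SL(2, ℝ)} (hM : NonnegEntries M) {z : ℂ} (hz : 0 ≤ z.re)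
    (h : (cmoebius M z).im = 0) : z.im = 0 := by
  have hN : 0 < Complex.normSq (M 1 0 * z + M 1 1) :=
    Complex.normSq_pos.mpr (hM.cden_ne_zero hz)
  rw [cmoebius, Complex.div_im, ← sub_div, div_eq_zero_iff] at h
  have h := h.resolve_right hN.ne'
  simp only [Complex.add_re, Complex.mul_re, Complex.ofReal_re, Complex.ofReal_im, zero_mul,
    sub_zero, Complex.add_im, Complex.mul_im, add_zero] at h
  linear_combination h - z.im * det_eq_one M

/-- The fixed points of a nonempty word are real. -/
lemma im_eq_zero_of_cmoebius_wordMat_eq {p : ℕ} (hp : 3 ≤ p) {l : List ℕ} (hl : IsWord p l)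
    (hne : l ≠ []) {z : ℂ} (hz : 0 ≤ z.re) (h : cmoebius (wordMat p l) z = z) : z.im = 0 := by
  have hN := nonnegEntries_wordMat hp hl
  have hoff : 0 < wordMat p l 0 1 ∨ 0 < wordMat p l 1 0 := by
    obtain _ | ⟨j, l'⟩ := l
    · exact absurd rfl hne
    have hj := (isWord_cons.mp hl).1
    rcases lt_or_ge j 2 with h | h
    · exact .inl (wordMat_01_pos hp hl (j := j) (by simp) (by omega))
    · exact .inr (wordMat_10_pos hp hl (j := j) (by simp) h)
  rw [cmoebius, div_eq_iff (hN.cden_ne_zero hz)] at h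
  have hre := congrArg Complex.re h
  have him := congrArg Complex.im h
  simp only [Complex.add_re, Complex.mul_re, Complex.ofReal_re, Complex.ofReal_im, zero_mul,
    sub_zero, Complex.add_im, Complex.mul_im, add_zero] at hre him
  by_contra hz0
  have h1 : 2 * wordMat p l 1 0 * z.re + wordMat p l 1 1 - wordMat p l 0 0 = 0 := by
    have : (2 * wordMat p l 1 0 * z.re + wordMat p l 1 1 - wordMat p l 0 0) * z.im = 0 := by
      linear_combination -him
    exact (mul_eq_zero.mp this).resolve_right hz0
  have h2 : wordMat p l 1 0 * (z.re ^ 2 + z.im ^ 2) + wordMat p l 0 1 = 0 := by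
    linear_combination hre + z.re * h1
  have hpos : 0 < z.re ^ 2 + z.im ^ 2 := by positivity
  have h01 := hN.nonneg_01
  have h10 := mul_nonneg hN.nonneg_10 hpos.le
  rcases hoff with h | h
  · linarith
  · have := mul_pos h hpos
    linarith

lemma finite_isPole (q : RatFunc ℂ) : {z | IsPole q z}.Finite := by
  refine (q.denom.roots.toFinset.finite_toSet).subset fun z hz => ?_
  simp only [Finset.mem_coe, Multiset.mem_toFinset]
  exact (Polynomial.mem_roots q.denom_ne_zero).mpr hz

/-- The poles of a rational period function in the closed right half plane, apart from `0`, are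
real: following poles `z, V_j z, V_i V_j z, …` leads to a pole that is fixed by a word. -/
lemma IsRPF.im_eq_zero {p k : ℕ} (hp : 3 ≤ p) {q : RatFunc ℂ} (hq : IsRPF p k q) {z : ℂ}
    (hz0 : z ≠ 0) (hre : 0 ≤ z.re) (h : IsPole q z) : z.im = 0 := by
  set P : Set ℂ := {z | IsPole q z ∧ z ≠ 0 ∧ 0 ≤ z.re} with hP
  have hfin : P.Finite := (finite_isPole q).subset fun z hz => hz.1
  have hstep : ∀ y : P, ∃ y' : P, ∃ j, (1 ≤ j ∧ j ≤ p - 1) ∧ (y' : ℂ) = cmoebius (matV p j) y := by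
    rintro ⟨y, hy, hy0, hyre⟩
    obtain ⟨j, h1, h2, hj⟩ := hq.exists_isPole_matV hp hy0 hyre (hq.isPole_neg_inv hy0 hy)
    have hV := nonnegEntries_matV hp h1 h2
    exact ⟨⟨_, hj, hV.cmoebius_ne_zero hyre hy0, hV.cmoebius_re_nonneg hyre⟩, j, ⟨h1, h2⟩, rfl⟩
  choose G hG using hstep
  have hiter : ∀ n, ∀ y : P, ∃ l, IsWord p l ∧ l.length = n ∧
      ((G^[n] y : P) : ℂ) = cmoebius (wordMat p l) y := by
    intro n y
    induction n with
    | zero => exact ⟨[], isWord_nil p, rfl, by simp [cmoebius_one]⟩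
    | succ n ih =>
      obtain ⟨l, hl, hlen, e⟩ := ih
      obtain ⟨j, hj, ej⟩ := hG (G^[n] y)
      refine ⟨j :: l, isWord_cons.mpr ⟨hj, hl⟩, by simp [hlen], ?_⟩
      rw [Function.iterate_succ_apply', ej, e, wordMat_cons,
        cmoebius_mul _ _ ((nonnegEntries_wordMat hp hl).cden_ne_zero y.2.2.2)]
  have : Finite P := hfin
  set z' : P := ⟨z, h, hz0, hre⟩
  obtain ⟨m, n, hmn, e⟩ := Finite.exists_ne_map_eq_of_infinite fun n : ℕ => G^[n] z'
  wlog hlt : m < n generalizing m n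
  · exact this n m hmn.symm e.symm (by omega)
  obtain ⟨i, rfl⟩ := Nat.exists_eq_add_of_lt hlt
  rw [show m + i + 1 = (i + 1) + m by omega, Function.iterate_add_apply] at e
  obtain ⟨l, hl, hlen, el⟩ := hiter (i + 1) (G^[m] z')
  rw [← e] at el
  have hreal := im_eq_zero_of_cmoebius_wordMat_eq hp hl (by rintro rfl; simp at hlen)
    (G^[m] z').2.2.2 el.symm
  obtain ⟨l', hl', -, el'⟩ := hiter m z'
  rw [el'] at hreal
  exact (nonnegEntries_wordMat hp hl').im_eq_zero hre hreal

/-- The positive poles of a rational period function are permuted by the shift. -/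
lemma IsRPF.shift_isPole {p k : ℕ} (hp : 3 ≤ p) {q : RatFunc ℂ} (hq : IsRPF p k q) {x : ℝ}
    (hx : 0 < x) (h : IsPole q x) :
    (0 < shift p x ∧ IsPole q (shift p x : ℝ)) ∧ x ∈ Function.periodicPts (shift p) := by
  set P : Set ℝ := {x | 0 < x ∧ IsPole q (x : ℝ)} with hP
  have hfin : P.Finite :=
    ((finite_isPole q).preimage Complex.ofReal_injective.injOn).subset fun x hx => hx.2
  have hstep : ∀ y : P, ∃ y' : P, shift p y' = y := by
    rintro ⟨y, hy0, hy⟩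
    have hyc : (y : ℂ) ≠ 0 := by exact_mod_cast hy0.ne'
    obtain ⟨j, h1, h2, hj⟩ :=
      hq.exists_isPole_matV hp hyc (by simpa using hy0.le) (hq.isPole_neg_inv hyc hy)
    rw [cmoebius_ofReal] at hj
    exact ⟨⟨_, (nonnegEntries_matV hp h1 h2).moebius_pos hy0, hj⟩, shift_moebius_matV hp h1 h2 hy0⟩
  choose G hG using hstep
  have : Finite P := hfin
  have hinj : Function.Injective G := fun a b hab => by
    apply Subtype.ext
    rw [← hG a, ← hG b, hab]
  have hsurj := Finite.surjective_of_injective hinj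
  have hmaps : ∀ y : P, shift p y ∈ P := by
    intro y
    obtain ⟨y', rfl⟩ := hsurj y
    rw [hG]; exact y'.2
  refine ⟨hmaps ⟨x, hx, h⟩, ?_⟩
  set f : P → P := fun y => ⟨shift p y, hmaps y⟩ with hf
  have hfG : ∀ y, f (G y) = y := fun y => Subtype.ext (hG y)
  have hfinj : Function.Injective f := by
    intro a b hab
    obtain ⟨a', rfl⟩ := hsurj a
    obtain ⟨b', rfl⟩ := hsurj b
    rw [hfG, hfG] at hab
    rw [hab]
  obtain ⟨n, hn, hper⟩ := hfinj.mem_periodicPts ⟨x, hx, h⟩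
  refine ⟨n, hn, ?_⟩
  have hsemi : Function.Semiconj (Subtype.val : P → ℝ) f (shift p) := fun y => rfl
  have := (hsemi.iterate_right n) ⟨x, hx, h⟩
  rw [Function.IsPeriodicPt, Function.IsFixedPt] at hper ⊢
  rw [← this, hper]

lemma IsRPF.iterate_shift_isPole {p k : ℕ} (hp : 3 ≤ p) {q : RatFunc ℂ} (hq : IsRPF p k q) {x : ℝ}
    (hx : 0 < x) (h : IsPole q x) (n : ℕ) :
    0 < (shift p)^[n] x ∧ IsPole q ((shift p)^[n] x : ℝ) := by
  induction n with
  | zero => exact ⟨hx, h⟩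
  | succ n ih =>
    rw [Function.iterate_succ_apply']
    exact (hq.shift_isPole hp ih.1 ih.2).1

/-! ### Rational period functions of weight two with prescribed poles -/

/-- The action of a matrix on column vectors. -/
def act (M : SL(2, ℝ)) (w : ℝ × ℝ) : ℝ × ℝ :=
  (M 0 0 * w.1 + M 0 1 * w.2, M 1 0 * w.1 + M 1 1 * w.2)

lemma act_mul (M N : SL(2, ℝ)) (w : ℝ × ℝ) : act (M * N) w = act M (act N w) := by
  simp only [act, mul_apply_00, mul_apply_01, mul_apply_10, mul_apply_11]
  ext <;> dsimp only <;> ring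

lemma act_neg (M : SL(2, ℝ)) (w : ℝ × ℝ) : act (-M) w = (-1 : ℝ) • act M w := by
  simp only [act, neg_apply]
  ext <;> simp <;> ring

lemma act_smul (M : SL(2, ℝ)) (t : ℝ) (w : ℝ × ℝ) : act M (t • w) = t • act M w := by
  simp only [act]
  ext <;> simp <;> ring

lemma act_one (w : ℝ × ℝ) : act 1 w = w := by
  simp [act]

/-- The rational function with a simple pole of residue one at the point `u / v` of the projective
line, as a function of the vector `(u, v)`; it vanishes for the point at infinity. -/
def simplePole (w : ℝ × ℝ) : RatFunc ℂ := RatFunc.C (w.2 : ℂ) / affine w.2 (-w.1)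

lemma simplePole_smul {t : ℝ} (ht : t ≠ 0) (w : ℝ × ℝ) : simplePole (t • w) = simplePole w := by
  have hC : (RatFunc.C (t : ℂ) : RatFunc ℂ) ≠ 0 := by
    rw [Ne, map_eq_zero]; exact_mod_cast ht
  have : affine (t * w.2) (-(t * w.1)) = RatFunc.C (t : ℂ) * affine w.2 (-w.1) := by
    simp only [affine]
    push_cast
    simp only [map_mul, map_neg]
    ring
  simp only [simplePole, Prod.smul_fst, Prod.smul_snd, smul_eq_mul, this]
  push_cast
  rw [map_mul, mul_div_mul_left _ _ hC]

/-- In weight two the slash operator permutes the functions `simplePole`, up to a term that depends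
only on the matrix. This is the transformation rule of logarithmic differentials. -/
lemma slash_simplePole (M : SL(2, ℝ)) {w : ℝ × ℝ} (hw : w ≠ 0) :
    slash 1 (simplePole w) M =
      simplePole (act M⁻¹ w) - RatFunc.C ((M 1 0 : ℝ) : ℂ) / affine (M 1 0) (M 1 1) := by
  obtain ⟨u, v⟩ := w
  have hdet := det_eq_one M
  have hD : affine (M 1 0) (M 1 1) ≠ 0 := by
    apply affine_ne_zero
    by_contra! h
    rw [h.1, h.2] at hdet
    simp at hdet
  have hL : affine (-M 1 0 * u + M 0 0 * v) (-(M 1 1 * u + -M 0 1 * v)) ≠ 0 := by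
    apply affine_ne_zero
    by_contra! h
    obtain ⟨h1, h2⟩ := h
    have hu : u = 0 := by
      linear_combination (-u) * hdet + M 0 1 * h1 - M 0 0 * h2
    have hv : v = 0 := by
      linear_combination (-v) * hdet + M 1 1 * h1 + (-M 1 0) * h2
    exact hw (by rw [hu, hv]; rfl)
  have hdetC : RatFunc.C ((M 0 0 : ℝ) : ℂ) * RatFunc.C ((M 1 1 : ℝ) : ℂ) -
      RatFunc.C ((M 0 1 : ℝ) : ℂ) * RatFunc.C ((M 1 0 : ℝ) : ℂ) = 1 := by
    rw [← map_mul, ← map_mul, ← map_sub, ← map_one RatFunc.C]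
    congr 1
    exact_mod_cast hdet
  rw [slash_eq_substHom, simplePole, simplePole]
  simp only [act, inv_apply_00, inv_apply_01, inv_apply_10, inv_apply_11]
  have hsub : substHom M (affine v (-u)) =
      affine (-M 1 0 * u + M 0 0 * v) (-(M 1 1 * u + -M 0 1 * v)) / affine (M 1 0) (M 1 1) := by
    rw [affine, map_add, map_mul, substHom_C, substHom_C, substHom_X, eq_div_iff hD, add_mul,
      mul_assoc, div_mul_cancel₀ _ hD]
    simp only [affine]
    push_cast
    simp only [map_mul, map_neg, map_add]
    ring
  rw [map_div₀, substHom_C, hsub]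
  have hpow : affine (M 1 0) (M 1 1) ^ (-(2 * ((1 : ℕ) : ℤ))) = (affine (M 1 0) (M 1 1) ^ 2)⁻¹ := by
    rw [zpow_neg]; norm_cast
  rw [hpow]
  have key : RatFunc.C ((v : ℝ) : ℂ) =
      RatFunc.C ((-M 1 0 * u + M 0 0 * v : ℝ) : ℂ) * affine (M 1 0) (M 1 1) -
      RatFunc.C ((M 1 0 : ℝ) : ℂ) *
        affine (-M 1 0 * u + M 0 0 * v) (-(M 1 1 * u + -M 0 1 * v)) := by
    simp only [affine]
    push_cast
    simp only [map_mul, map_neg, map_add]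
    linear_combination (-RatFunc.C (v : ℂ)) * hdetC
  set D := affine (M 1 0) (M 1 1)
  set L := affine (-M 1 0 * u + M 0 0 * v) (-(M 1 1 * u + -M 0 1 * v))
  generalize RatFunc.C ((-M 1 0 * u + M 0 0 * v : ℝ) : ℂ) = α at key ⊢
  generalize RatFunc.C ((M 1 0 : ℝ) : ℂ) = γ at key ⊢
  rw [key]
  field_simp

/-- The sum of the simple poles at the orbit of a point under the powers of `U`. -/
def orbitSum (p : ℕ) (w : ℝ × ℝ) : RatFunc ℂ :=
  ∑ j ∈ Finset.range p, simplePole (act (matU p ^ j)⁻¹ w)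

lemma orbitSum_smul {p : ℕ} {t : ℝ} (ht : t ≠ 0) (w : ℝ × ℝ) :
    orbitSum p (t • w) = orbitSum p w := by
  simp only [orbitSum, act_smul, simplePole_smul ht]

lemma orbitSum_matU {p : ℕ} (hp : 3 ≤ p) (w : ℝ × ℝ) :
    orbitSum p (act (matU p) w) = orbitSum p w := by
  obtain ⟨i, rfl⟩ := Nat.exists_eq_add_of_le' (show 1 ≤ p by omega)
  rw [orbitSum, orbitSum, Finset.sum_range_succ', Finset.sum_range_succ]
  congr 1
  · refine Finset.sum_congr rfl fun j _ => ?_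
    rw [← act_mul, pow_succ', mul_inv_rev, inv_mul_cancel_right]
  · have h : matU (i + 1) = -(matU (i + 1) ^ i)⁻¹ := by
      have : (matU (i + 1) ^ i)⁻¹ = -matU (i + 1) := by
        apply inv_eq_of_mul_eq_one_right
        rw [mul_neg, ← pow_succ, matU_pow_self hp, neg_neg]
      rw [this, neg_neg]
    rw [pow_zero, inv_one, act_one]
    conv_lhs => rw [h, act_neg, simplePole_smul (by norm_num)]

lemma orbitSum_matU_pow {p : ℕ} (hp : 3 ≤ p) (n : ℕ) (w : ℝ × ℝ) :
    orbitSum p (act (matU p ^ n) w) = orbitSum p w := by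
  induction n with
  | zero => rw [pow_zero, act_one]
  | succ n ih => rw [pow_succ', act_mul, orbitSum_matU hp, ih]

/-- If `x = V_j y` then the point `x` and the point `T y` have the same orbit under `U`. -/
lemma orbitSum_shift {p : ℕ} (hp : 3 ≤ p) {x : ℝ} (h : 0 < shift p x) :
    orbitSum p (x, 1) = orbitSum p (-1, shift p x) := by
  obtain ⟨j, h1, h2, e⟩ := exists_of_shift_pos h
  have hd := (nonnegEntries_matV hp h1 h2).den_pos h.le
  have hV := matV_eq_neg (p := p) h1
  set y := shift p x
  have e1 : act (matV p j) (y, 1) = (matV p j 1 0 * y + matV p j 1 1) • (x, (1 : ℝ)) := by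
    rw [eq_comm, moebius_eq_iff hd.ne'] at e
    simp only [act, Prod.smul_mk, smul_eq_mul, mul_one, e]
    rw [mul_comm x]
  have e2 : act matT (y, 1) = (-1, y) := by simp [act]
  rw [← orbitSum_smul hd.ne', ← e1, hV, act_neg, orbitSum_smul (by norm_num), act_mul, e2,
    orbitSum_matU_pow hp]

/-- The rational function whose residues are `1` on the first `n` points of the orbit of `x` under
the shift, and `-1` at their images under `T`. -/
def orbitRPF (p : ℕ) (x : ℝ) (n : ℕ) : RatFunc ℂ :=
  ∑ i ∈ Finset.range n, (simplePole ((shift p)^[i] x, 1) - simplePole (-1, (shift p)^[i] x))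

lemma isRPF_orbitRPF {p : ℕ} (hp : 3 ≤ p) {x : ℝ} (hx : 0 < x) {n : ℕ}
    (hn : Function.IsPeriodicPt (shift p) n x) (hn0 : 0 < n) : IsRPF p 1 (orbitRPF p x n) := by
  have hpos := iterate_shift_pos hp hx ⟨n, hn0, hn⟩
  have hterm : ∀ (M : SL(2, ℝ)) (y : ℝ), slash 1 (simplePole (y, 1) - simplePole (-1, y)) M =
      simplePole (act M⁻¹ (y, 1)) - simplePole (act M⁻¹ (-1, y)) := by
    intro M y
    rw [slash_sub, slash_simplePole M (by simp), slash_simplePole M (by simp)]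
    ring
  constructor
  · rw [orbitRPF, slash_sum, ← Finset.sum_add_distrib]
    refine Finset.sum_eq_zero fun i _ => ?_
    rw [hterm]
    set y := (shift p)^[i] x
    have e1 : act matT⁻¹ (y, 1) = (-1 : ℝ) • (-1, y) := by
      simp only [act, inv_apply_00, inv_apply_01, inv_apply_10, inv_apply_11]; simp
    have e2 : act matT⁻¹ (-1, y) = (y, 1) := by
      simp only [act, inv_apply_00, inv_apply_01, inv_apply_10, inv_apply_11]; simp
    rw [e1, e2, simplePole_smul (by norm_num)]
    ring
  · have : ∀ j, slash 1 (orbitRPF p x n) (matU p ^ j) = ∑ i ∈ Finset.range n,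
        (simplePole (act (matU p ^ j)⁻¹ ((shift p)^[i] x, 1)) -
          simplePole (act (matU p ^ j)⁻¹ (-1, (shift p)^[i] x))) := by
      intro j
      rw [orbitRPF, slash_sum]
      exact Finset.sum_congr rfl fun i _ => hterm _ _
    simp only [this]
    rw [Finset.sum_comm]
    have : ∀ i, ∑ j ∈ Finset.range p, (simplePole (act (matU p ^ j)⁻¹ ((shift p)^[i] x, 1)) -
          simplePole (act (matU p ^ j)⁻¹ (-1, (shift p)^[i] x))) =
        orbitSum p (-1, (shift p)^[i + 1] x) - orbitSum p (-1, (shift p)^[i] x) := by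
      intro i
      rw [Finset.sum_sub_distrib]
      have hp' := hpos (i + 1)
      rw [Function.iterate_succ_apply'] at hp' ⊢
      rw [← orbitSum_shift hp hp']
      rfl
    simp only [this]
    -- the orbit is periodic, so the sum telescopes to zero
    rw [Finset.sum_range_sub (fun i => orbitSum p (-1, (shift p)^[i] x)), hn.eq]
    simp

lemma isPole_sum_iff (S : Finset ℂ) (ε : ℂ → ℂ) (hε : ∀ s ∈ S, ε s ≠ 0) (z : ℂ) :
    IsPole (∑ s ∈ S, RatFunc.C (ε s) / (RatFunc.X - RatFunc.C s)) z ↔ z ∈ S := by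
  classical
  have hlin : ∀ s z : ℂ, HasValue (RatFunc.X - RatFunc.C s) z (z - s) := by
    intro s z
    rw [sub_eq_add_neg, sub_eq_add_neg]
    exact (HasValue.X z).add (HasValue.const s z).neg
  have hreg : ∀ S' : Finset ℂ, z ∉ S' →
      ∃ v, HasValue (∑ s ∈ S', RatFunc.C (ε s) / (RatFunc.X - RatFunc.C s)) z v := by
    intro S' hz
    refine exists_hasValue_sum _ _ _ fun s hs => ?_
    rw [div_eq_mul_inv]
    exact ⟨_, (HasValue.const (ε s) z).mul ((hlin s z).inv
      (sub_ne_zero.mpr (by rintro rfl; exact hz hs)))⟩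
  constructor
  · intro h
    by_contra hz
    exact not_isPole_iff.mpr (hreg S hz) h
  · intro hz
    by_contra h
    obtain ⟨v, hv⟩ := not_isPole_iff.mp h
    obtain ⟨v', hv'⟩ := hreg (S.erase z) (Finset.notMem_erase z S)
    rw [← Finset.add_sum_erase _ _ hz] at hv
    have h1 := hv.add hv'.neg
    rw [add_neg_cancel_right] at h1
    have h2 := h1.mul (hlin z z)
    have hne : (RatFunc.X - RatFunc.C z : RatFunc ℂ) ≠ 0 := by
      intro h0
      have h3 := hlin z (z + 1)
      rw [h0] at h3
      have := h3.unique (by simpa using HasValue.const 0 (z + 1))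
      simp at this
    rw [div_mul_cancel₀ _ hne, sub_self, mul_zero] at h2
    exact hε z hz ((HasValue.const (ε z) z).unique h2)

/-- There is a rational period function of weight two whose poles are the points on the orbit of a
periodic point under the shift, together with their images under `T`. -/
lemma exists_isRPF {p : ℕ} (hp : 3 ≤ p) {x : ℝ} (hx : 0 < x)
    (hper : x ∈ Function.periodicPts (shift p)) :
    ∃ q, IsRPF p 1 q ∧ ∀ z : ℂ, IsPole q z ↔
      ∃ i, z = ((shift p)^[i] x : ℝ) ∨ z = ((-1 / (shift p)^[i] x : ℝ) : ℂ) := by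
  classical
  set n := Function.minimalPeriod (shift p) x with hn
  have hn0 : 0 < n := Function.minimalPeriod_pos_of_mem_periodicPts hper
  have hnper : Function.IsPeriodicPt (shift p) n x := Function.isPeriodicPt_minimalPeriod _ _
  have hpos := iterate_shift_pos hp hx hper
  refine ⟨orbitRPF p x n, isRPF_orbitRPF hp hx hnper hn0, fun z => ?_⟩
  set a : ℕ → ℂ := fun i => ((shift p)^[i] x : ℝ) with ha
  set b : ℕ → ℂ := fun i => ((-1 / (shift p)^[i] x : ℝ) : ℂ) with hb
  have hinj : Set.InjOn (fun i => (shift p)^[i] x) (Finset.range n) := by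
    intro i hi j hj hij
    rw [Finset.coe_range, Set.mem_Iio] at hi hj
    exact (Function.iterate_eq_iterate_iff_of_lt_minimalPeriod hi hj).mp hij
  have hainj : Set.InjOn a (Finset.range n) := fun i hi j hj hij =>
    hinj hi hj (Complex.ofReal_injective hij)
  have hbinj : Set.InjOn b (Finset.range n) := fun i hi j hj hij => by
    refine hinj hi hj ?_
    have := Complex.ofReal_injective hij
    rw [div_eq_div_iff (hpos i).ne' (hpos j).ne'] at this
    dsimp only
    linarith
  set A := (Finset.range n).image a
  set B := (Finset.range n).image b
  have hApos : ∀ z ∈ A, 0 < z.re := by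
    intro z hz
    obtain ⟨i, -, rfl⟩ := Finset.mem_image.mp hz
    simpa [ha] using hpos i
  have hBneg : ∀ z ∈ B, z.re < 0 := by
    intro z hz
    obtain ⟨i, -, rfl⟩ := Finset.mem_image.mp hz
    rw [hb]
    dsimp only
    rw [Complex.ofReal_re]
    exact div_neg_of_neg_of_pos (by norm_num) (hpos i)
  have hdisj : Disjoint A B := by
    rw [Finset.disjoint_left]
    intro z h1 h2
    linarith [hApos z h1, hBneg z h2]
  set ε : ℂ → ℂ := fun z => if z ∈ A then 1 else -1 with hε
  have hq : orbitRPF p x n = ∑ s ∈ A ∪ B, RatFunc.C (ε s) / (RatFunc.X - RatFunc.C s) := by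
    rw [Finset.sum_union hdisj, Finset.sum_image hainj, Finset.sum_image hbinj,
      ← Finset.sum_add_distrib, orbitRPF]
    refine Finset.sum_congr rfl fun i hi => ?_
    have h1 : ε (a i) = 1 := if_pos (Finset.mem_image_of_mem a hi)
    have h2 : ε (b i) = -1 :=
      if_neg (Finset.disjoint_right.mp hdisj (Finset.mem_image_of_mem b hi))
    have e1 : simplePole ((shift p)^[i] x, 1) = RatFunc.C (ε (a i)) /
        (RatFunc.X - RatFunc.C (a i)) := by
      rw [h1]; simp [simplePole, affine, ha, sub_eq_add_neg]
    have e2 : simplePole (-1, (shift p)^[i] x) = 1 / (RatFunc.X - RatFunc.C (b i)) := by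
      have hy := (hpos i).ne'
      have : ((-1 : ℝ), (shift p)^[i] x) = (shift p)^[i] x • (-1 / (shift p)^[i] x, (1 : ℝ)) := by
        ext <;> simp; field_simp
      rw [this, simplePole_smul hy]
      simp [simplePole, affine, hb, sub_eq_add_neg]
    rw [e1, e2, h2, map_neg, map_one, neg_div _ (1 : RatFunc ℂ), ← sub_eq_add_neg]
  rw [hq, isPole_sum_iff _ _ (fun s _ => by rw [hε]; dsimp only; split_ifs <;> norm_num)]
  have hmod : ∀ i, (shift p)^[i % n] x = (shift p)^[i] x := fun i => hnper.iterate_mod_apply i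
  simp only [A, B, Finset.mem_union, Finset.mem_image, Finset.mem_range, ha, hb]
  constructor
  · rintro (⟨i, -, rfl⟩ | ⟨i, -, rfl⟩)
    · exact ⟨i, .inl rfl⟩
    · exact ⟨i, .inr rfl⟩
  · rintro ⟨i, rfl | rfl⟩
    · exact .inl ⟨i % n, Nat.mod_lt _ hn0, by rw [hmod]⟩
    · exact .inr ⟨i % n, Nat.mod_lt _ hn0, by rw [hmod]⟩

/-! ### Irreducible systems of poles -/

/-- The numbers on the orbit of a periodic point of the shift and their images under `T`. -/
def orbitPoles (p : ℕ) (x : ℝ) : Set ℂ :=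
  {z | ∃ i, z = ((shift p)^[i] x : ℝ) ∨ z = ((-1 / (shift p)^[i] x : ℝ) : ℂ)}

lemma poleSet_eq_orbitPoles {p : ℕ} (hp : 3 ≤ p) {c : ConjClasses (heckeGroup p)} {x : ℝ}
    (hx : x ∈ simpleNumbers (formClass c)) : poleSet (formClass c) = orbitPoles p x := by
  have key := fun y => mem_simpleNumbers_iff_exists_iterate hp hx (y := y)
  ext z
  simp only [poleSet, orbitPoles, Set.mem_image, Set.mem_union, Set.mem_ofPred_eq, key,
    moebius_matT]
  constructor
  · rintro ⟨y, ⟨i, rfl⟩ | ⟨-, ⟨i, rfl⟩, rfl⟩, rfl⟩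
    · exact ⟨i, .inl rfl⟩
    · exact ⟨i, .inr rfl⟩
  · rintro ⟨i, rfl | rfl⟩
    · exact ⟨_, .inl ⟨i, rfl⟩, rfl⟩
    · exact ⟨_, .inr ⟨_, ⟨i, rfl⟩, rfl⟩, rfl⟩

lemma IsRPF.orbitPoles_subset {p k : ℕ} (hp : 3 ≤ p) {q : RatFunc ℂ} (hq : IsRPF p k q) {x : ℝ}
    (hx : 0 < x) (h : IsPole q x) : ∀ z ∈ orbitPoles p x, IsPole q z := by
  rintro z ⟨i, rfl | rfl⟩
  · exact (hq.iterate_shift_isPole hp hx h i).2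
  · obtain ⟨hpos, hpole⟩ := hq.iterate_shift_isPole hp hx h i
    have := hq.isPole_neg_inv (by exact_mod_cast hpos.ne') hpole
    push_cast
    exact this

/-- The irreducible system of poles of a positive periodic point `x`, or of `T x`. -/
lemma forces_iff_mem_orbitPoles {p : ℕ} (hp : 3 ≤ p) {x : ℝ} (hx : 0 < x)
    (hper : x ∈ Function.periodicPts (shift p)) {z : ℂ} (hz : z = x ∨ z = -1 / (x : ℂ)) (y : ℂ) :
    (y ≠ 0 ∧ Forces p z y) ↔ y ∈ orbitPoles p x := by
  have hxc : (x : ℂ) ≠ 0 := by exact_mod_cast hx.ne'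
  have hzx : ∀ {k : ℕ} {q : RatFunc ℂ}, IsRPF p k q → (IsPole q z ↔ IsPole q x) := by
    intro k q hq
    rcases hz with rfl | rfl
    · rfl
    · constructor
      · intro h
        have := hq.isPole_neg_inv (div_ne_zero (by norm_num) hxc) h
        rwa [div_div_eq_mul_div, neg_one_mul, neg_div_neg_eq, div_one] at this
      · exact hq.isPole_neg_inv hxc
  constructor
  · rintro ⟨hy0, hy⟩
    obtain ⟨q, hq, hpoles⟩ := exists_isRPF hp hx hper
    exact (hpoles y).mp (hy 1 q one_pos hq ((hzx hq).mpr ((hpoles x).mpr ⟨0, .inl rfl⟩)))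
  · intro hy
    constructor
    · obtain ⟨i, rfl | rfl⟩ := hy
      · exact_mod_cast (iterate_shift_pos hp hx hper i).ne'
      · exact_mod_cast div_ne_zero (by norm_num) (iterate_shift_pos hp hx hper i).ne'
    · exact fun k q _ hq h => hq.orbitPoles_subset hp hx ((hzx hq).mp h) y hy

lemma isISP_orbitPoles {p : ℕ} (hp : 3 ≤ p) {x : ℝ} (hx : 0 < x)
    (hper : x ∈ Function.periodicPts (shift p)) : IsISP p (orbitPoles p x) := by
  obtain ⟨q, hq, hpoles⟩ := exists_isRPF hp hx hper
  refine ⟨x, by exact_mod_cast hx.ne', ⟨1, q, one_pos, hq, (hpoles x).mpr ⟨0, .inl rfl⟩⟩, ?_⟩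
  ext y
  exact (forces_iff_mem_orbitPoles hp hx hper (.inl rfl) y).symm

/-- Every irreducible system of poles comes from a periodic point of the shift. -/
lemma IsISP.exists_eq_orbitPoles {p : ℕ} (hp : 3 ≤ p) {P : Set ℂ} (hP : IsISP p P) :
    ∃ x, 0 < x ∧ x ∈ Function.periodicPts (shift p) ∧ P = orbitPoles p x := by
  obtain ⟨z, hz0, ⟨k, q, -, hq, hpole⟩, rfl⟩ := hP
  -- either `z` or `T z` lies in the closed right half plane, where the poles are positive numbers
  have key : ∀ w : ℂ, w ≠ 0 → 0 ≤ w.re → IsPole q w → (z = w ∨ z = -1 / w) →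
      ∃ x, 0 < x ∧ x ∈ Function.periodicPts (shift p) ∧
        {y | y ≠ 0 ∧ Forces p z y} = orbitPoles p x := by
    intro w hw0 hre hw hzw
    have him := hq.im_eq_zero hp hw0 hre hw
    obtain ⟨x, rfl⟩ : ∃ x : ℝ, w = x := ⟨w.re, Complex.ext rfl (by simpa using him)⟩
    have hx : 0 < x := lt_of_le_of_ne (by simpa using hre) (by
      rintro rfl; exact hw0 (by simp))
    have hper := (hq.shift_isPole hp hx hw).2
    exact ⟨x, hx, hper, Set.ext fun y => forces_iff_mem_orbitPoles hp hx hper hzw y⟩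
  rcases le_total 0 z.re with h | h
  · exact key z hz0 h hpole (.inl rfl)
  · refine key (-1 / z) (div_ne_zero (by norm_num) hz0) ?_ (hq.isPole_neg_inv hz0 hpole) (.inr ?_)
    · rw [Complex.div_re]
      have hn := Complex.normSq_nonneg z
      simp only [Complex.neg_re, Complex.one_re, Complex.neg_im, Complex.one_im]
      rw [neg_zero, zero_mul, zero_div, add_zero, neg_one_mul]
      exact div_nonneg (by linarith) hn
    · rw [div_div_eq_mul_div, neg_one_mul, neg_div_neg_eq, div_one]

/-- The positive elements of `orbitPoles` are the points of the orbit. -/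
lemma mem_simpleNumbers_of_mem_poleSet {p : ℕ} (hp : 3 ≤ p) {c : ConjClasses (heckeGroup p)}
    {x : ℝ} (hx : 0 < x) (h : (x : ℂ) ∈ poleSet (formClass c)) :
    x ∈ simpleNumbers (formClass c) := by
  obtain ⟨y, hy | ⟨y', hy', rfl⟩, e⟩ := h
  · obtain rfl : y = x := Complex.ofReal_injective e
    exact hy
  · have e := Complex.ofReal_injective e
    rw [moebius_matT] at e
    have := div_neg_of_neg_of_pos (show (-1 : ℝ) < 0 by norm_num) (pos_of_mem_simpleNumbers hp hy')
    linarith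

lemma bijOn_poleSet {p : ℕ} (hp : 3 ≤ p) :
    Set.BijOn (fun c : ConjClasses (heckeGroup p) => poleSet (formClass c))
      {c | IsPrimitiveHyperbolicClass c} {P | IsISP p P} := by
  refine ⟨fun c hc => ?_, fun c hc d hd h => ?_, fun P hP => ?_⟩
  · obtain ⟨x, hx⟩ := exists_mem_simpleNumbers hp hc
    change IsISP p (poleSet (formClass c))
    rw [poleSet_eq_orbitPoles hp hx]
    exact isISP_orbitPoles hp (pos_of_mem_simpleNumbers hp hx)
      (mem_periodicPts_of_mem_simpleNumbers hp hx)
  · obtain ⟨x, hx⟩ := exists_mem_simpleNumbers hp hc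
    have hmem : (x : ℂ) ∈ poleSet (formClass c) := ⟨x, .inl hx, rfl⟩
    have h : poleSet (formClass c) = poleSet (formClass d) := h
    rw [h] at hmem
    exact eq_of_mem_simpleNumbers hp hc hd hx
      (mem_simpleNumbers_of_mem_poleSet hp (pos_of_mem_simpleNumbers hp hx) hmem)
  · obtain ⟨x, hx, hper, rfl⟩ := IsISP.exists_eq_orbitPoles hp hP
    obtain ⟨c, hc, hxc⟩ := exists_class_of_mem_periodicPts hp hx hper
    exact ⟨c, hc, poleSet_eq_orbitPoles hp hxc⟩

end

end HeckeRPF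

theorem theorem3p3 (p : ℕ) (hp : 3 ≤ p) :
    -- `c ↦ P_𝒜` is a bijection from primitive hyperbolic conjugacy classes to ISPs
    Set.BijOn
      (fun c : ConjClasses (HeckeRPF.heckeGroup p) => HeckeRPF.poleSet (HeckeRPF.formClass c))
      {c | HeckeRPF.IsPrimitiveHyperbolicClass c}
      {P | HeckeRPF.IsISP p P} ∧
    -- every primitive hyperbolic conjugacy class contains a generator product
    (∀ c : ConjClasses (HeckeRPF.heckeGroup p), HeckeRPF.IsPrimitiveHyperbolicClass c →
      ∃ w : List (ℕ × ℕ), HeckeRPF.IsProductData p w ∧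
        ConjClasses.mk (HeckeRPF.genProduct p w) = c) ∧
    -- the explicit form of the correspondence
    (∀ w : List (ℕ × ℕ), HeckeRPF.IsProductData p w →
      HeckeRPF.IsPrimitive (HeckeRPF.genProduct p w) →
      HeckeRPF.IsHyperbolic (HeckeRPF.genProduct p w) →
      ∃ β : Fin w.length → ℝ,
        (∀ t : Fin w.length, HeckeRPF.IsReduced p (β t) ∧
          ∀ x : ℝ, HeckeRPF.HasCFPeriod p x (HeckeRPF.periodOf (w.rotate t)) ↔ x = β t) ∧
        HeckeRPF.simpleNumbers
            (HeckeRPF.formClass (ConjClasses.mk (HeckeRPF.genProduct p w))) =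
          {x | ∃ (t : Fin w.length) (i : ℕ), 1 ≤ i ∧ i ≤ (w.get t).1 + 1 ∧
            x = HeckeRPF.moebius ((HeckeRPF.matS p)⁻¹ ^ i) (β t)}) := by
  exact ⟨HeckeRPF.bijOn_poleSet hp, fun _ hc => HeckeRPF.exists_genProduct hp hc,
    fun _ hw _ hh => HeckeRPF.exists_reduced_numbers hp hw hh⟩
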